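/- Let $1<p_0,p,q<\infty$. A weight on $\mathbb{R}$ is a locally integrable function that is positive almost everywhere; for a weight $W$ put $$[W]_{A_{p_0}^+}=\sup_{a<b<c}\frac1{c-a}\int_a^bW\left(\frac1{c-a}\int_b^cW^{-\frac1{p_0-1}}\right)^{p_0-1},$$ and write $W\in A_{p_0}^+$ if this is finite. For $w\ge 0$ let $\|f\|_{L^r(w^r)}=\left(\int_{\mathbb R}|f|^rw^r\right)^{1/r}$. For a real-valued locally integrable $b$ let $\|b\|_{BMO}=\sup_I\frac1{|I|}\int_I|b-b_I|$, where $I$ runs over the bounded intervals and $b_I=\frac1{|I|}\int_Ib$; write $b\in BMO$ if this is finite. Then there is a constant $\kappa>0$, depending only on $p_0,p,q$, and for every integer $k\ge1$ there is a constant $C$, depending only on $p_0,p,q,k$, such that the following holds. Let $\varphi:[0,\infty)\to[0,\infty)$ be a function, $C_0\ge 0$, and let $T$ be a linear operator from a linear space of complex-valued measurable functions on $\mathbb{R}$ (modulo almost everywhere equality) to measurable functions, such that for every $w\geq 0$ with $w^q\in A_{p_0}^+$ the operator $T$ is defined on $L^p(w^p)$ and $$\|Tf\|_{L^q(w^q)}\le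 C_0\,\varphi\big([w^q]_{A_{p_0}^+}\big)\|f\|_{L^p(w^p)}\qquad(f\in L^p(w^p)).$$ Put $T_b^1f=[b,T]f=bT(f)-T(bf)$ and $T_b^kf=[b,T_b^{k-1}]f$ for $k>1$. Then for every $b\in BMO$, every $w\ge 0$ with $w^q\in A_{p_0}^+$ and every $f\in L^p(w^p)$, the function $T_b^kf$ is well defined and $$\|T_b^kf\|_{L^q(w^q)}\le C\,C_0\,\varphi\big(\kappa[w^q]_{A_{p_0}^+}\big)\,[w^q]_{A_{p_0}^+}^{k\max\{1,\frac1{p_0-1}\}}\,\|b\|_{BMO}^k\,\|f\|_{L^p(w^p)}.$$ -/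

import Mathlib

open MeasureTheory Set
open scoped ENNReal NNReal

noncomputable section

/-- The constant `[W]_{A_p^+}`, the supremum over `a < b < c` of
`(1/(c-a) ∫_a^b W) * (1/(c-a) ∫_b^c W^(-1/(p-1)))^(p-1)`, as an extended nonnegative real. -/
def ApPlusConst (p : ℝ) (W : ℝ → ℝ≥0) : ℝ≥0∞ :=
  ⨆ (a : ℝ) (b : ℝ) (c : ℝ) (_ : a < b) (_ : b < c),
    ((∫⁻ x in Ioo a b, (W x : ℝ≥0∞)) / ENNReal.ofReal (c - a)) *
      ((∫⁻ x in Ioo b c, (W x : ℝ≥0∞) ^ (-1 / (p - 1))) / ENNReal.ofReal (c - a)) ^ (p - 1)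

/-- The class `A_p^+` of weights on the line: `W` is locally integrable, positive almost
everywhere (so that `W^(-1/(p-1))` is a function) and `[W]_{A_p^+} < ∞`. -/
structure MemApPlus (p : ℝ) (W : ℝ → ℝ≥0) : Prop where
  locallyIntegrable : LocallyIntegrable (fun x => (W x : ℝ)) volume
  pos : ∀ᵐ x : ℝ, 0 < W x
  const_lt_top : ApPlusConst p W < ∞

/-- The measure `w(x)^r dx`. -/
def powMeasure (w : ℝ → ℝ≥0) (r : ℝ) : Measure ℝ :=
  volume.withDensity fun x => ((w x ^ r : ℝ≥0) : ℝ≥0∞)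

/-- `‖f‖_{L^r(w^r)} = (∫ |f|^r w^r)^(1/r)`. -/
def weightedNorm (w : ℝ → ℝ≥0) (r : ℝ) (f : ℝ →ₘ[volume] ℂ) : ℝ≥0∞ :=
  eLpNorm f (ENNReal.ofReal r) (powMeasure w r)

/-- The `BMO` seminorm: the supremum over bounded intervals `I = (a, c)` of
`1/|I| ∫_I |b - b_I|`, where `b_I` is the mean of `b` over `I`. -/
def bmoNorm (b : ℝ →ₘ[volume] ℝ) : ℝ≥0∞ :=
  ⨆ (a : ℝ) (c : ℝ) (_ : a < c),
    (∫⁻ x in Ioo a c, ‖b x - ⨍ y in Ioo a c, b y‖ₑ) / ENNReal.ofReal (c - a)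

/-- `b ∈ BMO(ℝ)`, for real-valued `b`. -/
structure MemBMO (b : ℝ →ₘ[volume] ℝ) : Prop where
  locallyIntegrable : LocallyIntegrable b volume
  norm_lt_top : bmoNorm b < ∞

/-- Multiplication by the real-valued function `b` on complex-valued measurable functions
modulo almost everywhere equality. -/
def mulBy (b : ℝ →ₘ[volume] ℝ) : (ℝ →ₘ[volume] ℂ) →ₗ[ℂ] (ℝ →ₘ[volume] ℂ) where
  toFun f := AEEqFun.comp ((↑) : ℝ → ℂ) Complex.continuous_ofReal b * f
  map_add' f g := by
    induction f using AEEqFun.induction_on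
    induction g using AEEqFun.induction_on
    induction b using AEEqFun.induction_on
    simp only [AEEqFun.comp_mk, AEEqFun.mk_add_mk, AEEqFun.mk_mul_mk, AEEqFun.mk_eq_mk]
    filter_upwards with x
    simp only [Pi.mul_apply, Pi.add_apply, mul_add]
  map_smul' c f := by
    induction f using AEEqFun.induction_on
    induction b using AEEqFun.induction_on
    simp only [AEEqFun.comp_mk, AEEqFun.smul_mk, AEEqFun.mk_mul_mk, RingHom.id_apply,
      AEEqFun.mk_eq_mk]
    filter_upwards with x
    simp only [Pi.mul_apply, Pi.smul_apply, smul_eq_mul]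
    ring

/-- A linear operator, defined on some subspace of the space of complex-valued measurable
functions on the line (modulo almost everywhere equality), with values in that space. -/
abbrev LineOperator := (ℝ →ₘ[volume] ℂ) →ₗ.[ℂ] (ℝ →ₘ[volume] ℂ)

/-- The commutator `[b, T] f = b T f - T (b f)`, defined for those `f` for which both `f` and
`b f` lie in the domain of `T`. -/
def commutatorOp (b : ℝ →ₘ[volume] ℝ) (T : LineOperator) : LineOperator where
  domain := T.domain ⊓ T.domain.comap (mulBy b)
  toFun :=
    { toFun := fun f => mulBy b (T ⟨f, f.2.1⟩) - T ⟨mulBy b f, f.2.2⟩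
      map_add' := fun f g => by
        have h₁ : (⟨(f + g : _), (f + g).2.1⟩ : T.domain) = ⟨f, f.2.1⟩ + ⟨g, g.2.1⟩ := rfl
        have h₂ : (⟨mulBy b (f + g : _), (f + g).2.2⟩ : T.domain)
            = ⟨mulBy b f, f.2.2⟩ + ⟨mulBy b g, g.2.2⟩ :=
          Subtype.ext (map_add (mulBy b) f.1 g.1)
        rw [h₁, h₂, T.map_add, T.map_add, map_add]
        abel
      map_smul' := fun c f => by
        have h₁ : (⟨(c • f : _), (c • f).2.1⟩ : T.domain) = c • ⟨f, f.2.1⟩ := rfl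
        have h₂ : (⟨mulBy b (c • f : _), (c • f).2.2⟩ : T.domain) = c • ⟨mulBy b f, f.2.2⟩ :=
          Subtype.ext (map_smul (mulBy b) c f.1)
        rw [h₁, h₂, T.map_smul, T.map_smul, map_smul, RingHom.id_apply, smul_sub] }

/-- The iterated commutators: `T_b^0 = T` and `T_b^(k+1) = [b, T_b^k]`. -/
def iterCommutator (b : ℝ →ₘ[volume] ℝ) (T : LineOperator) : ℕ → LineOperator
  | 0 => T
  | k + 1 => commutatorOp b (iterCommutator b T k)

end

/-! The commutator is a Taylor coefficient: formally, `T_b^k f` is the `k`-th derivative at `0` of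
`z ↦ exp (z b) T (exp (-z b) f)`. Cauchy's formula on `|z| = r` bounds it by `k! / r^k` times the
largest norm of this family on the circle. With `s = Re z`, the norm of a member in `L^q(w^q)` is
that of `T (exp (-z b) f)` for the weight `w exp (s b)`, and for the same weight `exp (-z b) f` has
the norm that `f` has for `w`. So it suffices that `w^q exp (q s b)` keeps a comparable `A^+`
constant for `|s| ≤ r`, with `r` of the order of `1 / (‖b‖ [w^q]^max(1, 1/(p₀-1)))`.

This stability (`PerturbationData.apPlusConst_le`) combines a one-sided reverse Hölder inequality of
exponent `1 + δ`, applied to the weight and to its reflected dual, with the John–Nirenberg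
inequality for the exponential factor. Here `δ` is of the order of the reciprocal of the constant;
the dual constant is at most `[W]^(1/(p-1))`, whence the maximum in the exponent. One-sided reverse
Hölder bounds an integral by one over a longer interval, so it only treats separated intervals; a
dyadic argument (`mul_rpow_le_of_separated`) closes the gap. Both inequalities rest on the rising
sun lemma.

No monotonicity of `φ` is available, so an upper bound for the perturbed constant is not enough. The
perturbed weight is multiplied by a function bounded above and below, chosen by the intermediate
value theorem so that the constant equals `κ [w^q]` exactly (`MemApPlus.exists_apPlusConst_mul_eq`).

The Cauchy integral is replaced by averages over roots of unity and Fatou's lemma. The power series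
of `T (exp (-z b) f)` converges almost everywhere because `T` is also bounded for the damped weight
`w exp (-2r|b|)`, against which every `b^j f` is controlled; the norm of `T` there does not enter
the final estimate. -/

/-! ### The rising sun lemma -/

/-- To compare two measures of a bounded open set of reals it suffices to compare them on the
maximal open intervals contained in it. -/
theorem measure_le_of_forall_maximal_Ioo {μ ν : Measure ℝ} {E : Set ℝ} {a b : ℝ} (hE : IsOpen E)
    (hEab : E ⊆ Ioo a b)
    (h : ∀ α β, a ≤ α → α < β → β ≤ b → Ioo α β ⊆ E → α ∉ E → β ∉ E →
      μ (Ioo α β) ≤ ν (Ioo α β)) : μ E ≤ ν E := by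
  set S : Set (Set ℝ) := (fun x => connectedComponentIn E x) '' E with hS
  have hopen : ∀ C ∈ S, IsOpen C := by
    rintro _ ⟨x, -, rfl⟩
    exact hE.connectedComponentIn
  have hdisj : S.PairwiseDisjoint id := by
    rintro _ ⟨x, hx, rfl⟩ _ ⟨y, hy, rfl⟩ hne
    refine Set.disjoint_left.2 fun z hzx hzy => hne ?_
    exact (connectedComponentIn_eq hzx).trans (connectedComponentIn_eq hzy).symm
  have hcount : S.Countable := by
    refine hdisj.countable_of_isOpen hopen ?_
    rintro _ ⟨x, hx, rfl⟩
    exact ⟨x, mem_connectedComponentIn hx⟩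
  have hun : ⋃₀ S = E := by
    apply Set.Subset.antisymm
    · rintro z ⟨_, ⟨x, -, rfl⟩, hz⟩
      exact connectedComponentIn_subset _ _ hz
    · exact fun x hx => ⟨_, ⟨x, hx, rfl⟩, mem_connectedComponentIn hx⟩
  rw [← hun, measure_sUnion hcount hdisj fun C hC => (hopen C hC).measurableSet,
    measure_sUnion hcount hdisj fun C hC => (hopen C hC).measurableSet]
  refine ENNReal.tsum_le_tsum ?_
  rintro ⟨_, x, hx, rfl⟩
  set C := connectedComponentIn E x with hC
  have hCo : IsOpen C := hE.connectedComponentIn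
  have hxC : x ∈ C := mem_connectedComponentIn hx
  have hCE : C ⊆ E := connectedComponentIn_subset _ _
  have hCab : C ⊆ Ioo a b := hCE.trans hEab
  have hbb : BddBelow C := ⟨a, fun y hy => (hCab hy).1.le⟩
  have hba : BddAbove C := ⟨b, fun y hy => (hCab hy).2.le⟩
  have hconn : IsConnected C := ⟨⟨x, hxC⟩, isPreconnected_connectedComponentIn⟩
  have hsub : Ioo (sInf C) (sSup C) ⊆ C := hconn.Ioo_csInf_csSup_subset hbb hba
  -- A component is closed relative to `E`: the component of `y` is an open neighbourhood of `y`, so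
  -- it meets `C` and equals it. Hence the endpoints of `C` lie outside `E`, not only outside `C`.
  have hnotmem : ∀ y ∈ closure C, y ∈ E → y ∈ C := by
    intro y hy hyE
    obtain ⟨z, hz1, hz2⟩ := mem_closure_iff.1 hy _ (hE.connectedComponentIn (x := y))
      (mem_connectedComponentIn hyE)
    have : connectedComponentIn E x = connectedComponentIn E y :=
      (connectedComponentIn_eq hz2).trans (connectedComponentIn_eq hz1).symm
    rw [hC, this]
    exact mem_connectedComponentIn hyE
  have hinf : sInf C ∉ C := fun hm => by
    obtain ⟨ε, hε, hball⟩ := Metric.isOpen_iff.1 hCo _ hm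
    have : sInf C - ε / 2 ∈ C := hball (by simp [abs_of_pos hε, hε])
    linarith [csInf_le hbb this]
  have hsup : sSup C ∉ C := fun hm => by
    obtain ⟨ε, hε, hball⟩ := Metric.isOpen_iff.1 hCo _ hm
    have : sSup C + ε / 2 ∈ C := hball (by simp [abs_of_pos hε, hε])
    linarith [le_csSup hba this]
  have hCeq : C = Ioo (sInf C) (sSup C) := by
    refine Set.Subset.antisymm (fun y hy => ⟨?_, ?_⟩) hsub
    · exact lt_of_le_of_ne (csInf_le hbb hy) fun h => hinf (h ▸ hy)
    · exact lt_of_le_of_ne (le_csSup hba hy) fun h => hsup (h ▸ hy)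
  have key := h (sInf C) (sSup C) (le_csInf hconn.nonempty fun y hy => (hCab hy).1.le)
    ((hCeq ▸ hxC : x ∈ Ioo (sInf C) (sSup C)).1.trans
      (hCeq ▸ hxC : x ∈ Ioo (sInf C) (sSup C)).2)
    (csSup_le hconn.nonempty fun y hy => (hCab hy).2.le) (hsub.trans hCE)
    (fun hm => hinf (hnotmem _ (csInf_mem_closure hconn.nonempty hbb) hm))
    (fun hm => hsup (hnotmem _ (csSup_mem_closure hconn.nonempty hba) hm))
  rw [← hCeq] at key
  exact key

/-- The set of points of `(a, b)` at which `g` exceeds some earlier value on `[a, b)`. -/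
def risingSet (g : ℝ → ℝ) (a b : ℝ) : Set ℝ :=
  {x | x ∈ Ioo a b ∧ ∃ y ∈ Ico a x, g y < g x}

theorem risingSet_subset (g : ℝ → ℝ) (a b : ℝ) : risingSet g a b ⊆ Ioo a b := fun _ h => h.1

theorem isOpen_risingSet {g : ℝ → ℝ} (hg : Continuous g) (a b : ℝ) : IsOpen (risingSet g a b) := by
  have : risingSet g a b = ⋃ y ∈ Ici a, Ioo a b ∩ Ioi y ∩ {x | g y < g x} := by
    ext x
    simp only [risingSet, mem_ofPred_eq, mem_iUnion, mem_inter_iff, mem_Ioi, mem_Ici, mem_Ico]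
    constructor
    · rintro ⟨h, y, hy, hlt⟩
      exact ⟨y, hy.1, ⟨h, hy.2⟩, hlt⟩
    · rintro ⟨y, hy, ⟨h, hyx⟩, hlt⟩
      exact ⟨h, y, ⟨hy, hyx⟩, hlt⟩
  rw [this]
  exact isOpen_biUnion fun y _ =>
    (isOpen_Ioo.inter isOpen_Ioi).inter (isOpen_lt continuous_const hg)

theorem le_of_notMem_risingSet {g : ℝ → ℝ} {a b α : ℝ} (ha : a ≤ α) (hb : α < b)
    (h : α ∉ risingSet g a b) {y : ℝ} (hy : y ∈ Icc a α) : g α ≤ g y := by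
  rcases ha.eq_or_lt with rfl | ha
  · rw [le_antisymm hy.2 hy.1]
  rcases hy.2.eq_or_lt with rfl | hyα
  · exact le_rfl
  by_contra! hlt
  exact h ⟨⟨ha, hb⟩, y, ⟨hy.1, hyα⟩, hlt⟩

/-- On a maximal interval of the rising set, `g` stays above its value at the left endpoint. -/
theorem le_of_Ioo_subset_risingSet {g : ℝ → ℝ} (hg : Continuous g) {a b α β : ℝ} (ha : a ≤ α)
    (hb : β ≤ b) (hsub : Ioo α β ⊆ risingSet g a b) (hα : α ∉ risingSet g a b) {x : ℝ}
    (hx : x ∈ Ico α β) : g α ≤ g x := by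
  obtain ⟨y, hy, hmin⟩ := isCompact_Icc.exists_isMinOn (nonempty_Icc.2 hx.1) hg.continuousOn
  have hαb : α < b := (hx.1.trans_lt hx.2).trans_le hb
  rcases hy.1.eq_or_lt with rfl | hαy
  · exact hmin (right_mem_Icc.2 hx.1)
  obtain ⟨-, z, hz, hlt⟩ := hsub ⟨hαy, hy.2.trans_lt hx.2⟩
  -- A lower value at `z ≥ α` contradicts the minimality of `y`; one at `z ≤ α` contradicts that `α`
  -- is not in the rising set.
  rcases le_total α z with hαz | hzα
  · exact absurd (hmin ⟨hαz, hz.2.le.trans hy.2⟩) (not_le.2 hlt)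
  · have h1 : g α ≤ g z := le_of_notMem_risingSet ha hαb hα ⟨hz.1, hzα⟩
    have h2 : g y ≤ g α := hmin (left_mem_Icc.2 hx.1)
    linarith

/-- Passage to the endpoint by continuity. For a tilted primitive it says that `f` has mean at least
`lam` on a component of the rising set; if `β` also lies outside the rising set and `β < b`, the
mean is exactly `lam`. -/
theorem le_of_Ioo_subset_risingSet_right {g : ℝ → ℝ} (hg : Continuous g) {a b α β : ℝ}
    (ha : a ≤ α) (hαβ : α < β)
    (hb : β ≤ b) (hsub : Ioo α β ⊆ risingSet g a b) (hα : α ∉ risingSet g a b) : g α ≤ g β := by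
  have : β ∈ closure (Ico α β) := by rw [closure_Ico hαβ.ne]; exact right_mem_Icc.2 hαβ.le
  have hcl : IsClosed {x | g α ≤ g x} := isClosed_le continuous_const hg
  exact hcl.closure_subset_iff.2 (fun x hx => le_of_Ioo_subset_risingSet hg ha hb hsub hα hx) this

/-- `x ↦ ∫_0^x f - lam x`. -/
noncomputable def tiltedPrimitive (f : ℝ → ℝ) (lam : ℝ) (x : ℝ) : ℝ :=
  (∫ y in (0 : ℝ)..x, f y) - lam * x

theorem MeasureTheory.LocallyIntegrable.intervalIntegrable' {f : ℝ → ℝ}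
    (hf : LocallyIntegrable f volume) (a b : ℝ) : IntervalIntegrable f volume a b :=
  (hf.integrableOn_isCompact isCompact_uIcc).intervalIntegrable

theorem continuous_tiltedPrimitive {f : ℝ → ℝ} (hf : LocallyIntegrable f volume) (lam : ℝ) :
    Continuous (tiltedPrimitive f lam) :=
  (intervalIntegral.continuous_primitive hf.intervalIntegrable' 0).sub
    (continuous_const.mul continuous_id)

theorem tiltedPrimitive_sub {f : ℝ → ℝ} (hf : LocallyIntegrable f volume) (lam x y : ℝ) :
    tiltedPrimitive f lam x - tiltedPrimitive f lam y = (∫ t in y..x, f t) - lam * (x - y) := by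
  have := intervalIntegral.integral_add_adjacent_intervals (hf.intervalIntegrable' 0 y)
    (hf.intervalIntegrable' y x)
  simp only [tiltedPrimitive]
  linarith

/-- Off the rising set of its primitive tilted by `lam`, a function is almost everywhere at
most `lam`. -/
theorem ae_mem_risingSet_of_lt {f : ℝ → ℝ} (hf : LocallyIntegrable f volume) (a b : ℝ) :
    ∀ᵐ x, x ∈ Ioo a b → ∀ lam, lam < f x → x ∈ risingSet (tiltedPrimitive f lam) a b := by
  -- The exceptional set comes from differentiating the primitive of `f`, so a single null set
  -- serves all `lam`.
  filter_upwards [_root_.LocallyIntegrable.ae_hasDerivAt_integral hf] with x hx hxab lam hlam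
  refine ⟨hxab, ?_⟩
  have hd : HasDerivAt (tiltedPrimitive f lam) (f x - lam) x := by
    have h2 : HasDerivAt (fun y => lam * y) lam x := by
      simpa using (hasDerivAt_id x).const_mul lam
    exact (hx 0).sub h2
  have hs := (hasDerivAt_iff_tendsto_slope_left_right.1 hd).1
  have hev := (hs.eventually (lt_mem_nhds (sub_pos.2 hlam))).and
    (Ioo_mem_nhdsLT hxab.1)
  obtain ⟨y, hy, hyI⟩ := hev.exists
  refine ⟨y, ⟨hyI.1.le, hyI.2⟩, ?_⟩
  rw [slope_def_field] at hy
  have h1 : y - x < 0 := sub_neg.2 hyI.2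
  by_contra! hle
  exact absurd (div_nonpos_of_nonneg_of_nonpos (sub_nonneg.2 hle) h1.le) (not_le.2 hy)

/-- A weak type estimate: there is a point to the right of `c` at which all left averages of `f`
are bounded by `lam`. -/
theorem exists_forall_integral_le {f : ℝ → ℝ} (hf : LocallyIntegrable f volume) {a c d lam : ℝ}
    (hac : a ≤ c) (hcd : c < d) (hlam : ∫ x in a..d, |f x| < lam * (d - c)) :
    ∃ e ∈ Ioo c d, ∀ y ∈ Ico a e, ∫ x in y..e, f x ≤ lam * (e - y) := by
  by_contra! hcon
  set g := tiltedPrimitive f lam with hg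
  have hgc : Continuous g := continuous_tiltedPrimitive hf lam
  have hsub : Ioo c d ⊆ risingSet g a d := by
    intro e he
    obtain ⟨y, hy, hlt⟩ := hcon e he
    refine ⟨⟨hac.trans_lt he.1, he.2⟩, y, hy, ?_⟩
    have := tiltedPrimitive_sub hf lam e y
    simp only [hg]; linarith
  -- a minimum of `g` on `[a, c]` serves as the left endpoint
  obtain ⟨m, hm, hmin⟩ := isCompact_Icc.exists_isMinOn (nonempty_Icc.2 hac) hgc.continuousOn
  -- A minimiser over `[a, x]` cannot lie beyond `c`, where every point exceeds some earlier value;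
  -- so the minimum over `[a, c]` persists up to `d`.
  have hle : ∀ x ∈ Ico m d, g m ≤ g x := by
    intro x hx
    obtain ⟨z, hz, hzmin⟩ := isCompact_Icc.exists_isMinOn
      (nonempty_Icc.2 (hm.1.trans hx.1)) hgc.continuousOn
    rcases le_or_gt z c with hzc | hzc
    · exact (hmin ⟨hz.1, hzc⟩).trans (hzmin ⟨hm.1.trans hx.1, le_rfl⟩)
    · obtain ⟨-, y, hy, hlt⟩ := hsub ⟨hzc, hz.2.trans_lt hx.2⟩
      exact absurd (hzmin ⟨hy.1, hy.2.le.trans hz.2⟩) (not_le.2 hlt)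
  have hmd : m < d := hm.2.trans_lt hcd
  have hd : g m ≤ g d := by
    have : d ∈ closure (Ico m d) := by rw [closure_Ico hmd.ne]; exact right_mem_Icc.2 hmd.le
    exact (isClosed_le continuous_const hgc).closure_subset_iff.2 hle this
  -- Now `g m ≤ g d` reads `lam (d - m) ≤ ∫_m^d f`, and `d - m ≥ d - c` contradicts `hlam`.
  have h1 := tiltedPrimitive_sub hf lam d m
  have h2 : ∫ x in m..d, f x ≤ ∫ x in a..d, |f x| := by
    have hab : LocallyIntegrable (fun x => |f x|) volume := fun x => (hf x).norm
    calc ∫ x in m..d, f x ≤ ∫ x in m..d, |f x| :=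
          intervalIntegral.integral_mono_on hmd.le (hf.intervalIntegrable' _ _)
            (hab.intervalIntegrable' _ _) fun x _ => le_abs_self _
      _ ≤ _ := by
          have := intervalIntegral.integral_add_adjacent_intervals (hab.intervalIntegrable' a m)
            (hab.intervalIntegrable' m d)
          have h0 : 0 ≤ ∫ x in a..m, |f x| :=
            intervalIntegral.integral_nonneg hm.1 fun x _ => abs_nonneg _
          linarith
  have h3 : 0 ≤ ∫ x in a..d, |f x| :=
    intervalIntegral.integral_nonneg (hac.trans hcd.le) fun x _ => abs_nonneg _
  have hl : 0 < lam := by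
    by_contra! h
    nlinarith
  nlinarith [hm.2]

theorem ofReal_integral_le_lintegral_ofReal {α : Type*} [MeasurableSpace α] {μ : Measure α}
    {f : α → ℝ} (hf : Integrable f μ) :
    ENNReal.ofReal (∫ x, f x ∂μ) ≤ ∫⁻ x, ENNReal.ofReal (f x) ∂μ := by
  calc ENNReal.ofReal (∫ x, f x ∂μ) ≤ ENNReal.ofReal (∫ x, max (f x) 0 ∂μ) :=
        ENNReal.ofReal_le_ofReal (integral_mono hf hf.pos_part fun x => le_max_left _ _)
    _ = ∫⁻ x, ENNReal.ofReal (max (f x) 0) ∂μ :=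
        ofReal_integral_eq_lintegral_ofReal hf.pos_part (ae_of_all _ fun x => le_max_right _ _)
    _ = _ := by simp

/-! ### Mean oscillation and the John–Nirenberg inequality -/

/-- The mean of `f` over the interval `(a, c)`. -/
noncomputable def intervalMean (f : ℝ → ℝ) (a c : ℝ) : ℝ := (∫ x in a..c, f x) / (c - a)

/-- `f` has mean oscillation at most `B` over every bounded interval. -/
def HasMeanOscillationLE (f : ℝ → ℝ) (B : ℝ) : Prop :=
  ∀ a c, a < c → ∫ x in a..c, |f x - intervalMean f a c| ≤ B * (c - a)

theorem setLIntegral_Ioo_ofReal_eq {f : ℝ → ℝ} (hf : LocallyIntegrable f volume)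
    (h0 : ∀ x, 0 ≤ f x) {a c : ℝ} (hac : a ≤ c) :
    ∫⁻ x in Ioo a c, ENNReal.ofReal (f x) = ENNReal.ofReal (∫ x in a..c, f x) := by
  have hi : IntegrableOn f (Ioo a c) :=
    (hf.integrableOn_isCompact isCompact_Icc).mono_set Ioo_subset_Icc_self
  rw [intervalIntegral.integral_of_le hac, integral_Ioc_eq_integral_Ioo,
    ofReal_integral_eq_lintegral_ofReal hi (ae_of_all _ h0)]

/-- A good-lambda inequality for functions of bounded mean oscillation. -/
theorem volume_risingSet_add_le_half {f : ℝ → ℝ} {B a e lam₀ lam : ℝ}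
    (hf : LocallyIntegrable f volume) (hB : 0 < B) (hosc : HasMeanOscillationLE f B)
    (hend : ∀ y ∈ Ico a e, ∫ x in y..e, f x ≤ lam₀ * (e - y)) (hlam : lam₀ ≤ lam) :
    volume (risingSet (tiltedPrimitive f (lam + 2 * B)) a e) ≤
      2⁻¹ * volume (risingSet (tiltedPrimitive f lam) a e) := by
  set E := risingSet (tiltedPrimitive f lam) a e with hE
  set E' := risingSet (tiltedPrimitive f (lam + 2 * B)) a e with hE'
  have hEo : IsOpen E := isOpen_risingSet (continuous_tiltedPrimitive hf _) _ _
  have hEo' : IsOpen E' := isOpen_risingSet (continuous_tiltedPrimitive hf _) _ _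
  have hsub : E' ⊆ E := by
    rintro x ⟨hx, y, hy, hlt⟩
    refine ⟨hx, y, hy, ?_⟩
    have h1 := tiltedPrimitive_sub hf lam x y
    have h2 := tiltedPrimitive_sub hf (lam + 2 * B) x y
    have h3 := hy.2
    nlinarith
  have hcomp : (volume.restrict E') E ≤ ((2⁻¹ : ℝ≥0∞) • volume) E := by
    refine measure_le_of_forall_maximal_Ioo hEo (risingSet_subset _ _ _) ?_
    intro α β hα hαβ hβ hsubE hαE hβE
    -- At a right endpoint inside `(a, e)` this is `β ∉ E`; at `β = e` nothing is known from `E`,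
    -- and the hypothesis on left averages at `e` takes over.
    have hmean : ∫ x in α..β, f x ≤ lam * (β - α) := by
      have h1 := tiltedPrimitive_sub hf lam β α
      rcases hβ.eq_or_lt with rfl | hβ
      · have := hend α ⟨hα, hαβ⟩
        nlinarith
      · have := le_of_notMem_risingSet (hα.trans hαβ.le) hβ hβE ⟨hα, hαβ.le⟩
        linarith
    -- The positive part of `f - lam` is the intermediary: on each component of `E' ∩ (α, β)` its
    -- mean is at least `2B`, while its mass on `(α, β)` is at most `B (β - α)`, because the mean of
    -- `f` there is at most `lam`.
    set ν : Measure ℝ := volume.withDensity fun x => ENNReal.ofReal (f x - lam) with hν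
    have hint : ∀ u v, IntegrableOn (fun x => f x - lam) (Ioo u v) := fun u v =>
      ((hf.integrableOn_isCompact isCompact_Icc).mono_set Ioo_subset_Icc_self).sub
        (by simp)
    have hstep : (ENNReal.ofReal (2 * B) • volume) (E' ∩ Ioo α β) ≤ ν (E' ∩ Ioo α β) := by
      refine measure_le_of_forall_maximal_Ioo (hEo'.inter isOpen_Ioo) inter_subset_right ?_
      intro α' β' hα' hαβ' hβ' hsub' hαE' hβE'
      have hαE'' : α' ∉ E' := by
        rcases hα'.eq_or_lt with rfl | hlt
        · exact fun h => hαE (hsub h)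
        · exact fun h => hαE' ⟨h, hlt, hαβ'.trans_le hβ'⟩
      have h1 := le_of_Ioo_subset_risingSet_right (continuous_tiltedPrimitive hf _)
        (hα.trans hα') hαβ' (hβ'.trans hβ) (hsub'.trans inter_subset_left) hαE''
      have h2 := tiltedPrimitive_sub hf (lam + 2 * B) β' α'
      rw [Measure.smul_apply, smul_eq_mul, Real.volume_Ioo, ← ENNReal.ofReal_mul (by positivity),
        hν, withDensity_apply _ measurableSet_Ioo]
      refine le_trans (ENNReal.ofReal_le_ofReal ?_)
        (ofReal_integral_le_lintegral_ofReal (hint α' β'))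
      rw [← integral_Ioc_eq_integral_Ioo, ← intervalIntegral.integral_of_le hαβ'.le,
        intervalIntegral.integral_sub (hf.intervalIntegrable' _ _) (by simp)]
      simp only [intervalIntegral.integral_const, smul_eq_mul]
      linarith
    have hνle : ν (Ioo α β) ≤ ENNReal.ofReal (B * (β - α)) := by
      have hloc : LocallyIntegrable (fun x => |f x - intervalMean f α β|) volume :=
        fun x => ((hf.sub (locallyIntegrable_const _)) x).norm
      rw [hν, withDensity_apply _ measurableSet_Ioo]
      calc ∫⁻ x in Ioo α β, ENNReal.ofReal (f x - lam)
          ≤ ∫⁻ x in Ioo α β, ENNReal.ofReal |f x - intervalMean f α β| := by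
            refine lintegral_mono fun x => ENNReal.ofReal_le_ofReal ?_
            have : intervalMean f α β ≤ lam := by
              rw [intervalMean, div_le_iff₀ (sub_pos.2 hαβ)]; exact hmean
            exact le_trans (by linarith) (le_abs_self _)
        _ = ENNReal.ofReal (∫ x in α..β, |f x - intervalMean f α β|) :=
            setLIntegral_Ioo_ofReal_eq hloc (fun _ => abs_nonneg _) hαβ.le
        _ ≤ _ := ENNReal.ofReal_le_ofReal (hosc α β hαβ)
    have hfin := (hstep.trans (measure_mono inter_subset_right)).trans hνle
    rw [Measure.restrict_apply measurableSet_Ioo, Measure.smul_apply, smul_eq_mul,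
      Real.volume_Ioo, inter_comm]
    rw [Measure.smul_apply, smul_eq_mul] at hfin
    have h2 : ENNReal.ofReal (B * (β - α)) =
        ENNReal.ofReal (2 * B) * (2⁻¹ * ENNReal.ofReal (β - α)) := by
      have : (2⁻¹ : ℝ≥0∞) = ENNReal.ofReal 2⁻¹ := by
        rw [ENNReal.ofReal_inv_of_pos two_pos]; simp
      rw [this, ← ENNReal.ofReal_mul (by positivity), ← ENNReal.ofReal_mul (by positivity)]
      congr 1; ring
    rw [h2] at hfin
    exact (ENNReal.mul_le_mul_iff_right (by simpa using hB) ENNReal.ofReal_ne_top).1 hfin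
  rwa [Measure.restrict_apply hEo.measurableSet, inter_eq_self_of_subset_right hsub,
    Measure.smul_apply, smul_eq_mul] at hcomp

theorem intervalMean_sub_const {f : ℝ → ℝ} (hf : LocallyIntegrable f volume) (m : ℝ) {a c : ℝ}
    (hac : a < c) : intervalMean (fun x => f x - m) a c = intervalMean f a c - m := by
  have : c - a ≠ 0 := (sub_pos.2 hac).ne'
  rw [intervalMean, intervalMean,
    intervalIntegral.integral_sub (hf.intervalIntegrable' _ _) (by simp)]
  simp only [intervalIntegral.integral_const, smul_eq_mul]
  field_simp

theorem HasMeanOscillationLE.sub_const {f : ℝ → ℝ} {B : ℝ} (hf : LocallyIntegrable f volume)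
    (h : HasMeanOscillationLE f B) (m : ℝ) : HasMeanOscillationLE (fun x => f x - m) B := by
  intro a c hac
  simpa [intervalMean_sub_const hf m hac] using h a c hac

theorem intervalMean_neg (f : ℝ → ℝ) (a c : ℝ) :
    intervalMean (fun x => -f x) a c = -intervalMean f a c := by
  simp [intervalMean, neg_div]

theorem HasMeanOscillationLE.neg {f : ℝ → ℝ} {B : ℝ}
    (h : HasMeanOscillationLE f B) : HasMeanOscillationLE (fun x => -f x) B := by
  intro a c hac
  have : ∀ x, |-f x - -intervalMean f a c| = |f x - intervalMean f a c| := fun x => by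
    rw [← abs_neg]; congr 1; ring
  simpa only [intervalMean_neg, this] using h a c hac

/-- Exponential decay of the distribution function of a function of bounded mean oscillation. -/
theorem volume_lt_sub_intervalMean_le {f : ℝ → ℝ} {B a c : ℝ} (hf : LocallyIntegrable f volume)
    (hB : 0 < B) (hosc : HasMeanOscillationLE f B) (hac : a < c) (n : ℕ) :
    volume (Ioo a c ∩ {x | 3 * B + n * (2 * B) < f x - intervalMean f a (2 * c - a)}) ≤
      2⁻¹ ^ n * ENNReal.ofReal (2 * (c - a)) := by
  set d := 2 * c - a with hd
  set m := intervalMean f a d with hm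
  have hF : LocallyIntegrable (fun x => f x - m) volume := hf.sub (locallyIntegrable_const _)
  -- Doubling the interval leaves room for a good endpoint beyond `c`. The integral of `|f - m|`
  -- over it is at most `2B (c - a)`, which is less than `3B (d - c)`; hence the starting level
  -- `3B`.
  obtain ⟨e, he, hend⟩ := exists_forall_integral_le hF (lam := 3 * B) hac.le
    (show c < d by linarith) (by
      have := hosc a d (by linarith)
      have h2 : 0 < B * (c - a) := mul_pos hB (by linarith)
      simp only [hd] at this ⊢
      nlinarith)
  have hdec : volume (risingSet (tiltedPrimitive (fun x => f x - m) (3 * B + n * (2 * B))) a e) ≤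
      2⁻¹ ^ n * ENNReal.ofReal (2 * (c - a)) := by
    induction n with
    | zero =>
      refine (measure_mono (risingSet_subset _ _ _)).trans ?_
      rw [Real.volume_Ioo, pow_zero, one_mul]
      exact ENNReal.ofReal_le_ofReal (by linarith [he.2])
    | succ n ih =>
      have := volume_risingSet_add_le_half hF hB (hosc.sub_const hf m) hend
        (lam := 3 * B + n * (2 * B)) (by nlinarith [(Nat.cast_nonneg n : (0 : ℝ) ≤ n)])
      rw [pow_succ', mul_assoc]
      refine le_trans ?_ (this.trans (mul_le_mul_right ih _))
      push_cast
      rw [show 3 * B + n * (2 * B) + 2 * B = 3 * B + (n + 1) * (2 * B) by ring]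
  refine (measure_mono_ae ?_).trans hdec
  filter_upwards [ae_mem_risingSet_of_lt hF a e] with x hx hxm
  exact hx ⟨hxm.1.1, hxm.1.2.trans he.1⟩ _ hxm.2

/-- Integration over the layers `3B + 2nB < f - m`. As `s B ≤ 1/8`, the exponential grows by at most
`exp (1/4) ≤ 4/3` from one layer to the next while the measure bound halves, which leaves a
geometric series of ratio `2/3`. The total is `8/5 + 64/5 ≤ 16` times the length. -/
theorem lintegral_exp_sub_intervalMean_le_of_nonneg {f : ℝ → ℝ} {B a c s : ℝ}
    (hf : LocallyIntegrable f volume) (hB : 0 < B) (hosc : HasMeanOscillationLE f B) (hac : a < c)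
    (hs : 0 ≤ s) (hsB : s * B ≤ 1 / 8) :
    ∫⁻ x in Ioo a c, ENNReal.ofReal (Real.exp (s * (f x - intervalMean f a (2 * c - a)))) ≤
      ENNReal.ofReal (16 * (c - a)) := by
  set m := intervalMean f a (2 * c - a) with hm
  set A : ℕ → Set ℝ := fun n => {x | 3 * B + n * (2 * B) < f x - m} with hA
  have hAm : ∀ n, NullMeasurableSet (A n) (volume.restrict (Ioo a c)) := fun n =>
    nullMeasurableSet_lt aemeasurable_const
      ((hf.aestronglyMeasurable.aemeasurable.sub aemeasurable_const).restrict)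
  have he1 : Real.exp (3 / 8) ≤ 8 / 5 := by
    have := Real.one_sub_le_exp_neg (3 / 8)
    rw [Real.exp_neg] at this
    rw [show (8 / 5 : ℝ) = (5 / 8)⁻¹ by norm_num, ← inv_inv (Real.exp (3 / 8))]
    exact inv_anti₀ (by norm_num) (by linarith)
  have he2 : Real.exp (1 / 4) ≤ 4 / 3 := by
    have := Real.one_sub_le_exp_neg (1 / 4)
    rw [Real.exp_neg] at this
    rw [show (4 / 3 : ℝ) = (3 / 4)⁻¹ by norm_num, ← inv_inv (Real.exp (1 / 4))]
    exact inv_anti₀ (by norm_num) (by linarith)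
  have hexp : ∀ n : ℕ, Real.exp (s * (3 * B + n * (2 * B))) ≤ 8 / 5 * (4 / 3) ^ n := by
    intro n
    calc Real.exp (s * (3 * B + n * (2 * B))) ≤ Real.exp (3 / 8 + n * (1 / 4)) :=
          Real.exp_le_exp.2 (by nlinarith [(Nat.cast_nonneg n : (0 : ℝ) ≤ n)])
      _ = Real.exp (3 / 8) * Real.exp (1 / 4) ^ n := by
          rw [Real.exp_add, ← Real.exp_nat_mul]
      _ ≤ _ := by gcongr
  have hpt : ∀ x, ENNReal.ofReal (Real.exp (s * (f x - m))) ≤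
      ENNReal.ofReal (8 / 5) + ∑' n : ℕ, (A n).indicator
        (fun _ => ENNReal.ofReal (8 / 5 * (4 / 3) ^ (n + 1))) x := by
    intro x
    by_cases hx : f x - m ≤ 3 * B
    · refine le_add_right (ENNReal.ofReal_le_ofReal ?_)
      have := hexp 0
      simp only [Nat.cast_zero, zero_mul, add_zero, pow_zero, mul_one] at this
      exact (Real.exp_le_exp.2 (mul_le_mul_of_nonneg_left hx hs)).trans this
    · push Not at hx
      obtain ⟨N, hN⟩ := exists_nat_ge ((f x - m - 3 * B) / (2 * B))
      have hex : ∃ N : ℕ, f x - m ≤ 3 * B + N * (2 * B) :=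
        ⟨N, by rw [div_le_iff₀ (by positivity)] at hN; linarith⟩
      classical
      obtain ⟨k, hk⟩ : ∃ k, Nat.find hex = k + 1 := by
        refine Nat.exists_eq_succ_of_ne_zero fun h0 => ?_
        have := Nat.find_spec hex
        rw [h0] at this
        simp at this; linarith
      have h1 : f x - m ≤ 3 * B + (k + 1 : ℕ) * (2 * B) := hk ▸ Nat.find_spec hex
      have h2 : x ∈ A k := by
        have := Nat.find_min hex (show k < Nat.find hex by omega)
        exact not_le.1 this
      refine le_add_left (le_trans ?_ (ENNReal.le_tsum k))
      rw [indicator_of_mem h2]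
      exact ENNReal.ofReal_le_ofReal
        ((Real.exp_le_exp.2 (mul_le_mul_of_nonneg_left h1 hs)).trans (hexp (k + 1)))
  have hterm : ∀ n : ℕ, ∫⁻ x in Ioo a c, (A n).indicator
      (fun _ => ENNReal.ofReal (8 / 5 * (4 / 3) ^ (n + 1))) x ≤
        ENNReal.ofReal (64 / 15 * (c - a) * (2 / 3) ^ n) := by
    intro n
    rw [lintegral_indicator_const₀ (hAm n), Measure.restrict_apply' measurableSet_Ioo, inter_comm]
    refine (mul_le_mul_right (volume_lt_sub_intervalMean_le hf hB hosc hac n) _).trans ?_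
    have : (2⁻¹ : ℝ≥0∞) = ENNReal.ofReal 2⁻¹ := by
      rw [ENNReal.ofReal_inv_of_pos two_pos]; simp
    rw [this, ← ENNReal.ofReal_pow (by norm_num), ← ENNReal.ofReal_mul (by positivity),
      ← ENNReal.ofReal_mul (by positivity)]
    refine ENNReal.ofReal_le_ofReal (le_of_eq ?_)
    rw [show (2 / 3 : ℝ) = 4 / 3 * 2⁻¹ by norm_num, mul_pow, pow_succ]
    ring
  have hsum : HasSum (fun n : ℕ => 64 / 15 * (c - a) * (2 / 3 : ℝ) ^ n)
      (64 / 15 * (c - a) * (1 - 2 / 3)⁻¹) :=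
    (hasSum_geometric_of_lt_one (by norm_num) (by norm_num)).mul_left _
  have hca : 0 < c - a := sub_pos.2 hac
  calc ∫⁻ x in Ioo a c, ENNReal.ofReal (Real.exp (s * (f x - m)))
      ≤ ∫⁻ x in Ioo a c, (ENNReal.ofReal (8 / 5) + ∑' n : ℕ, (A n).indicator
        (fun _ => ENNReal.ofReal (8 / 5 * (4 / 3) ^ (n + 1))) x) := lintegral_mono hpt
    _ = ENNReal.ofReal (8 / 5) * ENNReal.ofReal (c - a) +
        ∑' n : ℕ, ∫⁻ x in Ioo a c, (A n).indicator
          (fun _ => ENNReal.ofReal (8 / 5 * (4 / 3) ^ (n + 1))) x := by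
        rw [lintegral_add_left measurable_const, lintegral_const,
          lintegral_tsum fun n => aemeasurable_const.indicator₀ (hAm n)]
        simp
    _ ≤ ENNReal.ofReal (8 / 5) * ENNReal.ofReal (c - a) +
        ∑' n : ℕ, ENNReal.ofReal (64 / 15 * (c - a) * (2 / 3) ^ n) := by
        gcongr with n
        exact hterm n
    _ = ENNReal.ofReal (8 / 5 * (c - a) + 64 / 15 * (c - a) * (1 - 2 / 3)⁻¹) := by
        rw [← ENNReal.ofReal_tsum_of_nonneg (fun n => by positivity) hsum.summable, hsum.tsum_eq,
          ← ENNReal.ofReal_mul (by norm_num), ← ENNReal.ofReal_add (by positivity) (by norm_num; linarith)]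
    _ ≤ _ := ENNReal.ofReal_le_ofReal (by norm_num; linarith)

/-- The **John–Nirenberg inequality** in exponential form. -/
theorem lintegral_exp_sub_intervalMean_le {f : ℝ → ℝ} {B a c s : ℝ}
    (hf : LocallyIntegrable f volume) (hB : 0 < B) (hosc : HasMeanOscillationLE f B) (hac : a < c)
    (hsB : |s| * B ≤ 1 / 8) :
    ∫⁻ x in Ioo a c, ENNReal.ofReal (Real.exp (s * (f x - intervalMean f a (2 * c - a)))) ≤
      ENNReal.ofReal (16 * (c - a)) := by
  rcases le_total 0 s with hs | hs
  · exact lintegral_exp_sub_intervalMean_le_of_nonneg hf hB hosc hac hs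
      (by rwa [abs_of_nonneg hs] at hsB)
  · have := lintegral_exp_sub_intervalMean_le_of_nonneg hf.neg hB hosc.neg hac (s := -s)
      (by linarith) (by rwa [abs_of_nonpos hs] at hsB)
    refine le_of_eq_of_le (lintegral_congr fun x => ?_) this
    simp only [Pi.neg_apply]
    rw [show -f = fun x => -f x from rfl, intervalMean_neg]
    congr 2; ring

/-! ### The one-sided reverse Hölder inequality -/

/-- The denominators `c - a` and `(c - a)^(p-1)` combine to `(c - a)^p`. This product form also
covers infinite integrals, so it can be used before local integrability is known. -/
theorem apPlusConst_le_iff {p : ℝ} (hp : 1 < p) {W : ℝ → ℝ≥0} {K : ℝ≥0∞} :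
    ApPlusConst p W ≤ K ↔ ∀ a b c : ℝ, a < b → b < c →
      (∫⁻ x in Ioo a b, (W x : ℝ≥0∞)) *
        (∫⁻ x in Ioo b c, (W x : ℝ≥0∞) ^ (-1 / (p - 1))) ^ (p - 1) ≤
      K * ENNReal.ofReal (c - a) ^ p := by
  simp only [ApPlusConst, iSup_le_iff]
  refine forall_congr' fun a => forall_congr' fun b => forall_congr' fun c =>
    forall_congr' fun hab => forall_congr' fun hbc => ?_
  have hL0 : ENNReal.ofReal (c - a) ≠ 0 := by simpa using hab.trans hbc
  have hLt : ENNReal.ofReal (c - a) ≠ ∞ := ENNReal.ofReal_ne_top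
  set L := ENNReal.ofReal (c - a)
  rw [ENNReal.div_rpow_of_nonneg _ _ (by linarith)]
  have hLp : L ^ p = L * L ^ (p - 1) := by
    conv_lhs => rw [show p = 1 + (p - 1) by ring]
    rw [ENNReal.rpow_add _ _ hL0 hLt, ENNReal.rpow_one]
  have hp0 : L ^ p ≠ 0 := by simp [hL0, hLt]
  have hpt : L ^ p ≠ ∞ := by simp [hL0, hLt]
  have h1 : L ^ (p - 1) ≠ 0 := by simp [hL0, hLt]
  have h2 : L ^ (p - 1) ≠ ∞ := by simp [hL0, hLt]
  set X := ∫⁻ x in Ioo a b, (W x : ℝ≥0∞)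
  set Y := (∫⁻ x in Ioo b c, (W x : ℝ≥0∞) ^ (-1 / (p - 1))) ^ (p - 1)
  have : X / L * (Y / L ^ (p - 1)) = X * Y / L ^ p := by
    rw [hLp, div_eq_mul_inv, div_eq_mul_inv, div_eq_mul_inv,
      ENNReal.mul_inv (Or.inl hL0) (Or.inl hLt)]
    ring
  rw [this, ENNReal.div_le_iff hp0 hpt]

/-- On an interval where the averages of `W` from the left endpoint are at least `lam`, an `A_p^+`
weight is comparable to `lam` on a fixed portion. -/
theorem ofReal_quarter_le_volume_lt {p τ η lam α β : ℝ} (hp : 1 < p) {W : ℝ → ℝ≥0}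
    (hW : LocallyIntegrable (fun x => (W x : ℝ)) volume)
    (hτ : ApPlusConst p W ≤ ENNReal.ofReal τ) (hη : 0 < η)
    (hητ : 2 * τ * η < (1 / 4) ^ (p - 1)) (hlam : 0 < lam) (hαβ : α < β)
    (hmid : lam * ((β - α) / 2) ≤ ∫ x in α..((α + β) / 2), (W x : ℝ)) :
    ENNReal.ofReal ((β - α) / 4) ≤ volume (Ioo α β ∩ {x | η * lam < W x}) := by
  set γ := (α + β) / 2 with hγ
  have hαγ : α < γ := by linarith
  have hγβ : γ < β := by linarith
  set F := Ioo γ β ∩ {x | (W x : ℝ) ≤ η * lam} with hF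
  have hWm : AEMeasurable (fun x => (W x : ℝ≥0∞)) volume := by
    have := hW.aestronglyMeasurable.aemeasurable.ennreal_ofReal
    simpa using this
  have hFle : volume F ≤ ENNReal.ofReal ((β - α) / 4) := by
    -- Otherwise the two factors of the `A_p^+` product at `α < γ < β` are at least `lam (β - α) /
    -- 2` and `(η lam)^(-1) ((β - α) / 4)^(p-1)`, which forces `(1/4)^(p-1) ≤ 2 τ η`.
    by_contra! hlt
    have h := (apPlusConst_le_iff hp).1 hτ α γ β hαγ hγβ
    have hX : ENNReal.ofReal (lam * ((β - α) / 2)) ≤ ∫⁻ x in Ioo α γ, (W x : ℝ≥0∞) := by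
      refine (ENNReal.ofReal_le_ofReal hmid).trans (le_of_eq ?_)
      rw [← setLIntegral_Ioo_ofReal_eq hW (fun x => NNReal.coe_nonneg _) hαγ.le]
      simp
    have hY : ENNReal.ofReal ((η * lam) ^ (-1 / (p - 1)) * ((β - α) / 4)) ≤
        ∫⁻ x in Ioo γ β, (W x : ℝ≥0∞) ^ (-1 / (p - 1)) := by
      have hm := mul_meas_ge_le_lintegral₀ (μ := volume.restrict (Ioo γ β))
        (hWm.restrict.pow_const (-1 / (p - 1))) (ENNReal.ofReal ((η * lam) ^ (-1 / (p - 1))))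
      refine le_trans ?_ hm
      rw [ENNReal.ofReal_mul (by positivity)]
      refine mul_le_mul_right ?_ _
      refine hlt.le.trans ?_
      rw [Measure.restrict_apply' measurableSet_Ioo]
      refine measure_mono fun x hx => ⟨?_, hx.1⟩
      rw [mem_ofPred_eq, ← ENNReal.ofReal_rpow_of_pos (by positivity), neg_div, ENNReal.rpow_neg,
        ENNReal.rpow_neg, ENNReal.inv_le_inv]
      have h2 : (W x : ℝ≥0∞) ≤ ENNReal.ofReal (η * lam) := by
        rw [← ENNReal.ofReal_coe_nnreal]
        exact ENNReal.ofReal_le_ofReal hx.2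
      exact ENNReal.rpow_le_rpow h2 (div_nonneg zero_le_one (by linarith))
    have h2 := (mul_le_mul' hX (ENNReal.rpow_le_rpow hY (by linarith : 0 ≤ p - 1))).trans h
    have hℓ : 0 < β - α := sub_pos.2 hαβ
    rw [ENNReal.ofReal_rpow_of_nonneg (by positivity) (by linarith),
      ← ENNReal.ofReal_mul (by positivity), ENNReal.ofReal_rpow_of_nonneg hℓ.le (by linarith),
      ← ENNReal.ofReal_mul' (by positivity), Real.mul_rpow (by positivity) (by positivity),
      ← Real.rpow_mul (by positivity), div_mul_cancel₀ _ (by linarith), Real.rpow_neg_one,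
      ENNReal.ofReal_le_ofReal_iff'] at h2
    have hℓp : (β - α) ^ p = (β - α) * (β - α) ^ (p - 1) := by
      conv_lhs => rw [show p = 1 + (p - 1) by ring]
      rw [Real.rpow_add hℓ, Real.rpow_one]
    have hq : ((β - α) / 4) ^ (p - 1) = (1 / 4) ^ (p - 1) * (β - α) ^ (p - 1) := by
      rw [← Real.mul_rpow (by norm_num) hℓ.le]; congr 1; ring
    have hpos : 0 < (β - α) * (β - α) ^ (p - 1) := by positivity
    rcases h2 with h2 | h2
    · rw [hq, hℓp] at h2
      have h3 : lam * ((β - α) / 2) * ((η * lam)⁻¹ * ((1 / 4) ^ (p - 1) * (β - α) ^ (p - 1))) =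
          (1 / 4) ^ (p - 1) / (2 * η) * ((β - α) * (β - α) ^ (p - 1)) := by
        field_simp
      rw [h3] at h2
      have h4 := le_of_mul_le_mul_right h2 hpos
      rw [div_le_iff₀ (by positivity)] at h4
      linarith
    · have : 0 < lam * ((β - α) / 2) * ((η * lam)⁻¹ * ((β - α) / 4) ^ (p - 1)) := by positivity
      linarith
  have hcov : volume (Ioo γ β) ≤ volume F + volume (Ioo α β ∩ {x | η * lam < W x}) := by
    refine (measure_mono fun x hx => ?_).trans (measure_union_le _ _)
    rcases le_or_gt (W x : ℝ) (η * lam) with h | h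
    · exact Or.inl ⟨hx, h⟩
    · exact Or.inr ⟨⟨hαγ.trans hx.1, hx.2⟩, h⟩
  rw [Real.volume_Ioo] at hcov
  have h1 : ENNReal.ofReal (β - γ) =
      ENNReal.ofReal ((β - α) / 4) + ENNReal.ofReal ((β - α) / 4) := by
    rw [← ENNReal.ofReal_add (by linarith) (by linarith)]; congr 1; simp only [hγ]; ring
  rw [h1] at hcov
  have := hcov.trans (add_le_add_left hFle _)
  exact (ENNReal.add_le_add_iff_left ENNReal.ofReal_ne_top).1 this

/-- The level set estimate behind the reverse Hölder inequality. -/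
theorem setLIntegral_lt_le_mul_volume_lt {p τ η lam₀ lam a e : ℝ} (hp : 1 < p) {W : ℝ → ℝ≥0}
    (hW : LocallyIntegrable (fun x => (W x : ℝ)) volume)
    (hτ : ApPlusConst p W ≤ ENNReal.ofReal τ) (hη : 0 < η)
    (hητ : 2 * τ * η < (1 / 4) ^ (p - 1))
    (hend : ∀ y ∈ Ico a e, ∫ x in y..e, (W x : ℝ) ≤ lam₀ * (e - y)) (hlam : 0 < lam)
    (hlam₀ : lam₀ ≤ lam) :
    ((volume.restrict (Ioo a e)).withDensity fun x => (W x : ℝ≥0∞)) {x | lam < W x} ≤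
      ENNReal.ofReal (4 * lam) * (volume.restrict (Ioo a e)) {x | η * lam < W x} := by
  set E := risingSet (tiltedPrimitive (fun x => (W x : ℝ)) lam) a e with hE
  have hEo : IsOpen E := isOpen_risingSet (continuous_tiltedPrimitive hW _) _ _
  -- On a component the mean of `W` is at most `lam`, while its averages from the left endpoint are
  -- at least `lam`; the latter puts `W` above `η lam` on a quarter of the component. This explains
  -- the factor `4 lam`.
  have hcomp : (volume.withDensity fun x => (W x : ℝ≥0∞)) E ≤
      (ENNReal.ofReal (4 * lam) • volume.restrict {x | η * lam < W x}) E := by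
    refine measure_le_of_forall_maximal_Ioo hEo (risingSet_subset _ _ _) ?_
    intro α β hα hαβ hβ hsubE hαE hβE
    have hmean : ∫ x in α..β, (W x : ℝ) ≤ lam * (β - α) := by
      have h1 := tiltedPrimitive_sub hW lam β α
      rcases hβ.eq_or_lt with rfl | hβ
      · have := hend α ⟨hα, hαβ⟩
        nlinarith
      · have := le_of_notMem_risingSet (hα.trans hαβ.le) hβ hβE ⟨hα, hαβ.le⟩
        linarith
    have hmid : lam * ((β - α) / 2) ≤ ∫ x in α..((α + β) / 2), (W x : ℝ) := by
      have h1 := tiltedPrimitive_sub hW lam ((α + β) / 2) α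
      have h2 := le_of_Ioo_subset_risingSet (continuous_tiltedPrimitive hW _) hα hβ hsubE hαE
        (x := (α + β) / 2) ⟨by linarith, by linarith⟩
      nlinarith
    have hq := ofReal_quarter_le_volume_lt hp hW hτ hη hητ hlam hαβ hmid
    rw [withDensity_apply _ measurableSet_Ioo, Measure.smul_apply, smul_eq_mul,
      Measure.restrict_apply measurableSet_Ioo]
    refine le_trans ?_ (mul_le_mul_right hq _)
    have h3 := setLIntegral_Ioo_ofReal_eq hW (fun x => NNReal.coe_nonneg _) hαβ.le
    simp only [ENNReal.ofReal_coe_nnreal] at h3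
    rw [h3, ← ENNReal.ofReal_mul (by positivity)]
    exact ENNReal.ofReal_le_ofReal (by linarith)
  rw [Measure.smul_apply, smul_eq_mul, Measure.restrict_apply hEo.measurableSet] at hcomp
  rw [← restrict_withDensity measurableSet_Ioo, Measure.restrict_apply' measurableSet_Ioo,
    Measure.restrict_apply' measurableSet_Ioo]
  have hae : ({x | lam < W x} ∩ Ioo a e : Set ℝ) ≤ᵐ[volume] E := by
    filter_upwards [ae_mem_risingSet_of_lt hW a e] with x hx hxm
    exact hx hxm.2 _ hxm.1
  refine (measure_mono_ae ((withDensity_absolutelyContinuous volume _).ae_le hae)).trans ?_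
  refine hcomp.trans (mul_le_mul_right (measure_mono ?_) _)
  exact fun x hx => ⟨hx.2, risingSet_subset _ _ _ hx.1⟩

/-- `δ log (1/η) ≤ η (1/η - 1) ≤ 1`, and `e ≤ 3`. -/
theorem rpow_neg_le_three {η δ : ℝ} (hη : 0 < η) (hη1 : η ≤ 1) (hδ : δ ≤ η) :
    η ^ (-δ) ≤ 3 := by
  have h1 : -Real.log η ≤ η⁻¹ - 1 := by
    rw [← Real.log_inv]; exact Real.log_le_sub_one_of_pos (inv_pos.2 hη)
  have h0 : 0 ≤ -Real.log η := by linarith [Real.log_nonpos hη.le hη1]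
  rw [Real.rpow_def_of_pos hη]
  have h2 : Real.log η * -δ ≤ 1 := by
    have : η * (η⁻¹ - 1) ≤ 1 := by rw [mul_sub, mul_inv_cancel₀ hη.ne']; linarith
    nlinarith
  calc Real.exp (Real.log η * -δ) ≤ Real.exp 1 := Real.exp_le_exp.2 h2
    _ ≤ 3 := by linarith [Real.exp_one_lt_d9]

/-- Reverse Hölder inequality for truncations. -/
theorem lintegral_min_rpow_le {p τ η δ lam₀ a e N : ℝ} (hp : 1 < p) {W : ℝ → ℝ≥0}
    (hW : LocallyIntegrable (fun x => (W x : ℝ)) volume)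
    (hτ : ApPlusConst p W ≤ ENNReal.ofReal τ) (hη : 0 < η) (hη1 : η ≤ 1)
    (hητ : 2 * τ * η < (1 / 4) ^ (p - 1)) (hδ : 0 < δ) (hδη : δ ≤ η / 24)
    (hend : ∀ y ∈ Ico a e, ∫ x in y..e, (W x : ℝ) ≤ lam₀ * (e - y))
    (hlam₀ : 0 < lam₀) (hN : 0 < N) :
    ∫⁻ x in Ioo a e, (W x : ℝ≥0∞) * ENNReal.ofReal (min (W x : ℝ) N ^ δ) ≤
      2 * (ENNReal.ofReal (lam₀ ^ δ) * ∫⁻ x in Ioo a e, (W x : ℝ≥0∞)) := by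
  have hWr : AEMeasurable (fun x => (W x : ℝ)) (volume.restrict (Ioo a e)) :=
    hW.aestronglyMeasurable.aemeasurable.restrict
  have hWm : AEMeasurable (fun x => (W x : ℝ≥0∞)) (volume.restrict (Ioo a e)) := by
    simpa using hWr.ennreal_ofReal
  set μ := (volume.restrict (Ioo a e)).withDensity fun x => (W x : ℝ≥0∞) with hμ
  set vol := volume.restrict (Ioo a e) with hvol
  have hac : μ ≪ vol := withDensity_absolutelyContinuous _ _
  -- Truncation keeps `X` finite, so that half of it can be subtracted at the end. For `t < N` the
  -- set `{t < h}` contains `{η t < W}`, the set on the right of the level set estimate.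
  set f : ℝ → ℝ := fun x => min (W x : ℝ) N with hf
  set h : ℝ → ℝ := fun x => min (W x / η : ℝ) N with hh
  have hf0 : ∀ x, 0 ≤ f x := fun x => le_min (NNReal.coe_nonneg _) hN.le
  have hh0 : ∀ x, 0 ≤ h x := fun x => le_min (by positivity) hN.le
  have hfm : AEMeasurable f vol := hWr.min aemeasurable_const
  have hhm : AEMeasurable h vol := (hWr.div_const _).min aemeasurable_const
  set X := ∫⁻ x, ENNReal.ofReal (f x ^ δ) ∂μ with hX
  have hXeq : ∫⁻ x in Ioo a e, (W x : ℝ≥0∞) * ENNReal.ofReal (min (W x : ℝ) N ^ δ) = X := by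
    rw [hX, lintegral_withDensity_eq_lintegral_mul₀ hWm (hfm.pow_const δ).ennreal_ofReal]
    rfl
  have hμuniv : μ univ = ∫⁻ x in Ioo a e, (W x : ℝ≥0∞) := by
    rw [hμ, withDensity_apply _ MeasurableSet.univ, Measure.restrict_univ]
  have hμfin : μ univ < ∞ := by
    have hle := (setLIntegral_Ioo_ofReal_eq hW (fun x => NNReal.coe_nonneg _)
      (le_max_left a e))
    simp only [ENNReal.ofReal_coe_nnreal] at hle
    rw [hμuniv]
    refine (lintegral_mono_set (Ioo_subset_Ioo_right (le_max_right a e))).trans_lt ?_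
    rw [hle]; exact ENNReal.ofReal_lt_top
  have hXfin : X < ∞ := by
    calc X ≤ ∫⁻ _, ENNReal.ofReal (N ^ δ) ∂μ := lintegral_mono fun x =>
          ENNReal.ofReal_le_ofReal (Real.rpow_le_rpow (hf0 x) (min_le_right _ _) hδ.le)
      _ = ENNReal.ofReal (N ^ δ) * μ univ := lintegral_const _
      _ < ∞ := ENNReal.mul_lt_top ENNReal.ofReal_lt_top hμfin
  have hlayer := lintegral_rpow_eq_lintegral_meas_lt_mul μ (ae_of_all _ hf0) (hfm.mono_ac hac) hδ
  have hlayer0 := lintegral_rpow_eq_lintegral_meas_lt_mul μ (f := fun _ => lam₀)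
    (ae_of_all _ fun _ => hlam₀.le) aemeasurable_const hδ
  have hlayer1 := lintegral_rpow_eq_lintegral_meas_lt_mul vol (ae_of_all _ hh0) hhm
    (show 0 < 1 + δ by linarith)
  -- Below `lam₀` the trivial bound is kept, between `lam₀` and `N` the level set estimate applies,
  -- and from `N` on the set is empty.
  have hlevel : ∀ t ∈ Ioi (0 : ℝ), μ {x | t < f x} * ENNReal.ofReal (t ^ (δ - 1)) ≤
      μ {_x | t < lam₀} * ENNReal.ofReal (t ^ (δ - 1)) +
        4 * (vol {x | t < h x} * ENNReal.ofReal (t ^ (1 + δ - 1))) := by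
    intro t ht
    have ht : 0 < t := ht
    rcases lt_or_ge t lam₀ with htl | htl
    · refine le_add_right (mul_le_mul_left (measure_mono fun x _ => htl) _)
    · refine le_add_left ?_
      rcases lt_or_ge t N with htN | htN
      · have h1 := setLIntegral_lt_le_mul_volume_lt hp hW hτ hη hητ hend ht htl
        have h2 : μ {x | t < f x} ≤ ENNReal.ofReal (4 * t) * vol {x | t < h x} := by
          refine (measure_mono fun x hx => ?_).trans (h1.trans
            (mul_le_mul_right (measure_mono fun x hx => ?_) _))
          · have hx : t < f x := hx
            exact hx.trans_le (min_le_left _ _)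
          · have hx : η * t < W x := hx
            exact lt_min (by rw [lt_div_iff₀ hη]; linarith) htN
        refine (mul_le_mul_left h2 _).trans (le_of_eq ?_)
        have h3 : t ^ (1 + δ - 1) = t * t ^ (δ - 1) := by
          rw [show 1 + δ - 1 = 1 + (δ - 1) by ring, Real.rpow_add ht, Real.rpow_one]
        rw [h3, ENNReal.ofReal_mul ht.le, ENNReal.ofReal_mul (by norm_num : (0 : ℝ) ≤ 4)]
        simp only [ENNReal.ofReal_ofNat]
        ring
      · have : {x | t < f x} = ∅ := by
          ext x
          simp only [mem_ofPred_eq, mem_empty_iff_false, iff_false, not_lt]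
          exact (min_le_right _ _).trans htN
        simp [this]
  have hhle : ∫⁻ x, ENNReal.ofReal (h x ^ (1 + δ)) ∂vol ≤
      ENNReal.ofReal (η⁻¹ * 3) * X := by
    rw [← hXeq, ← lintegral_const_mul' _ _ ENNReal.ofReal_ne_top]
    refine lintegral_mono fun x => ?_
    have hnn : (0 : ℝ) ≤ W x := NNReal.coe_nonneg _
    have h1 : h x ≤ f x / η := by
      rw [le_div_iff₀ hη]
      refine le_min ?_ ?_
      · have : h x ≤ W x / η := min_le_left _ _
        rwa [le_div_iff₀ hη] at this
      · have : h x ≤ N := min_le_right _ _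
        nlinarith [hh0 x]
    have h2 : h x ^ (1 + δ) ≤ η⁻¹ * 3 * (W x * f x ^ δ) := by
      rw [Real.rpow_add' (hh0 x) (by linarith), Real.rpow_one]
      calc h x * h x ^ δ ≤ (W x / η) * (f x / η) ^ δ :=
            mul_le_mul (min_le_left _ _) (Real.rpow_le_rpow (hh0 x) h1 hδ.le)
              (Real.rpow_nonneg (hh0 x) _) (by positivity)
        _ = η⁻¹ * η ^ (-δ) * (W x * f x ^ δ) := by
            rw [Real.div_rpow (hf0 x) hη.le, Real.rpow_neg hη.le]; ring
        _ ≤ η⁻¹ * 3 * (W x * f x ^ δ) := by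
            have := rpow_neg_le_three hη hη1 (show δ ≤ η by linarith)
            have h4 : 0 ≤ (W x : ℝ) * f x ^ δ := mul_nonneg hnn (Real.rpow_nonneg (hf0 x) _)
            gcongr
    refine (ENNReal.ofReal_le_ofReal h2).trans (le_of_eq ?_)
    rw [ENNReal.ofReal_mul (by positivity), ENNReal.ofReal_mul hnn, ENNReal.ofReal_coe_nnreal]
  have hmain : X ≤ ENNReal.ofReal (lam₀ ^ δ) * μ univ + 2⁻¹ * X := by
    have hmeas : Measurable fun t : ℝ => ENNReal.ofReal (t ^ (δ - 1)) := by fun_prop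
    calc X = ENNReal.ofReal δ * ∫⁻ t in Ioi 0, μ {x | t < f x} * ENNReal.ofReal (t ^ (δ - 1)) :=
          hlayer
      _ ≤ ENNReal.ofReal δ * ∫⁻ t in Ioi 0, (μ {_x | t < lam₀} * ENNReal.ofReal (t ^ (δ - 1)) +
            4 * (vol {x | t < h x} * ENNReal.ofReal (t ^ (1 + δ - 1)))) :=
          mul_le_mul_right (setLIntegral_mono' measurableSet_Ioi hlevel) _
      _ = ENNReal.ofReal δ * (∫⁻ t in Ioi 0, μ {_x | t < lam₀} * ENNReal.ofReal (t ^ (δ - 1))) +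
          ENNReal.ofReal δ * (4 * ∫⁻ t in Ioi 0,
            vol {x | t < h x} * ENNReal.ofReal (t ^ (1 + δ - 1))) := by
          rw [lintegral_add_left', mul_add, lintegral_const_mul' _ _ (by simp)]
          refine AEMeasurable.mul (Measurable.aemeasurable ?_) hmeas.aemeasurable
          exact Antitone.measurable fun s t hst => measure_mono fun x hx => lt_of_le_of_lt hst hx
      _ ≤ ENNReal.ofReal (lam₀ ^ δ) * μ univ + 2⁻¹ * X := by
          refine add_le_add ?_ ?_
          · rw [← hlayer0, lintegral_const]
          · set I := ∫⁻ t in Ioi 0, vol {x | t < h x} * ENNReal.ofReal (t ^ (1 + δ - 1))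
            have hI : I ≤ ENNReal.ofReal (η⁻¹ * 3) * X := by
              refine le_trans ?_ hhle
              rw [hlayer1]
              refine le_mul_of_one_le_left (by positivity) ?_
              rw [ENNReal.one_le_ofReal]; linarith
            calc ENNReal.ofReal δ * (4 * I)
                ≤ ENNReal.ofReal δ * (4 * (ENNReal.ofReal (η⁻¹ * 3) * X)) := by gcongr
              _ = ENNReal.ofReal (δ * (4 * (η⁻¹ * 3))) * X := by
                  rw [ENNReal.ofReal_mul hδ.le, ENNReal.ofReal_mul (by norm_num : (0 : ℝ) ≤ 4)]
                  simp only [ENNReal.ofReal_ofNat]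
                  ring
              _ ≤ 2⁻¹ * X := by
                  refine mul_le_mul_left ?_ _
                  rw [show (2⁻¹ : ℝ≥0∞) = ENNReal.ofReal 2⁻¹ by
                    rw [ENNReal.ofReal_inv_of_pos two_pos]; simp]
                  refine ENNReal.ofReal_le_ofReal ?_
                  -- The coefficient of `X` is `12 δ / η`; the bound `δ ≤ η / 24` makes it at most
                  -- one half.
                  have h5 : δ * η⁻¹ ≤ 1 / 24 := by
                    rw [← div_eq_mul_inv, div_le_iff₀ hη]; linarith
                  linarith
  rw [hXeq, ← hμuniv]
  have h6 : 2⁻¹ * X + 2⁻¹ * X ≤ ENNReal.ofReal (lam₀ ^ δ) * μ univ + 2⁻¹ * X := by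
    rw [← add_mul, ENNReal.inv_two_add_inv_two, one_mul]; exact hmain
  have h7 := (ENNReal.add_le_add_iff_right
    (ENNReal.mul_lt_top (by simp) hXfin).ne).1 h6
  calc X = 2 * (2⁻¹ * X) := by
        rw [← mul_assoc, ENNReal.mul_inv_cancel (by simp) (by simp), one_mul]
    _ ≤ _ := by gcongr

/-- The **one-sided reverse Hölder inequality** on an interval whose right endpoint is good. -/
theorem lintegral_rpow_one_add_le {p τ η δ lam₀ a e : ℝ} (hp : 1 < p) {W : ℝ → ℝ≥0}
    (hW : LocallyIntegrable (fun x => (W x : ℝ)) volume)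
    (hτ : ApPlusConst p W ≤ ENNReal.ofReal τ) (hη : 0 < η) (hη1 : η ≤ 1)
    (hητ : 2 * τ * η < (1 / 4) ^ (p - 1)) (hδ : 0 < δ) (hδη : δ ≤ η / 24)
    (hend : ∀ y ∈ Ico a e, ∫ x in y..e, (W x : ℝ) ≤ lam₀ * (e - y))
    (hlam₀ : 0 < lam₀) :
    ∫⁻ x in Ioo a e, (W x : ℝ≥0∞) ^ (1 + δ) ≤
      2 * (ENNReal.ofReal (lam₀ ^ δ) * ∫⁻ x in Ioo a e, (W x : ℝ≥0∞)) := by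
  have hWr : AEMeasurable (fun x => (W x : ℝ)) (volume.restrict (Ioo a e)) :=
    hW.aestronglyMeasurable.aemeasurable.restrict
  have hWm : AEMeasurable (fun x => (W x : ℝ≥0∞)) (volume.restrict (Ioo a e)) := by
    simpa using hWr.ennreal_ofReal
  set F : ℕ → ℝ → ℝ≥0∞ := fun n x =>
    (W x : ℝ≥0∞) * ENNReal.ofReal (min (W x : ℝ) (n + 1) ^ δ) with hF
  have hlim : ∀ x, Filter.liminf (fun n => F n x) Filter.atTop = (W x : ℝ≥0∞) ^ (1 + δ) := by
    intro x
    refine Filter.Tendsto.liminf_eq (tendsto_const_nhds.congr' ?_)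
    obtain ⟨N, hN⟩ := exists_nat_ge (W x : ℝ)
    filter_upwards [Filter.eventually_ge_atTop N] with n hn
    have : (W x : ℝ) ≤ n + 1 := by
      have : (N : ℝ) ≤ n := by exact_mod_cast hn
      linarith
    simp only [hF]
    rw [min_eq_left this, ← ENNReal.ofReal_rpow_of_nonneg (NNReal.coe_nonneg _) hδ.le,
      ENNReal.ofReal_coe_nnreal, ENNReal.rpow_add_of_nonneg _ _ zero_le_one hδ.le,
      ENNReal.rpow_one]
  calc ∫⁻ x in Ioo a e, (W x : ℝ≥0∞) ^ (1 + δ)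
      = ∫⁻ x in Ioo a e, Filter.liminf (fun n => F n x) Filter.atTop := by simp only [hlim]
    _ ≤ Filter.liminf (fun n => ∫⁻ x in Ioo a e, F n x) Filter.atTop :=
        lintegral_liminf_le' fun n =>
          hWm.mul ((hWr.min aemeasurable_const).pow_const δ).ennreal_ofReal
    _ ≤ _ := by
        refine Filter.liminf_le_of_frequently_le' (Filter.Frequently.of_forall fun n => ?_)
        exact lintegral_min_rpow_le hp hW hτ hη hη1 hητ hδ hδη hend hlam₀ (by positivity)

/-- The **one-sided reverse Hölder inequality** for `A_p^+` weights, with an exponent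
depending linearly on the reciprocal of the `A_p^+` constant. -/
theorem lintegral_rpow_one_add_le_of_lt {p τ η δ a b d : ℝ} (hp : 1 < p) {W : ℝ → ℝ≥0}
    (hW : LocallyIntegrable (fun x => (W x : ℝ)) volume)
    (hτ : ApPlusConst p W ≤ ENNReal.ofReal τ) (hη : 0 < η) (hη1 : η ≤ 1)
    (hητ : 2 * τ * η < (1 / 4) ^ (p - 1)) (hδ : 0 < δ) (hδη : δ ≤ η / 24)
    (hab : a < b) (hbd : b < d) (hI : 0 < ∫ x in a..d, (W x : ℝ)) :
    ∫⁻ x in Ioo a b, (W x : ℝ≥0∞) ^ (1 + δ) ≤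
      ENNReal.ofReal (2 * ((2 * (∫ x in a..d, (W x : ℝ)) / (d - b)) ^ δ *
        ∫ x in a..d, (W x : ℝ))) := by
  set I := ∫ x in a..d, (W x : ℝ) with hIdef
  have hdb : 0 < d - b := sub_pos.2 hbd
  -- The good endpoint lies between `b` and `d`, which is why the right side integrates over the
  -- longer `(a, d)`. The factor `2` gives the strict inequality of the weak type estimate.
  obtain ⟨e, he, hend⟩ := exists_forall_integral_le hW (lam := 2 * I / (d - b)) hab.le hbd (by
    simp only [NNReal.abs_eq]
    rw [div_mul_cancel₀ _ hdb.ne']; linarith)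
  have h1 := lintegral_rpow_one_add_le hp hW hτ hη hη1 hητ hδ hδη hend (by positivity)
  calc ∫⁻ x in Ioo a b, (W x : ℝ≥0∞) ^ (1 + δ)
      ≤ ∫⁻ x in Ioo a e, (W x : ℝ≥0∞) ^ (1 + δ) :=
        lintegral_mono_set (Ioo_subset_Ioo_right he.1.le)
    _ ≤ _ := h1
    _ ≤ 2 * (ENNReal.ofReal ((2 * I / (d - b)) ^ δ) * ∫⁻ x in Ioo a d, (W x : ℝ≥0∞)) := by
        gcongr
        exact he.2.le
    _ = _ := by
        have h3 := setLIntegral_Ioo_ofReal_eq hW (fun x => NNReal.coe_nonneg _)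
          (hab.trans hbd).le
        simp only [ENNReal.ofReal_coe_nnreal] at h3
        rw [h3, ← hIdef, ENNReal.ofReal_mul (by norm_num), ENNReal.ofReal_mul (by positivity)]
        simp

/-- The powers of `D` cancel, leaving `(2 · 256^δ)^(1/(1+δ)) I`; the bound `512 I` is uniform in
`δ`. -/
theorem rpow_mul_rpow_le_of_reverse_holder {δ I D : ℝ} (hδ : 0 < δ) (hI : 0 < I) (hD : 0 < D) :
    (2 * ((2 * I / D) ^ δ * I)) ^ (1 / (1 + δ)) * (128 * D) ^ (1 / ((1 + δ) / δ)) ≤ 512 * I := by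
  have hr : 0 < 1 + δ := by linarith
  have h1 : (128 * D) ^ (1 / ((1 + δ) / δ)) = ((128 * D) ^ δ) ^ (1 / (1 + δ)) := by
    rw [← Real.rpow_mul (by positivity)]; congr 1; field_simp
  rw [h1, ← Real.mul_rpow (by positivity) (by positivity)]
  have h2 : 2 * ((2 * I / D) ^ δ * I) * (128 * D) ^ δ = 2 * 256 ^ δ * I ^ (1 + δ) := by
    have : (2 * I / D) ^ δ * (128 * D) ^ δ = 256 ^ δ * I ^ δ := by
      rw [← Real.mul_rpow (by positivity) (by positivity),
        ← Real.mul_rpow (by positivity) (by positivity)]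
      congr 1; field_simp; norm_num
    rw [Real.rpow_add hI, Real.rpow_one]
    linear_combination (2 * I) * this
  rw [h2]
  have h3 : (2 : ℝ) * 256 ^ δ * I ^ (1 + δ) ≤ (512 * I) ^ (1 + δ) := by
    rw [Real.mul_rpow (by norm_num) hI.le, Real.rpow_add (by norm_num : (0 : ℝ) < 512),
      Real.rpow_one]
    have : (256 : ℝ) ^ δ ≤ 512 ^ δ := Real.rpow_le_rpow (by norm_num) (by norm_num) hδ.le
    gcongr
    norm_num
  calc _ ≤ ((512 * I) ^ (1 + δ)) ^ (1 / (1 + δ)) :=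
        Real.rpow_le_rpow (by positivity) h3 (by positivity)
    _ = 512 * I := by
        rw [← Real.rpow_mul (by positivity), mul_one_div_cancel hr.ne', Real.rpow_one]

theorem setLIntegral_Ioo_ne_zero {F : ℝ → ℝ≥0∞} (hF : AEMeasurable F volume)
    (hpos : ∀ᵐ x, F x ≠ 0) {a b : ℝ} (hab : a < b) : ∫⁻ x in Ioo a b, F x ≠ 0 := by
  intro h
  rw [lintegral_eq_zero_iff' hF.restrict] at h
  have : ∀ᵐ x ∂(volume.restrict (Ioo a b)), False := by
    filter_upwards [h, ae_restrict_of_ae hpos] with x h1 h2 using h2 h1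
  rw [Filter.eventually_false_iff_eq_bot, ae_eq_bot, Measure.restrict_eq_zero,
    Real.volume_Ioo] at this
  simp only [ENNReal.ofReal_eq_zero, sub_nonpos] at this
  linarith

/-- The reverse Hölder inequality in the form in which it is used: an `A_p^+` weight may be
multiplied by a factor whose high power is controlled. -/
theorem lintegral_mul_le_of_reverse_holder {p τ η δ a b d : ℝ} (hp : 1 < p) {W : ℝ → ℝ≥0}
    (hW : LocallyIntegrable (fun x => (W x : ℝ)) volume) (hpos : ∀ᵐ x, 0 < W x)
    (hτ : ApPlusConst p W ≤ ENNReal.ofReal τ) (hη : 0 < η) (hη1 : η ≤ 1)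
    (hητ : 2 * τ * η < (1 / 4) ^ (p - 1)) (hδ : 0 < δ) (hδη : δ ≤ η / 24)
    (hab : a < b) (hbd : b < d) {G : ℝ → ℝ≥0∞} (hG : AEMeasurable G volume)
    (hGle : ∫⁻ x in Ioo a b, G x ^ ((1 + δ) / δ) ≤ ENNReal.ofReal (128 * (d - b))) :
    ∫⁻ x in Ioo a b, (W x : ℝ≥0∞) * G x ≤ 512 * ∫⁻ x in Ioo a d, (W x : ℝ≥0∞) := by
  have hdb : 0 < d - b := sub_pos.2 hbd
  have hIeq := setLIntegral_Ioo_ofReal_eq hW (fun x => NNReal.coe_nonneg _) (hab.trans hbd).le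
  simp only [ENNReal.ofReal_coe_nnreal] at hIeq
  have hWm : AEMeasurable (fun x => (W x : ℝ≥0∞)) volume := by
    simpa using hW.aestronglyMeasurable.aemeasurable.ennreal_ofReal
  have hI : 0 < ∫ x in a..d, (W x : ℝ) := by
    have := setLIntegral_Ioo_ne_zero hWm
      (by filter_upwards [hpos] with x hx; simpa using hx.ne') (hab.trans hbd)
    rw [hIeq] at this
    simpa using this
  set I := ∫ x in a..d, (W x : ℝ) with hIdef
  have hr : 0 < 1 + δ := by linarith
  have hconj : (1 + δ).HolderConjugate ((1 + δ) / δ) := by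
    rw [Real.holderConjugate_iff]
    refine ⟨by linarith, ?_⟩
    field_simp
  have hhol := ENNReal.lintegral_mul_le_Lp_mul_Lq (volume.restrict (Ioo a b)) hconj
    hWm.restrict hG.restrict
  have h1 := lintegral_rpow_one_add_le_of_lt hp hW hτ hη hη1 hητ hδ hδη hab hbd hI
  refine hhol.trans ?_
  refine (mul_le_mul' (ENNReal.rpow_le_rpow h1 (by positivity))
    (ENNReal.rpow_le_rpow hGle (by positivity))).trans ?_
  rw [hIeq, ← hIdef, ENNReal.ofReal_rpow_of_nonneg (by positivity) (by positivity),
    ENNReal.ofReal_rpow_of_nonneg (by positivity) (by positivity),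
    ← ENNReal.ofReal_mul (by positivity)]
  refine (ENNReal.ofReal_le_ofReal (rpow_mul_rpow_le_of_reverse_holder hδ hI hdb)).trans ?_
  rw [ENNReal.ofReal_mul (by norm_num)]
  simp

/-- John–Nirenberg at the exponent `s (1 + δ) / δ`, admissible because `(1 + δ) / 16 ≤ 1/8`; the
constant is `16 · 8 = 128`. The mean is attached to the larger interval `(u, v)`, so that one
centring serves both the weight and its dual. -/
theorem lintegral_exp_rpow_le {δ a b u v s B D : ℝ} {f : ℝ → ℝ} (hδ : 0 < δ) (hδ1 : δ ≤ 1)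
    (hf : LocallyIntegrable f volume) (hB : 0 < B) (hosc : HasMeanOscillationLE f B)
    (hsB : |s| * B ≤ δ / 16) (hua : u ≤ a) (hbv : b ≤ v) (huv : u < v)
    (hD : v - u ≤ 8 * D) :
    ∫⁻ x in Ioo a b, ENNReal.ofReal (Real.exp (s * (f x - intervalMean f u (2 * v - u)))) ^
      ((1 + δ) / δ) ≤ ENNReal.ofReal (128 * D) := by
  set m := intervalMean f u (2 * v - u)
  have hJN := lintegral_exp_sub_intervalMean_le hf hB hosc (a := u) (c := v)
    (s := s * ((1 + δ) / δ)) huv (by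
      rw [abs_mul, abs_of_pos (show 0 < (1 + δ) / δ by positivity)]
      have : (1 + δ) / δ * (|s| * B) ≤ (1 + δ) / δ * (δ / 16) := by gcongr
      have h4 : (1 + δ) / δ * (δ / 16) = (1 + δ) / 16 := by field_simp
      nlinarith)
  calc _ ≤ ∫⁻ x in Ioo u v, ENNReal.ofReal (Real.exp (s * (f x - m))) ^ ((1 + δ) / δ) :=
        lintegral_mono_set (Ioo_subset_Ioo hua hbv)
    _ = ∫⁻ x in Ioo u v, ENNReal.ofReal (Real.exp (s * ((1 + δ) / δ) * (f x - m))) := by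
        refine lintegral_congr fun x => ?_
        rw [ENNReal.ofReal_rpow_of_pos (Real.exp_pos _), ← Real.exp_mul]
        congr 2; ring
    _ ≤ _ := hJN.trans (ENNReal.ofReal_le_ofReal (by linarith))

/-! ### Reflection and the dual weight -/

theorem setLIntegral_Ioo_comp_neg (F : ℝ → ℝ≥0∞) (a b : ℝ) :
    ∫⁻ x in Ioo a b, F (-x) = ∫⁻ x in Ioo (-b) (-a), F x := by
  have := (Measure.measurePreserving_neg (volume : Measure ℝ)).setLIntegral_comp_preimage_emb
    (MeasurableEquiv.neg ℝ).measurableEmbedding F (Ioo (-b) (-a))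
  rw [← this]
  simp

theorem MemApPlus.aemeasurable {p : ℝ} {W : ℝ → ℝ≥0} (hW : MemApPlus p W) :
    AEMeasurable (fun x => (W x : ℝ≥0∞)) volume := by
  simpa using hW.locallyIntegrable.aestronglyMeasurable.aemeasurable.ennreal_ofReal

theorem locallyIntegrable_of_forall_lintegral_lt_top {W : ℝ → ℝ≥0}
    (hWm : AEMeasurable (fun x => (W x : ℝ≥0∞)) volume)
    (h : ∀ a b : ℝ, a < b → ∫⁻ x in Ioo a b, (W x : ℝ≥0∞) < ∞) :
    LocallyIntegrable (fun x => (W x : ℝ)) volume := by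
  intro x
  refine ⟨Ioo (x - 1) (x + 1), Ioo_mem_nhds (by linarith) (by linarith), ?_, ?_⟩
  · exact hWm.ennreal_toReal.aestronglyMeasurable.restrict
  · have := h (x - 1) (x + 1) (by linarith)
    simpa [HasFiniteIntegral] using this

/-- The mean of a weight over an interval is finite as soon as the `A_p^+` constant is. -/
theorem memApPlus_of_const_lt_top {p : ℝ} (hp : 1 < p) {W : ℝ → ℝ≥0}
    (hWm : AEMeasurable (fun x => (W x : ℝ≥0∞)) volume) (hpos : ∀ᵐ x, 0 < W x)
    (hc : ApPlusConst p W < ∞) : MemApPlus p W := by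
  refine ⟨locallyIntegrable_of_forall_lintegral_lt_top hWm fun a b hab => ?_, hpos, hc⟩
  have h := (apPlusConst_le_iff hp).1 (le_refl (ApPlusConst p W)) a b (b + 1) hab (by linarith)
  -- Since `W` takes finite values its dual power never vanishes, so an infinite integral of `W`
  -- would make the `A_p^+` product infinite.
  have hY : ∫⁻ x in Ioo b (b + 1), (W x : ℝ≥0∞) ^ (-1 / (p - 1)) ≠ 0 := by
    refine setLIntegral_Ioo_ne_zero (hWm.pow_const _) ?_ (by linarith)
    filter_upwards [hpos] with x hx
    simp [ENNReal.rpow_eq_zero_iff, hx.ne']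
  by_contra htop
  rw [not_lt, top_le_iff] at htop
  rw [htop, ENNReal.top_mul] at h
  · refine absurd (top_le_iff.1 h) (ENNReal.mul_lt_top hc ?_).ne
    exact ENNReal.rpow_lt_top_of_nonneg (by linarith) ENNReal.ofReal_ne_top
  · simp [ENNReal.rpow_eq_zero_iff, hY, hp.le]

/-- The dual weight, reflected so as to be again of `A^+` type. -/
noncomputable def dualWeight (p : ℝ) (W : ℝ → ℝ≥0) (x : ℝ) : ℝ≥0 := W (-x) ^ (-1 / (p - 1))

theorem coe_dualWeight_ae {p : ℝ} {W : ℝ → ℝ≥0} (hpos : ∀ᵐ x, 0 < W x) :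
    ∀ᵐ x, 0 < W (-x) ∧ (dualWeight p W x : ℝ≥0∞) = (W (-x) : ℝ≥0∞) ^ (-1 / (p - 1)) := by
  have := (Measure.measurePreserving_neg (volume : Measure ℝ)).quasiMeasurePreserving.ae hpos
  filter_upwards [this] with x hx
  exact ⟨hx, by rw [dualWeight, ENNReal.coe_rpow_of_ne_zero hx.ne']⟩

theorem lintegral_dualWeight {p : ℝ} {W : ℝ → ℝ≥0} (hpos : ∀ᵐ x, 0 < W x) (a b : ℝ) :
    ∫⁻ x in Ioo a b, (dualWeight p W x : ℝ≥0∞) =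
      ∫⁻ x in Ioo (-b) (-a), (W x : ℝ≥0∞) ^ (-1 / (p - 1)) := by
  rw [← setLIntegral_Ioo_comp_neg (fun x => (W x : ℝ≥0∞) ^ (-1 / (p - 1)))]
  refine lintegral_congr_ae (ae_restrict_of_ae ?_)
  filter_upwards [coe_dualWeight_ae hpos] with x hx using hx.2

/-- The reflected dual weight of an `A_p^+` weight is in `A_{p'}^+`. -/
theorem MemApPlus.dualWeight {p : ℝ} (hp : 1 < p) {W : ℝ → ℝ≥0} (hW : MemApPlus p W) :
    MemApPlus (p / (p - 1)) (dualWeight p W) ∧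
      ApPlusConst (p / (p - 1)) (dualWeight p W) ≤ ApPlusConst p W ^ (1 / (p - 1)) := by
  have hp1 : 0 < p - 1 := by linarith
  have hp' : 1 < p / (p - 1) := by rw [one_lt_div hp1]; linarith
  have hpp : p / (p - 1) - 1 = 1 / (p - 1) := by field_simp; ring
  have hle : ApPlusConst (p / (p - 1)) (_root_.dualWeight p W) ≤
      ApPlusConst p W ^ (1 / (p - 1)) := by
    refine (apPlusConst_le_iff hp').2 fun a b c hab hbc => ?_
    have h := (apPlusConst_le_iff hp).1 (le_refl (ApPlusConst p W)) (-c) (-b) (-a)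
      (by linarith) (by linarith)
    have h2 : ∫⁻ x in Ioo b c, (_root_.dualWeight p W x : ℝ≥0∞) ^ (-1 / (p / (p - 1) - 1)) =
        ∫⁻ x in Ioo (-c) (-b), (W x : ℝ≥0∞) := by
      rw [← setLIntegral_Ioo_comp_neg (fun x => (W x : ℝ≥0∞))]
      refine lintegral_congr_ae (ae_restrict_of_ae ?_)
      filter_upwards [coe_dualWeight_ae (p := p) hW.pos] with x hx
      rw [hx.2, ← ENNReal.rpow_mul, hpp]
      have : -1 / (p - 1) * (-1 / (1 / (p - 1))) = 1 := by field_simp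
      rw [this, ENNReal.rpow_one]
    rw [lintegral_dualWeight hW.pos, h2, hpp]
    -- The power `1/(p-1)` interchanges the roles of the two factors, and the reflection restores
    -- their order on the line.
    have h3 := ENNReal.rpow_le_rpow h (show 0 ≤ 1 / (p - 1) by positivity)
    rw [ENNReal.mul_rpow_of_nonneg _ _ (by positivity), ENNReal.mul_rpow_of_nonneg _ _
      (by positivity), ← ENNReal.rpow_mul, ← ENNReal.rpow_mul, mul_one_div_cancel hp1.ne',
      ENNReal.rpow_one, mul_one_div, mul_comm] at h3
    rwa [show c - a = -a - -c by ring]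
  refine ⟨memApPlus_of_const_lt_top hp' ?_ ?_ ?_, hle⟩
  · have : AEMeasurable (fun x => (W (-x) : ℝ≥0∞) ^ (-1 / (p - 1))) volume :=
      (hW.aemeasurable.comp_quasiMeasurePreserving
        (Measure.measurePreserving_neg (volume : Measure ℝ)).quasiMeasurePreserving).pow_const _
    refine this.congr ?_
    filter_upwards [coe_dualWeight_ae (p := p) hW.pos] with x hx using hx.2.symm
  · filter_upwards [coe_dualWeight_ae (p := p) hW.pos] with x hx
    exact NNReal.rpow_pos hx.1
  · exact hle.trans_lt (ENNReal.rpow_lt_top_of_nonneg (by positivity) hW.const_lt_top.ne)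

/-- The counterpart of `lintegral_mul_le_of_reverse_holder` for the dual weight. -/
theorem lintegral_dual_mul_le_of_reverse_holder {p τ η δ a b d : ℝ} (hp : 1 < p) {W : ℝ → ℝ≥0}
    (hW : MemApPlus p W) (hτ : ApPlusConst p W ^ (1 / (p - 1)) ≤ ENNReal.ofReal τ) (hη : 0 < η)
    (hη1 : η ≤ 1) (hητ : 2 * τ * η < (1 / 4) ^ (1 / (p - 1))) (hδ : 0 < δ) (hδη : δ ≤ η / 24)
    (hda : d < a) (hab : a < b) {G : ℝ → ℝ≥0∞} (hG : AEMeasurable G volume)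
    (hGle : ∫⁻ x in Ioo a b, G x ^ ((1 + δ) / δ) ≤ ENNReal.ofReal (128 * (a - d))) :
    ∫⁻ x in Ioo a b, (W x : ℝ≥0∞) ^ (-1 / (p - 1)) * G x ≤
      512 * ∫⁻ x in Ioo d b, (W x : ℝ≥0∞) ^ (-1 / (p - 1)) := by
  have hp1 : 0 < p - 1 := by linarith
  have hp' : 1 < p / (p - 1) := by rw [one_lt_div hp1]; linarith
  have hpp : p / (p - 1) - 1 = 1 / (p - 1) := by field_simp; ring
  obtain ⟨hd, hdc⟩ := hW.dualWeight hp
  -- Under reflection the spare interval `(d, a)` on the left becomes `(-a, -d)` on the right.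
  have := lintegral_mul_le_of_reverse_holder hp' hd.locallyIntegrable hd.pos (hdc.trans hτ) hη hη1
    (by rwa [hpp]) hδ hδη (a := -b) (b := -a) (d := -d) (by linarith) (by linarith)
    (G := fun x => G (-x)) (hG.comp_quasiMeasurePreserving
        (Measure.measurePreserving_neg (volume : Measure ℝ)).quasiMeasurePreserving) (by
      rw [setLIntegral_Ioo_comp_neg (fun x => G x ^ ((1 + δ) / δ))]
      simpa [add_comm, sub_eq_add_neg] using hGle)
  rw [lintegral_dualWeight hW.pos, neg_neg, neg_neg] at this
  refine le_trans (le_of_eq ?_) this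
  have h2 := setLIntegral_Ioo_comp_neg (fun x => (W x : ℝ≥0∞) ^ (-1 / (p - 1)) * G x) (-b) (-a)
  rw [neg_neg, neg_neg] at h2
  rw [← h2]
  refine lintegral_congr_ae (ae_restrict_of_ae ?_)
  filter_upwards [coe_dualWeight_ae (p := p) hW.pos] with x hx
  rw [hx.2]

/-! ### From separated to adjacent intervals -/

/-- The summation behind the passage from separated to adjacent intervals. -/
theorem mul_rpow_le_of_separated {s G : ℝ} (hs : 0 < s) (hG : 0 ≤ G) {B T : ℕ → ℝ}
    (hB : Antitone B) (hT : ∀ n, 0 ≤ T n)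
    (hB0 : Filter.Tendsto B Filter.atTop (nhds 0))
    (h1 : ∀ n, (B n - B (n + 1)) * T n ^ s ≤ G * ((1 / 2 : ℝ) ^ n) ^ (s + 1))
    (h2 : ∀ n, B n * (T n - T (n + 1)) ^ s ≤ G * ((1 / 2 : ℝ) ^ n) ^ (s + 1)) :
    B 0 * T 0 ^ s ≤ (2 ^ s + 2) * G := by
  have hBnn : ∀ n, 0 ≤ B n := hB.le_of_tendsto hB0
  by_contra! hcon
  have h2s : (0 : ℝ) < 2 ^ s := by positivity
  -- As long as `T` decays no faster than `2^(-n)`, the differences of `B` telescope into a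
  -- geometric series of sum at most `2G`.
  have key : ∀ n, (1 / 2 : ℝ) ^ n * T 0 ≤ T n ∧
      B 0 * T 0 ^ s ≤ G * (2 - 2 * (1 / 2) ^ n) + B n * T 0 ^ s := by
    intro n
    induction n with
    | zero => simp
    | succ n ih =>
      obtain ⟨ih1, ih2⟩ := ih
      have hh : (0 : ℝ) < (1 / 2) ^ n := by positivity
      have hh1 : ((1 / 2 : ℝ)) ^ n ≤ 1 := pow_le_one₀ (by norm_num) (by norm_num)
      set h := (1 / 2 : ℝ) ^ n with hhdef
      have hpow : h ^ (s + 1) = h ^ s * h := by rw [Real.rpow_add hh, Real.rpow_one]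
      have hhs : 0 < h ^ s := by positivity
      have hsucc : (1 / 2 : ℝ) ^ (n + 1) = h / 2 := by rw [pow_succ, hhdef]; ring
      rw [hsucc]
      -- If the decay is faster at this step, then `T n - T (n + 1)` is at least `h / 2 * T 0`, and
      -- `h2` gives `B n * T 0 ^ s ≤ 2 ^ s * G * h`. With the telescoped part this contradicts
      -- `hcon`.
      by_cases hc : h / 2 * T 0 ≤ T (n + 1)
      · refine ⟨hc, ?_⟩
        have h3 : h ^ s * T 0 ^ s ≤ T n ^ s := by
          rw [← Real.mul_rpow hh.le (hT 0)]
          exact Real.rpow_le_rpow (mul_nonneg hh.le (hT 0)) ih1 hs.le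
        have h4 : (B n - B (n + 1)) * T 0 ^ s ≤ G * h := by
          have h5 := (mul_le_mul_of_nonneg_left h3
            (sub_nonneg.2 (hB n.le_succ))).trans (h1 n)
          rw [hpow] at h5
          refine le_of_mul_le_mul_left ?_ hhs
          linarith
        linarith
      · exfalso
        push Not at hc
        have h3 : h / 2 * T 0 ≤ T n - T (n + 1) := by linarith
        have h4 : (h ^ s / 2 ^ s) * T 0 ^ s ≤ (T n - T (n + 1)) ^ s := by
          rw [← Real.div_rpow hh.le (by norm_num), ← Real.mul_rpow (by positivity) (hT 0)]
          exact Real.rpow_le_rpow (mul_nonneg (by positivity) (hT 0)) h3 hs.le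
        have h5 := (mul_le_mul_of_nonneg_left h4 (hBnn n)).trans (h2 n)
        rw [hpow] at h5
        have h6 : B n * T 0 ^ s ≤ 2 ^ s * (G * h) := by
          rw [← sub_nonneg] at h5 ⊢
          have : 2 ^ s * (G * h) - B n * T 0 ^ s =
            (2 ^ s / h ^ s) * (G * (h ^ s * h) - B n * (h ^ s / 2 ^ s * T 0 ^ s)) := by
            field_simp
          rw [this]; positivity
        have h7 : 2 ^ s * (G * h) ≤ 2 ^ s * G := by
          have : G * h ≤ G := mul_le_of_le_one_right hG hh1
          gcongr
        have h8 : 0 ≤ G * h := by positivity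
        linarith
  have hlim : Filter.Tendsto (fun n => G * 2 + B n * T 0 ^ s) Filter.atTop
      (nhds (G * 2 + 0 * T 0 ^ s)) := (hB0.mul_const _).const_add _
  have := ge_of_tendsto' hlim (b := B 0 * T 0 ^ s) fun n => by
    have h3 : 0 ≤ G * (1 / 2 : ℝ) ^ n := by positivity
    linarith [(key n).2]
  have h9 : 0 ≤ 2 ^ s * G := by positivity
  linarith

theorem setLIntegral_Ioo_add_adjacent (F : ℝ → ℝ≥0∞) {a b c : ℝ} (hab : a ≤ b) (hbc : b ≤ c) :
    ∫⁻ x in Ioo a c, F x = (∫⁻ x in Ioo a b, F x) + ∫⁻ x in Ioo b c, F x := by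
  have h : ∀ u v : ℝ, ∫⁻ x in Ioo u v, F x = ∫⁻ x in Ioc u v, F x := fun u v =>
    setLIntegral_congr Ioo_ae_eq_Ioc
  rw [h, h, h, ← Ioc_union_Ioc_eq_Ioc hab hbc,
    lintegral_union measurableSet_Ioc (Ioc_disjoint_Ioc_of_le le_rfl)]

/-- A product estimate for separated intervals implies one for adjacent intervals. -/
theorem lintegral_mul_rpow_le_of_separated {s G β h : ℝ} (hs : 0 < s) (hG : 0 ≤ G) (hh : 0 < h)
    {U V : ℝ → ℝ≥0∞}
    (hU : ∫⁻ x in Ioo (β - h) β, U x < ∞) (hV : ∫⁻ x in Ioo β (β + h), V x < ∞)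
    (h1 : ∀ r, 0 < r → (∫⁻ x in Ioo (β - r) (β - r / 2), U x) *
      (∫⁻ x in Ioo β (β + r), V x) ^ s ≤ ENNReal.ofReal (G * r ^ (s + 1)))
    (h2 : ∀ r, 0 < r → (∫⁻ x in Ioo (β - r) β, U x) *
      (∫⁻ x in Ioo (β + r / 2) (β + r), V x) ^ s ≤ ENNReal.ofReal (G * r ^ (s + 1))) :
    (∫⁻ x in Ioo (β - h) β, U x) * (∫⁻ x in Ioo β (β + h), V x) ^ s ≤
      ENNReal.ofReal ((2 ^ s + 2) * (G * h ^ (s + 1))) := by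
  set r : ℕ → ℝ := fun n => h * (1 / 2) ^ n with hr
  have hr0 : ∀ n, 0 < r n := fun n => by positivity
  have hrs : ∀ n, r (n + 1) = r n / 2 := fun n => by simp only [hr, pow_succ]; ring
  have hrle : ∀ n, r n ≤ h := fun n =>
    mul_le_of_le_one_right hh.le (pow_le_one₀ (by norm_num) (by norm_num))
  have hranti : Antitone r := antitone_nat_of_succ_le fun n => by
    rw [hrs]; linarith [hr0 n]
  set b : ℕ → ℝ≥0∞ := fun n => ∫⁻ x in Ioo (β - r n) β, U x with hb
  set t : ℕ → ℝ≥0∞ := fun n => ∫⁻ x in Ioo β (β + r n), V x with ht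
  have hbfin : ∀ n, b n ≠ ∞ := fun n =>
    ((lintegral_mono_set (Ioo_subset_Ioo_left (by linarith [hrle n]))).trans_lt hU).ne
  have htfin : ∀ n, t n ≠ ∞ := fun n =>
    ((lintegral_mono_set (Ioo_subset_Ioo_right (by linarith [hrle n]))).trans_lt hV).ne
  have hbadd : ∀ n, b n = (∫⁻ x in Ioo (β - r n) (β - r n / 2), U x) + b (n + 1) := fun n => by
    simp only [hb, hrs]
    exact setLIntegral_Ioo_add_adjacent U (by linarith [hr0 n]) (by linarith [hr0 n])
  have htadd : ∀ n, t n = t (n + 1) + ∫⁻ x in Ioo (β + r n / 2) (β + r n), V x := fun n => by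
    simp only [ht, hrs]
    exact setLIntegral_Ioo_add_adjacent V (by linarith [hr0 n]) (by linarith [hr0 n])
  have hbsub : ∀ n, (b n).toReal - (b (n + 1)).toReal =
      (∫⁻ x in Ioo (β - r n) (β - r n / 2), U x).toReal := fun n => by
    have hne := hbfin n
    rw [hbadd n, ENNReal.add_ne_top] at hne
    rw [hbadd n, ENNReal.toReal_add hne.1 hne.2]; ring
  have htsub : ∀ n, (t n).toReal - (t (n + 1)).toReal =
      (∫⁻ x in Ioo (β + r n / 2) (β + r n), V x).toReal := fun n => by
    have hne := htfin n
    rw [htadd n, ENNReal.add_ne_top] at hne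
    rw [htadd n, ENNReal.toReal_add hne.1 hne.2]; ring
  have hconv : ∀ n, G * r n ^ (s + 1) = G * h ^ (s + 1) * ((1 / 2 : ℝ) ^ n) ^ (s + 1) := fun n => by
    simp only [hr]
    rw [Real.mul_rpow hh.le (by positivity)]; ring
  have htoReal : ∀ {x y : ℝ≥0∞} {c : ℝ}, 0 ≤ c → x * y ^ s ≤ ENNReal.ofReal c →
      x.toReal * y.toReal ^ s ≤ c := fun {x y c} hc hle => by
    have := ENNReal.toReal_mono ENNReal.ofReal_ne_top hle
    rwa [ENNReal.toReal_mul, ← ENNReal.toReal_rpow, ENNReal.toReal_ofReal hc] at this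
  have hBlim : Filter.Tendsto (fun n => (b n).toReal) Filter.atTop (nhds 0) := by
    have hz : Filter.Tendsto b Filter.atTop (nhds 0) := by
      have := tendsto_setLIntegral_zero (μ := volume.restrict (Ioo (β - h) β)) (f := U) hU.ne
        (l := Filter.atTop) (s := fun n : ℕ => Ioo (β - r n) β) ?_
      · refine this.congr fun n => ?_
        rw [Measure.restrict_restrict measurableSet_Ioo, inter_eq_self_of_subset_left
          (Ioo_subset_Ioo_left (by linarith [hrle n]))]
      · have h3 : Filter.Tendsto (fun n => ENNReal.ofReal (r n)) Filter.atTop (nhds 0) := by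
          have h4 : Filter.Tendsto r Filter.atTop (nhds (h * 0)) :=
            (tendsto_pow_atTop_nhds_zero_of_lt_one (by norm_num) (by norm_num)).const_mul h
          rw [mul_zero] at h4
          simpa using ENNReal.tendsto_ofReal h4
        refine tendsto_of_tendsto_of_tendsto_of_le_of_le tendsto_const_nhds h3
          (fun n => zero_le) fun n => ?_
        refine (Measure.restrict_apply_le _ _).trans ?_
        simp
    simpa [Function.comp_def] using (ENNReal.tendsto_toReal ENNReal.zero_ne_top).comp hz
  have hfin := mul_rpow_le_of_separated hs (G := G * h ^ (s + 1)) (by positivity)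
    (B := fun n => (b n).toReal) (T := fun n => (t n).toReal)
    (fun m n hmn => ENNReal.toReal_mono (hbfin m)
      (lintegral_mono_set (Ioo_subset_Ioo_left (by linarith [hranti hmn]))))
    (fun n => ENNReal.toReal_nonneg)
    hBlim
    (fun n => by
      rw [hbsub, ← hconv]
      exact htoReal (by have := hr0 n; positivity) (h1 (r n) (hr0 n)))
    (fun n => by
      rw [htsub, ← hconv]
      exact htoReal (by have := hr0 n; positivity) (h2 (r n) (hr0 n)))
  have hb0 : b 0 = ∫⁻ x in Ioo (β - h) β, U x := by simp [hb, hr]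
  have ht0 : t 0 = ∫⁻ x in Ioo β (β + h), V x := by simp [ht, hr]
  rw [← hb0, ← ht0, ← ENNReal.ofReal_toReal (hbfin 0), ← ENNReal.ofReal_toReal (htfin 0),
    ENNReal.ofReal_rpow_of_nonneg ENNReal.toReal_nonneg hs.le,
    ← ENNReal.ofReal_mul ENNReal.toReal_nonneg]
  exact ENNReal.ofReal_le_ofReal hfin

/-! ### Perturbation of weights by exponentials -/

/-- The function `exp (s f)`, as a nonnegative real. -/
noncomputable def expWeight (s : ℝ) (f : ℝ → ℝ) (x : ℝ) : ℝ≥0 := (Real.exp (s * f x)).toNNReal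

theorem coe_expWeight (s : ℝ) (f : ℝ → ℝ) (x : ℝ) :
    (expWeight s f x : ℝ≥0∞) = ENNReal.ofReal (Real.exp (s * f x)) := rfl

theorem coe_expWeight_real (s : ℝ) (f : ℝ → ℝ) (x : ℝ) :
    (expWeight s f x : ℝ) = Real.exp (s * f x) := Real.coe_toNNReal _ (Real.exp_pos _).le

theorem expWeight_pos (s : ℝ) (f : ℝ → ℝ) (x : ℝ) : 0 < expWeight s f x :=
  Real.toNNReal_pos.2 (Real.exp_pos _)

theorem aemeasurable_ofReal_exp {f : ℝ → ℝ} (hf : AEMeasurable f volume) (s m : ℝ) :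
    AEMeasurable (fun x => ENNReal.ofReal (Real.exp (s * (f x - m)))) volume :=
  (Real.measurable_exp.comp_aemeasurable ((hf.sub aemeasurable_const).const_mul s)).ennreal_ofReal

theorem aemeasurable_mul_expWeight {W : ℝ → ℝ≥0}
    (hW : AEMeasurable (fun x => (W x : ℝ≥0∞)) volume) {f : ℝ → ℝ} (hf : AEMeasurable f volume)
    (s : ℝ) : AEMeasurable (fun x => ((W x * expWeight s f x : ℝ≥0) : ℝ≥0∞)) volume := by
  have h1 := aemeasurable_ofReal_exp hf s 0
  simp only [sub_zero] at h1
  simp only [ENNReal.coe_mul, coe_expWeight]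
  exact hW.mul h1

/-- Extracting `exp (s m)` centres `f` for John–Nirenberg. The extracted constants cancel in the
`A_p^+` product, since the dual factor carries the power `-1/(p-1)` and is raised to `p - 1`. -/
theorem coe_mul_expWeight (W : ℝ → ℝ≥0) (s : ℝ) (f : ℝ → ℝ) (m x : ℝ) :
    ((W x * expWeight s f x : ℝ≥0) : ℝ≥0∞) = ENNReal.ofReal (Real.exp (s * m)) *
      (W x * ENNReal.ofReal (Real.exp (s * (f x - m)))) := by
  rw [ENNReal.coe_mul, coe_expWeight, mul_left_comm, ← ENNReal.ofReal_mul (Real.exp_pos _).le,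
    ← Real.exp_add]
  congr 3; ring

theorem coe_mul_expWeight_rpow {W : ℝ → ℝ≥0} (s : ℝ) (f : ℝ → ℝ) (m : ℝ) {x : ℝ}
    (hx : 0 < W x) (e : ℝ) :
    ((W x * expWeight s f x : ℝ≥0) : ℝ≥0∞) ^ e = ENNReal.ofReal (Real.exp (s * m)) ^ e *
      ((W x : ℝ≥0∞) ^ e * ENNReal.ofReal (Real.exp (s * e * (f x - m)))) := by
  have h0 : ∀ y, ENNReal.ofReal (Real.exp y) ≠ 0 := fun y => by simp [Real.exp_pos]
  have hW : (W x : ℝ≥0∞) ≠ 0 := by simpa using hx.ne'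
  rw [coe_mul_expWeight W s f m, ENNReal.mul_rpow_of_ne_zero (h0 _) (mul_ne_zero hW (h0 _)),
    ENNReal.mul_rpow_of_ne_zero hW (h0 _), ENNReal.ofReal_rpow_of_pos (Real.exp_pos (s * (f x - m))),
    ← Real.exp_mul]
  congr 4; ring

/-- Parameters for which the reverse Hölder inequality applies to a weight and to its dual, and for
which the exponential of `s f` is integrable to the conjugate exponent. -/
structure PerturbationData (p : ℝ) (W : ℝ → ℝ≥0) (f : ℝ → ℝ) (s : ℝ) where
  τ : ℝ
  τ' : ℝ
  η : ℝ
  B : ℝ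
  hW : MemApPlus p W
  hτ : ApPlusConst p W ≤ ENNReal.ofReal τ
  hτ0 : 0 ≤ τ
  hτ' : ApPlusConst p W ^ (1 / (p - 1)) ≤ ENNReal.ofReal τ'
  hη : 0 < η
  hη1 : η ≤ 1
  hητ : 2 * τ * η < (1 / 4) ^ (p - 1)
  hητ' : 2 * τ' * η < (1 / 4) ^ (1 / (p - 1))
  hf : LocallyIntegrable f volume
  hB : 0 < B
  hosc : HasMeanOscillationLE f B
  hs : |s| * B ≤ η / 384
  hs' : |s / (p - 1)| * B ≤ η / 384

/-- The `A_p^+` estimate of the perturbed weight on separated intervals. -/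
theorem PerturbationData.separated {p : ℝ} (hp : 1 < p) {W : ℝ → ℝ≥0} {f : ℝ → ℝ} {s : ℝ}
    (D : PerturbationData p W f s) {u v a₁ b₁ c a₂ b₂ r : ℝ}
    (hua : u ≤ a₁) (hab₁ : a₁ < b₁) (hbc : b₁ + r / 4 ≤ c) (hca : c + r / 4 ≤ a₂)
    (hab₂ : a₂ < b₂) (hbv : b₂ ≤ v) (hr : 0 < r) (huv : v - u = 2 * r) :
    (∫⁻ x in Ioo a₁ b₁, ((W x * expWeight s f x : ℝ≥0) : ℝ≥0∞)) *
      (∫⁻ x in Ioo a₂ b₂, ((W x * expWeight s f x : ℝ≥0) : ℝ≥0∞) ^ (-1 / (p - 1))) ^ (p - 1) ≤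
      ENNReal.ofReal (1024 ^ p * D.τ * r ^ p) := by
  have hp1 : 0 < p - 1 := by linarith
  set m := intervalMean f u (2 * v - u) with hm
  -- The largest `δ` allowed by the reverse Hölder inequality. As `384 = 24 · 16`, the smallness
  -- conditions on `s` and `s / (p - 1)` become the bound `δ / 16` required for the exponential.
  set δ := D.η / 24 with hδ
  have hη := D.hη
  have hδ0 : 0 < δ := by positivity
  have hδ1 : δ ≤ 1 := by have := D.hη1; simp only [hδ]; linarith
  have hfm := D.hf.aestronglyMeasurable.aemeasurable
  -- The gap between `b₁` and `c` pays for enlarging `(a₁, b₁)` to `(a₁, c)`, and the gap between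
  -- `c` and `a₂` for enlarging `(a₂, b₂)` to `(c, b₂)`. The enlarged intervals meet at `c`, where
  -- the condition on `W` applies.
  have hX : ∫⁻ x in Ioo a₁ b₁, ((W x * expWeight s f x : ℝ≥0) : ℝ≥0∞) ≤
      ENNReal.ofReal (Real.exp (s * m)) * (512 * ∫⁻ x in Ioo a₁ c, (W x : ℝ≥0∞)) := by
    simp only [coe_mul_expWeight W s f m]
    rw [lintegral_const_mul' _ _ ENNReal.ofReal_ne_top]
    refine mul_le_mul_right ?_ _
    refine lintegral_mul_le_of_reverse_holder hp D.hW.locallyIntegrable D.hW.pos D.hτ D.hη D.hη1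
      D.hητ hδ0 le_rfl hab₁ (by linarith) (aemeasurable_ofReal_exp hfm _ _) ?_
    exact lintegral_exp_rpow_le hδ0 hδ1 D.hf D.hB D.hosc (by have := D.hs; simp only [hδ]; linarith)
      hua (by linarith) (by linarith) (by linarith)
  have hY : ∫⁻ x in Ioo a₂ b₂, ((W x * expWeight s f x : ℝ≥0) : ℝ≥0∞) ^ (-1 / (p - 1)) ≤
      ENNReal.ofReal (Real.exp (s * m)) ^ (-1 / (p - 1)) *
        (512 * ∫⁻ x in Ioo c b₂, (W x : ℝ≥0∞) ^ (-1 / (p - 1))) := by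
    have hcongr : ∫⁻ x in Ioo a₂ b₂, ((W x * expWeight s f x : ℝ≥0) : ℝ≥0∞) ^ (-1 / (p - 1)) =
        ∫⁻ x in Ioo a₂ b₂, ENNReal.ofReal (Real.exp (s * m)) ^ (-1 / (p - 1)) *
      ((W x : ℝ≥0∞) ^ (-1 / (p - 1)) *
        ENNReal.ofReal (Real.exp (s * (-1 / (p - 1)) * (f x - m)))) := by
      refine lintegral_congr_ae (ae_restrict_of_ae ?_)
      filter_upwards [D.hW.pos] with x hx using coe_mul_expWeight_rpow s f m hx _
    have hne : ENNReal.ofReal (Real.exp (s * m)) ^ (-1 / (p - 1)) ≠ ∞ := by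
      rw [ENNReal.ofReal_rpow_of_pos (Real.exp_pos _)]; exact ENNReal.ofReal_ne_top
    rw [hcongr, lintegral_const_mul' _ _ hne]
    refine mul_le_mul_right ?_ _
    refine lintegral_dual_mul_le_of_reverse_holder hp D.hW D.hτ' D.hη D.hη1
      D.hητ' hδ0 le_rfl (by linarith) hab₂ (aemeasurable_ofReal_exp hfm _ _) ?_
    refine lintegral_exp_rpow_le hδ0 hδ1 D.hf D.hB D.hosc ?_
      (by linarith) hbv (by linarith) (by linarith)
    have h1 := D.hs'
    have h2 : |s * (-1 / (p - 1))| = |s / (p - 1)| := by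
      rw [← abs_neg]; congr 1; ring
    rw [h2]; simp only [hδ]; linarith
  have hAp := (apPlusConst_le_iff hp).1 D.hτ a₁ c b₂ (by linarith) (by linarith)
  set X := ∫⁻ x in Ioo a₁ c, (W x : ℝ≥0∞)
  set Y := ∫⁻ x in Ioo c b₂, (W x : ℝ≥0∞) ^ (-1 / (p - 1))
  set E := ENNReal.ofReal (Real.exp (s * m)) with hE
  have hE0 : E ≠ 0 := by simp [hE, Real.exp_pos]
  have hEt : E ≠ ∞ := ENNReal.ofReal_ne_top
  calc _ ≤ (E * (512 * X)) * (E ^ (-1 / (p - 1)) * (512 * Y)) ^ (p - 1) :=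
        mul_le_mul' hX (ENNReal.rpow_le_rpow hY hp1.le)
    _ = (E * E⁻¹) * ((512 * 512 ^ (p - 1)) * (X * Y ^ (p - 1))) := by
        rw [ENNReal.mul_rpow_of_nonneg _ _ hp1.le, ENNReal.mul_rpow_of_nonneg _ _ hp1.le,
          ← ENNReal.rpow_mul, div_mul_cancel₀ _ hp1.ne', ENNReal.rpow_neg_one]
        ring
    _ = 512 ^ p * (X * Y ^ (p - 1)) := by
        rw [ENNReal.mul_inv_cancel hE0 hEt, one_mul]
        congr 1
        conv_rhs => rw [show p = 1 + (p - 1) by ring]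
        rw [ENNReal.rpow_add _ _ (by norm_num) (by norm_num), ENNReal.rpow_one]
    _ ≤ 512 ^ p * (ENNReal.ofReal D.τ * ENNReal.ofReal (2 * r) ^ p) := by
        refine mul_le_mul_right (hAp.trans ?_) _
        gcongr
        linarith
    _ = _ := by
        rw [ENNReal.ofReal_rpow_of_nonneg (by positivity) (by linarith),
          ← ENNReal.ofReal_ofNat 512, ENNReal.ofReal_rpow_of_nonneg (by norm_num) (by linarith),
          ← ENNReal.ofReal_mul D.hτ0, ← ENNReal.ofReal_mul (by positivity)]
        congr 1
        rw [Real.mul_rpow (by norm_num) hr.le, show (1024 : ℝ) = 512 * 2 by norm_num,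
          Real.mul_rpow (by norm_num) (by norm_num)]
        ring

/-- Multiplication by the exponential of a small multiple of a `BMO` function enlarges the
`A_p^+` constant at most by a factor. -/
theorem PerturbationData.apPlusConst_le {p : ℝ} (hp : 1 < p) {W : ℝ → ℝ≥0} {f : ℝ → ℝ} {s : ℝ}
    (D : PerturbationData p W f s) :
    ApPlusConst p (fun x => W x * expWeight s f x) ≤
      ENNReal.ofReal ((2 ^ (p - 1) + 2) * 1024 ^ p * D.τ) := by
  have hp1 : 0 < p - 1 := by linarith
  have hτ0 := D.hτ0
  set U : ℝ → ℝ≥0∞ := fun x => ((W x * expWeight s f x : ℝ≥0) : ℝ≥0∞) with hU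
  have hpp : p - 1 + 1 = p := by ring
  have hUm : AEMeasurable U volume :=
    aemeasurable_mul_expWeight D.hW.aemeasurable D.hf.aestronglyMeasurable.aemeasurable s
  have hUpos : ∀ᵐ x, 0 < W x * expWeight s f x := by
    filter_upwards [D.hW.pos] with x hx using mul_pos hx (expWeight_pos _ _ _)
  have hU0 : ∀ᵐ x, U x ≠ 0 := by
    filter_upwards [hUpos] with x hx; exact ENNReal.coe_ne_zero.2 hx.ne'
  have hV0 : ∀ᵐ x, U x ^ (-1 / (p - 1)) ≠ 0 := by
    filter_upwards with x
    rw [Ne, ENNReal.rpow_eq_zero_iff]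
    rintro (⟨-, h⟩ | ⟨h, -⟩)
    · exact absurd h (not_lt.2 (div_nonpos_of_nonpos_of_nonneg (by norm_num) hp1.le))
    · exact ENNReal.coe_ne_top h
  refine (apPlusConst_le_iff hp).2 fun a b c hab hbc => ?_
  -- A gap of length `r / 2` is left on one side of `b`, here the left one and in `hsep2` the right
  -- one; its midpoint is taken as `c`.
  have hsep1 : ∀ r, 0 < r → (∫⁻ x in Ioo (b - r) (b - r / 2), U x) *
      (∫⁻ x in Ioo b (b + r), U x ^ (-1 / (p - 1))) ^ (p - 1) ≤
        ENNReal.ofReal (1024 ^ p * D.τ * r ^ p) := fun r hr =>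
    D.separated hp (u := b - r) (v := b + r) (c := b - r / 4) le_rfl (by linarith) (by linarith)
      (by linarith) (by linarith) le_rfl hr (by ring)
  have hsep2 : ∀ r, 0 < r → (∫⁻ x in Ioo (b - r) b, U x) *
      (∫⁻ x in Ioo (b + r / 2) (b + r), U x ^ (-1 / (p - 1))) ^ (p - 1) ≤
        ENNReal.ofReal (1024 ^ p * D.τ * r ^ p) := fun r hr =>
    D.separated hp (u := b - r) (v := b + r) (c := b + r / 4) le_rfl (by linarith) (by linarith)
      (by linarith) (by linarith) le_rfl hr (by ring)
  have hh : 0 < c - a := by linarith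
  -- Local integrability of the perturbed weight is not known beforehand: it follows from the
  -- separated estimate, whose other factor is nonzero.
  have hUfin : ∫⁻ x in Ioo (b - (c - a)) b, U x < ∞ := by
    by_contra htop
    rw [not_lt, top_le_iff] at htop
    have h := hsep2 _ hh
    have hne := setLIntegral_Ioo_ne_zero (hUm.pow_const (-1 / (p - 1))) hV0
      (show b + (c - a) / 2 < b + (c - a) by linarith)
    rw [htop, ENNReal.top_mul (by simp [ENNReal.rpow_eq_zero_iff, hne, hp1.not_gt])] at h
    exact absurd (top_le_iff.1 h) ENNReal.ofReal_ne_top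
  have hVfin : ∫⁻ x in Ioo b (b + (c - a)), U x ^ (-1 / (p - 1)) < ∞ := by
    by_contra htop
    rw [not_lt, top_le_iff] at htop
    have h := hsep1 _ hh
    have hne := setLIntegral_Ioo_ne_zero hUm hU0
      (show b - (c - a) < b - (c - a) / 2 by linarith)
    rw [htop, ENNReal.top_rpow_of_pos hp1, ENNReal.mul_top hne] at h
    exact absurd (top_le_iff.1 h) ENNReal.ofReal_ne_top
  have hmain := lintegral_mul_rpow_le_of_separated hp1 (G := 1024 ^ p * D.τ) (by positivity) hh
    hUfin hVfin (by rw [hpp]; exact hsep1) (by rw [hpp]; exact hsep2)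
  rw [hpp] at hmain
  calc _ ≤ (∫⁻ x in Ioo (b - (c - a)) b, U x) *
        (∫⁻ x in Ioo b (b + (c - a)), U x ^ (-1 / (p - 1))) ^ (p - 1) :=
        mul_le_mul' (lintegral_mono_set (Ioo_subset_Ioo_left (by linarith)))
          (ENNReal.rpow_le_rpow (lintegral_mono_set (Ioo_subset_Ioo_right (by linarith))) hp1.le)
    _ ≤ _ := hmain
    _ = _ := by
        rw [ENNReal.ofReal_rpow_of_nonneg hh.le (by linarith), ← ENNReal.ofReal_mul (by positivity)]
        congr 1; ring

theorem PerturbationData.memApPlus {p : ℝ} (hp : 1 < p) {W : ℝ → ℝ≥0} {f : ℝ → ℝ} {s : ℝ}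
    (D : PerturbationData p W f s) : MemApPlus p (fun x => W x * expWeight s f x) := by
  refine memApPlus_of_const_lt_top hp ?_ ?_
    ((D.apPlusConst_le hp).trans_lt ENNReal.ofReal_lt_top)
  · exact aemeasurable_mul_expWeight D.hW.aemeasurable D.hf.aestronglyMeasurable.aemeasurable s
  · filter_upwards [D.hW.pos] with x hx using mul_pos hx (expWeight_pos _ _ _)

/-! ### Prescribing the constant of a perturbed weight -/

theorem MemApPlus.lintegral_dual_lt_top {p : ℝ} (hp : 1 < p) {W : ℝ → ℝ≥0} (hW : MemApPlus p W)
    {a b : ℝ} (hab : a < b) : ∫⁻ x in Ioo a b, (W x : ℝ≥0∞) ^ (-1 / (p - 1)) < ∞ := by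
  have h := (hW.dualWeight hp).1.locallyIntegrable
  have h2 := setLIntegral_Ioo_ofReal_eq h (fun x => NNReal.coe_nonneg _)
    (show -b ≤ -a by linarith)
  simp only [ENNReal.ofReal_coe_nnreal] at h2
  rw [lintegral_dualWeight hW.pos, neg_neg, neg_neg] at h2
  rw [h2]
  exact ENNReal.ofReal_lt_top

/-- The `A_p^+` constant of a weight is bounded below. -/
theorem MemApPlus.one_le_two_rpow_mul {p : ℝ} (hp : 1 < p) {W : ℝ → ℝ≥0} (hW : MemApPlus p W) :
    1 ≤ 2 ^ p * (ApPlusConst p W).toReal := by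
  have hp1 : 0 < p - 1 := by linarith
  set τ := (ApPlusConst p W).toReal with hτ
  set σ : ℝ → ℝ≥0 := fun x => W x ^ (-1 / (p - 1)) with hσ
  have hσae : ∀ᵐ x, (σ x : ℝ≥0∞) = (W x : ℝ≥0∞) ^ (-1 / (p - 1)) := by
    filter_upwards [hW.pos] with x hx
    rw [hσ, ENNReal.coe_rpow_of_ne_zero hx.ne']
  have hσint : ∀ a b, ∫⁻ x in Ioo a b, (σ x : ℝ≥0∞) =
      ∫⁻ x in Ioo a b, (W x : ℝ≥0∞) ^ (-1 / (p - 1)) := fun a b =>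
    lintegral_congr_ae (ae_restrict_of_ae hσae)
  have hσloc : LocallyIntegrable (fun x => (σ x : ℝ)) volume := by
    refine locallyIntegrable_of_forall_lintegral_lt_top ?_ fun a b hab => ?_
    · exact (hW.aemeasurable.pow_const (-1 / (p - 1))).congr (hσae.mono fun x hx => hx.symm)
    · rw [hσint]; exact hW.lintegral_dual_lt_top hp hab
  -- The triple `x - u < x < x + u` has total length `2u`, hence the factor `2^p`.
  have hreal : ∀ x u, 0 < u → (u⁻¹ * ∫ y in (x - u)..x, (W y : ℝ)) *
      (u⁻¹ * ∫ y in x..(x + u), (σ y : ℝ)) ^ (p - 1) ≤ 2 ^ p * τ := by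
    intro x u hu
    have h := (apPlusConst_le_iff hp).1 (le_refl (ApPlusConst p W)) (x - u) x (x + u)
      (by linarith) (by linarith)
    have h1 := setLIntegral_Ioo_ofReal_eq hW.locallyIntegrable (fun x => NNReal.coe_nonneg _)
      (show x - u ≤ x by linarith)
    have h2 := setLIntegral_Ioo_ofReal_eq hσloc (fun x => NNReal.coe_nonneg _)
      (show x ≤ x + u by linarith)
    simp only [ENNReal.ofReal_coe_nnreal] at h1 h2
    have hA : 0 ≤ ∫ y in (x - u)..x, (W y : ℝ) :=
      intervalIntegral.integral_nonneg (by linarith) fun _ _ => NNReal.coe_nonneg _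
    have hB : 0 ≤ ∫ y in x..(x + u), (σ y : ℝ) :=
      intervalIntegral.integral_nonneg (by linarith) fun _ _ => NNReal.coe_nonneg _
    rw [← hσint, h1, h2, ← ENNReal.ofReal_toReal hW.const_lt_top.ne, ← hτ,
      ENNReal.ofReal_rpow_of_nonneg hB hp1.le, ENNReal.ofReal_rpow_of_nonneg (by linarith)
      (by linarith), ← ENNReal.ofReal_mul hA, ← ENNReal.ofReal_mul ENNReal.toReal_nonneg,
      ENNReal.ofReal_le_ofReal_iff (mul_nonneg ENNReal.toReal_nonneg
        (Real.rpow_nonneg (by linarith) _)), show x + u - (x - u) = 2 * u by ring,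
      Real.mul_rpow (by norm_num) hu.le] at h
    rw [Real.mul_rpow (by positivity) hB, Real.inv_rpow hu.le]
    have hup : u ^ p = u * u ^ (p - 1) := by
      conv_lhs => rw [show p = 1 + (p - 1) by ring]
      rw [Real.rpow_add hu, Real.rpow_one]
    have hup0 : 0 < u ^ (p - 1) := by positivity
    rw [hup] at h
    calc _ = ((∫ y in (x - u)..x, (W y : ℝ)) * (∫ y in x..(x + u), (σ y : ℝ)) ^ (p - 1)) /
          (u * u ^ (p - 1)) := by field_simp
      _ ≤ _ := by
          rw [div_le_iff₀ (by positivity)]; linarith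
  -- At a point where both primitives are differentiable the averages tend to `W x` and `σ x`, and
  -- `W σ^(p-1) = 1`.
  obtain ⟨x, hxW, hxσ, hxpos⟩ := ((_root_.LocallyIntegrable.ae_hasDerivAt_integral
    hW.locallyIntegrable).and ((_root_.LocallyIntegrable.ae_hasDerivAt_integral hσloc).and
      hW.pos)).exists
  set u : ℕ → ℝ := fun n => 1 / ((n : ℝ) + 1) with hu
  have hu0 : ∀ n, 0 < u n := fun n => by positivity
  have hulim : Filter.Tendsto u Filter.atTop (nhds 0) := tendsto_one_div_add_atTop_nhds_zero_nat
  have hup : Filter.Tendsto u Filter.atTop (nhdsWithin 0 {0}ᶜ) :=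
    tendsto_nhdsWithin_iff.2 ⟨hulim, Filter.Eventually.of_forall fun n => (hu0 n).ne'⟩
  have hum : Filter.Tendsto (fun n => -u n) Filter.atTop (nhdsWithin 0 {0}ᶜ) :=
    tendsto_nhdsWithin_iff.2 ⟨by simpa using hulim.neg,
      Filter.Eventually.of_forall fun n => (neg_neg_of_pos (hu0 n)).ne⟩
  have hL : Filter.Tendsto (fun n => (u n)⁻¹ * ∫ y in (x - u n)..x, (W y : ℝ)) Filter.atTop
      (nhds (W x : ℝ)) := by
    refine ((hxW x).tendsto_slope_zero.comp hum).congr fun n => ?_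
    simp only [Function.comp, smul_eq_mul, intervalIntegral.integral_same, sub_zero]
    rw [intervalIntegral.integral_symm, ← sub_eq_add_neg, inv_neg]; ring
  have hR : Filter.Tendsto (fun n => (u n)⁻¹ * ∫ y in x..(x + u n), (σ y : ℝ)) Filter.atTop
      (nhds (σ x : ℝ)) := by
    refine ((hxσ x).tendsto_slope_zero.comp hup).congr fun n => ?_
    simp only [Function.comp, smul_eq_mul, intervalIntegral.integral_same, sub_zero]
  have hlim := hL.mul (hR.rpow_const (p := p - 1) (Or.inr hp1.le))
  have hle := le_of_tendsto' hlim fun n => hreal x (u n) (hu0 n)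
  have hWx : (0 : ℝ) < W x := hxpos
  have : (W x : ℝ) * (σ x : ℝ) ^ (p - 1) = 1 := by
    simp only [hσ, NNReal.coe_rpow]
    rw [← Real.rpow_mul hWx.le, div_mul_cancel₀ _ hp1.ne', Real.rpow_neg_one,
      mul_inv_cancel₀ hWx.ne']
  linarith

/-- The dual integral changes by at most `y^(1/(p-1))`, and the outer power turns this into `y`. -/
theorem apPlusConst_le_mul {p : ℝ} (hp : 1 < p) {W₁ W₂ : ℝ → ℝ≥0} {x y : ℝ≥0} (hy : 0 < y)
    (h₁ : ∀ z, W₁ z ≤ x * W₂ z) (h₂ : ∀ z, W₂ z ≤ y * W₁ z) :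
    ApPlusConst p W₁ ≤ x * y * ApPlusConst p W₂ := by
  have hp1 : 0 < p - 1 := by linarith
  refine (apPlusConst_le_iff hp).2 fun a b c hab hbc => ?_
  have h := (apPlusConst_le_iff hp).1 (le_refl (ApPlusConst p W₂)) a b c hab hbc
  have hX : ∫⁻ z in Ioo a b, (W₁ z : ℝ≥0∞) ≤ x * ∫⁻ z in Ioo a b, (W₂ z : ℝ≥0∞) := by
    rw [← lintegral_const_mul' _ _ ENNReal.coe_ne_top]
    exact lintegral_mono fun z => (ENNReal.coe_le_coe.2 (h₁ z)).trans_eq (ENNReal.coe_mul _ _)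
  have hy0 : (y : ℝ≥0∞) ^ (1 / (p - 1)) ≠ 0 := by
    simp [ENNReal.rpow_eq_zero_iff, hy.ne']
  have hyt : (y : ℝ≥0∞) ^ (1 / (p - 1)) ≠ ∞ :=
    ENNReal.rpow_ne_top_of_nonneg (by positivity) ENNReal.coe_ne_top
  have hY : ∫⁻ z in Ioo b c, (W₁ z : ℝ≥0∞) ^ (-1 / (p - 1)) ≤
      (y : ℝ≥0∞) ^ (1 / (p - 1)) * ∫⁻ z in Ioo b c, (W₂ z : ℝ≥0∞) ^ (-1 / (p - 1)) := by
    rw [← lintegral_const_mul' _ _ hyt]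
    refine lintegral_mono fun z => ?_
    have h3 : (W₂ z : ℝ≥0∞) ^ (1 / (p - 1)) ≤
        (y : ℝ≥0∞) ^ (1 / (p - 1)) * (W₁ z : ℝ≥0∞) ^ (1 / (p - 1)) := by
      rw [← ENNReal.mul_rpow_of_nonneg _ _ (by positivity)]
      exact ENNReal.rpow_le_rpow (by exact_mod_cast h₂ z) (by positivity)
    have h4 := ENNReal.inv_le_inv.2 h3
    rw [ENNReal.mul_inv (Or.inl hy0) (Or.inl hyt)] at h4
    simp only [neg_div, ENNReal.rpow_neg]
    calc _ = (y : ℝ≥0∞) ^ (1 / (p - 1)) * (((y : ℝ≥0∞) ^ (1 / (p - 1)))⁻¹ *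
          ((W₁ z : ℝ≥0∞) ^ (1 / (p - 1)))⁻¹) := by
          rw [← mul_assoc, ENNReal.mul_inv_cancel hy0 hyt, one_mul]
      _ ≤ _ := mul_le_mul_right h4 _
  calc _ ≤ (x * ∫⁻ z in Ioo a b, (W₂ z : ℝ≥0∞)) * ((y : ℝ≥0∞) ^ (1 / (p - 1)) *
        ∫⁻ z in Ioo b c, (W₂ z : ℝ≥0∞) ^ (-1 / (p - 1))) ^ (p - 1) :=
        mul_le_mul' hX (ENNReal.rpow_le_rpow hY hp1.le)
    _ = x * y * ((∫⁻ z in Ioo a b, (W₂ z : ℝ≥0∞)) *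
        (∫⁻ z in Ioo b c, (W₂ z : ℝ≥0∞) ^ (-1 / (p - 1))) ^ (p - 1)) := by
        rw [ENNReal.mul_rpow_of_nonneg _ _ hp1.le, ← ENNReal.rpow_mul,
          one_div_mul_cancel hp1.ne', ENNReal.rpow_one]
        ring
    _ ≤ _ := by
        rw [mul_assoc (x * y : ℝ≥0∞)]
        exact mul_le_mul_right h _

/-- The function equal to `1 + r` on the set `S` and to `1` elsewhere. -/
noncomputable def bump (S : Set ℝ) (r : ℝ) (x : ℝ) : ℝ≥0 := 1 + S.indicator (fun _ => r.toNNReal) x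

theorem one_le_bump (S : Set ℝ) (r x : ℝ) : 1 ≤ bump S r x := le_self_add

theorem bump_le (S : Set ℝ) (r x : ℝ) : bump S r x ≤ 1 + r.toNNReal := by
  rw [bump]
  by_cases hx : x ∈ S <;> simp [hx]

theorem measurable_bump {S : Set ℝ} (hS : MeasurableSet S) (r : ℝ) : Measurable (bump S r) :=
  measurable_const.add (measurable_const.indicator hS)

theorem bump_mono (S : Set ℝ) {r r' : ℝ} (h : r ≤ r') (x : ℝ) : bump S r x ≤ bump S r' x := by
  rw [bump, bump]
  by_cases hx : x ∈ S <;> simp [hx, Real.toNNReal_le_toNNReal h]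

theorem bump_le_mul (S : Set ℝ) {r r' : ℝ} (hr : 0 ≤ r) (h : r ≤ r') (x : ℝ) :
    bump S r' x ≤ (1 + (r' - r).toNNReal) * bump S r x := by
  have h1 : r'.toNNReal = r.toNNReal + (r' - r).toNNReal := by
    rw [← Real.toNNReal_add hr (by linarith)]; congr 1; ring
  by_cases hx : x ∈ S
  · simp only [bump, hx, indicator_of_mem, h1]
    set y := r.toNNReal
    set d := (r' - r).toNNReal
    calc 1 + (y + d) ≤ 1 + (y + d) + d * y := le_self_add
      _ = (1 + d) * (1 + y) := by ring
  · simp [bump, hx]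

/-- The `A_p^+` constant of a weight can be raised to any prescribed value by multiplying
the weight by a function bounded above and below. -/
theorem MemApPlus.exists_apPlusConst_mul_eq {p : ℝ} (hp : 1 < p) {W : ℝ → ℝ≥0}
    (hW : MemApPlus p W) {R : ℝ≥0} (hR : 1 ≤ R) {t : ℝ≥0∞} (ht : ApPlusConst p W ≤ t)
    (htR : t ≤ R * ApPlusConst p W) :
    ∃ u : ℝ → ℝ≥0, Measurable u ∧ (∀ x, 1 ≤ u x) ∧ (∀ x, u x ≤ 2 * R) ∧
      ApPlusConst p (fun x => W x * u x) = t := by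
  have hc0 : ApPlusConst p W ≠ 0 := by
    intro h0
    have := hW.one_le_two_rpow_mul hp
    rw [h0] at this
    norm_num at this
  have hct := hW.const_lt_top.ne
  -- A triple reaching half the supremum. The bump lives on the left interval, so the dual factor is
  -- untouched and a bump of height `2R` multiplies this term by `2R`, which makes up for the half.
  obtain ⟨a, b, c, hab, hbc, hlt⟩ : ∃ a b c : ℝ, ∃ (_ : a < b) (_ : b < c),
      ApPlusConst p W / 2 <
      ((∫⁻ x in Ioo a b, (W x : ℝ≥0∞)) / ENNReal.ofReal (c - a)) *
      ((∫⁻ x in Ioo b c, (W x : ℝ≥0∞) ^ (-1 / (p - 1))) / ENNReal.ofReal (c - a)) ^ (p - 1) := by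
    have := ENNReal.half_lt_self hc0 hct
    conv_rhs at this => rw [ApPlusConst]
    simpa only [lt_iSup_iff] using this
  set S := Ioo a b with hS
  set Φ : ℝ → ℝ≥0∞ := fun r => ApPlusConst p (fun x => W x * bump S r x) with hΦ
  have hcmp1 : ∀ r r', 0 ≤ r → r ≤ r' → Φ r' ≤ (1 + (r' - r).toNNReal : ℝ≥0) * Φ r := by
    intro r r' hr hrr
    have := apPlusConst_le_mul hp (W₁ := fun x => W x * bump S r' x)
      (W₂ := fun x => W x * bump S r x) (x := 1 + (r' - r).toNNReal) (y := 1) one_pos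
      (fun z => by
        rw [mul_left_comm]; exact mul_le_mul_right (bump_le_mul S hr hrr z) _)
      (fun z => by rw [one_mul]; exact mul_le_mul_right (bump_mono S hrr z) _)
    simpa using this
  have hcmp2 : ∀ r r', 0 ≤ r → r ≤ r' → Φ r ≤ (1 + (r' - r).toNNReal : ℝ≥0) * Φ r' := by
    intro r r' hr hrr
    have := apPlusConst_le_mul hp (W₂ := fun x => W x * bump S r' x)
      (W₁ := fun x => W x * bump S r x) (y := 1 + (r' - r).toNNReal) (x := 1) (by positivity)
      (fun z => by rw [one_mul]; exact mul_le_mul_right (bump_mono S hrr z) _)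
      (fun z => by
        rw [mul_left_comm]; exact mul_le_mul_right (bump_le_mul S hr hrr z) _)
    simpa using this
  have hΦ0 : Φ 0 = ApPlusConst p W := by simp [hΦ, bump]
  set K : ℝ := 2 * R - 1 with hK
  have hR' : (1 : ℝ) ≤ R := by exact_mod_cast hR
  have hK0 : 0 ≤ K := by linarith
  have hΦfin : ∀ r, 0 ≤ r → Φ r ≠ ∞ := fun r hr => by
    have := hcmp1 0 r le_rfl hr
    rw [hΦ0] at this
    exact (this.trans_lt (ENNReal.mul_lt_top ENNReal.coe_lt_top hW.const_lt_top)).ne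
  set φ : ℝ → ℝ := fun r => (Φ r).toReal with hφ
  have hmul : ∀ r r', 0 ≤ r → r ≤ r' →
      φ r' ≤ (1 + (r' - r)) * φ r ∧ φ r ≤ (1 + (r' - r)) * φ r' := by
    intro r r' hr hrr
    have e : ((1 + (r' - r).toNNReal : ℝ≥0) : ℝ) = 1 + (r' - r) := by
      rw [NNReal.coe_add, NNReal.coe_one, Real.coe_toNNReal _ (by linarith)]
    constructor
    · have := ENNReal.toReal_mono (ENNReal.mul_ne_top ENNReal.coe_ne_top (hΦfin r hr))
        (hcmp1 r r' hr hrr)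
      rwa [ENNReal.toReal_mul, ENNReal.coe_toReal, e] at this
    · have := ENNReal.toReal_mono (ENNReal.mul_ne_top ENNReal.coe_ne_top
        (hΦfin r' (hr.trans hrr))) (hcmp2 r r' hr hrr)
      rwa [ENNReal.toReal_mul, ENNReal.coe_toReal, e] at this
  have hφ0 : ∀ r, 0 ≤ φ r := fun r => ENNReal.toReal_nonneg
  set M := (1 + K) * φ 0 with hM
  have hbd : ∀ r ∈ Icc 0 K, φ r ≤ M := fun r hr => by
    have := (hmul 0 r le_rfl hr.1).1
    simp only [sub_zero] at this
    exact this.trans (mul_le_mul_of_nonneg_right (by linarith [hr.2]) (hφ0 0))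
  -- Weights for `r ≤ r'` are comparable with ratio `1 + (r' - r)`, so the constant is a Lipschitz
  -- function of `r` on `[0, K]`.
  have hcont : ContinuousOn φ (Icc 0 K) := by
    have hlip : ∀ r ∈ Icc 0 K, ∀ r' ∈ Icc 0 K, r ≤ r' → |φ r - φ r'| ≤ M * (r' - r) := by
      intro r hr r' hr' hrr
      obtain ⟨h1, h2⟩ := hmul r r' hr.1 hrr
      have h3 := hbd r hr
      have h4 := hbd r' hr'
      rw [abs_le]
      constructor <;> nlinarith [hφ0 r, hφ0 r']
    refine LipschitzOnWith.continuousOn (K := M.toNNReal) (LipschitzOnWith.of_dist_le_mul ?_)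
    intro r hr r' hr'
    have hM0 : 0 ≤ M := (hφ0 r).trans (hbd r hr)
    rw [Real.coe_toNNReal _ hM0, Real.dist_eq, Real.dist_eq]
    rcases le_total r r' with h | h
    · rw [abs_sub_comm r, abs_of_nonneg (sub_nonneg.2 h)]; exact hlip r hr r' hr' h
    · rw [abs_sub_comm (φ r), abs_of_nonneg (sub_nonneg.2 h)]; exact hlip r' hr' r hr h
  have hΦK : t ≤ Φ K := by
    have hterm : ((∫⁻ x in Ioo a b, ((W x * bump S K x : ℝ≥0) : ℝ≥0∞)) / ENNReal.ofReal (c - a)) *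
      ((∫⁻ x in Ioo b c, ((W x * bump S K x : ℝ≥0) : ℝ≥0∞) ^ (-1 / (p - 1))) /
        ENNReal.ofReal (c - a)) ^ (p - 1) ≤ Φ K :=
      le_iSup_of_le a <| le_iSup_of_le b <| le_iSup_of_le c <| le_iSup_of_le hab <|
        le_iSup_of_le hbc le_rfl
    have hKR : 1 + K.toNNReal = 2 * R := by
      apply NNReal.eq
      push_cast
      rw [Real.coe_toNNReal _ hK0, hK]; ring
    have h1 : ∫⁻ x in Ioo a b, ((W x * bump S K x : ℝ≥0) : ℝ≥0∞) =
        (2 * R) * ∫⁻ x in Ioo a b, (W x : ℝ≥0∞) := by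
      rw [← lintegral_const_mul' _ _ (by finiteness)]
      refine setLIntegral_congr_fun measurableSet_Ioo fun x hx => ?_
      have : bump S K x = 2 * R := by rw [bump, indicator_of_mem hx, hKR]
      simp only [this]
      push_cast; ring
    have h2 : ∫⁻ x in Ioo b c, ((W x * bump S K x : ℝ≥0) : ℝ≥0∞) ^ (-1 / (p - 1)) =
        ∫⁻ x in Ioo b c, (W x : ℝ≥0∞) ^ (-1 / (p - 1)) := by
      refine setLIntegral_congr_fun measurableSet_Ioo fun x hx => ?_
      have : x ∉ S := fun h => (h.2.trans hx.1).false
      simp [bump, this]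
    rw [h1, h2] at hterm
    refine htR.trans (le_trans ?_ hterm)
    calc (R : ℝ≥0∞) * ApPlusConst p W = (2 * R) * (ApPlusConst p W / 2) := by
          rw [ENNReal.div_eq_inv_mul, mul_comm (2 : ℝ≥0∞), mul_assoc, ← mul_assoc (2 : ℝ≥0∞),
            ENNReal.mul_inv_cancel (by simp) (by simp), one_mul]
      _ ≤ _ := mul_le_mul_right hlt.le _
      _ = _ := by simp only [div_eq_mul_inv]; ring
  have htfin : t ≠ ∞ := (htR.trans_lt (ENNReal.mul_lt_top ENNReal.coe_lt_top hW.const_lt_top)).ne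
  obtain ⟨r, hr, hrt⟩ := intermediate_value_Icc hK0 hcont
    (show t.toReal ∈ Icc (φ 0) (φ K) from
      ⟨ENNReal.toReal_mono htfin (hΦ0 ▸ ht), ENNReal.toReal_mono (hΦfin K hK0) hΦK⟩)
  refine ⟨bump S r, measurable_bump measurableSet_Ioo r, one_le_bump S r, fun x => ?_, ?_⟩
  · refine (bump_le S r x).trans ?_
    rw [← NNReal.coe_le_coe]
    push_cast
    rw [Real.coe_toNNReal _ hr.1]
    linarith [hr.2]
  · exact (ENNReal.toReal_eq_toReal_iff' (hΦfin r hr.1) htfin).1 hrt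

/-- Reverse Hölder for the weight and for its dual needs `η` below small multiples of `1/τ` and of
`1/τ^(1/(p-1))`. A multiple of `τ^(-max(1, 1/(p-1)))` achieves both, and this fixes the admissible
size of `s`; `κ` comes from `PerturbationData.apPlusConst_le`. -/
theorem exists_apPlusConst_mul_expWeight_le {p : ℝ} (hp : 1 < p) :
    ∃ ε : ℝ, 0 < ε ∧ ∃ κ : ℝ≥0, 1 ≤ κ ∧ ∀ (W : ℝ → ℝ≥0) (f : ℝ → ℝ) (B s : ℝ), MemApPlus p W →
      LocallyIntegrable f volume → 0 < B → HasMeanOscillationLE f B →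
      |s| * B * (ApPlusConst p W).toReal ^ (max 1 (1 / (p - 1))) ≤ ε →
      MemApPlus p (fun x => W x * expWeight s f x) ∧
        ApPlusConst p (fun x => W x * expWeight s f x) ≤ κ * ApPlusConst p W := by
  have hp1 : 0 < p - 1 := by linarith
  set M := max 1 (1 / (p - 1)) with hM
  have hM1 : 1 ≤ M := le_max_left _ _
  have hM0 : 0 < M := by linarith
  set c : ℝ := min ((1 / 4) ^ (p - 1)) ((1 / 4) ^ (1 / (p - 1))) / 4 with hc
  have hc0 : 0 < c := by positivity
  have hcl : 4 * c ≤ (1 / 4) ^ (p - 1) := by rw [hc]; linarith [min_le_left ((1 / 4 : ℝ) ^ (p - 1)) ((1 / 4) ^ (1 / (p - 1)))]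
  have hcr : 4 * c ≤ (1 / 4) ^ (1 / (p - 1)) := by rw [hc]; linarith [min_le_right ((1 / 4 : ℝ) ^ (p - 1)) ((1 / 4) ^ (1 / (p - 1)))]
  have hc1 : c ≤ 1 := by
    have : (1 / 4 : ℝ) ^ (p - 1) ≤ 1 := Real.rpow_le_one (by norm_num) (by norm_num) hp1.le
    linarith
  have h2p : (0 : ℝ) < 2 ^ p := by positivity
  refine ⟨c / (384 * (2 ^ p) ^ M * M), by positivity,
    ((2 ^ (p - 1) + 2) * 1024 ^ p : ℝ).toNNReal, ?_, ?_⟩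
  · rw [Real.one_le_toNNReal]
    have h1 : (1 : ℝ) ≤ 1024 ^ p := Real.one_le_rpow (by norm_num) (by linarith)
    have h2 : (0 : ℝ) ≤ 2 ^ (p - 1) := by positivity
    nlinarith
  intro W f B s hW hf hB hosc hs
  set τ := (ApPlusConst p W).toReal with hτ
  have hτ1 : 1 ≤ 2 ^ p * τ := hW.one_le_two_rpow_mul hp
  have hτ0 : 0 < τ := by
    by_contra! h
    nlinarith
  have hofτ : ENNReal.ofReal τ = ApPlusConst p W := ENNReal.ofReal_toReal hW.const_lt_top.ne
  have h2p1 : (1 : ℝ) ≤ 2 ^ p := Real.one_le_rpow (by norm_num) (by linarith)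
  -- With the factor `2^p` the base is at least `1`, so the exponents `1` and `1/(p-1)` may both be
  -- raised to `M`.
  set T := (2 ^ p * τ) ^ M with hT
  have hT1 : 1 ≤ T := Real.one_le_rpow hτ1 hM0.le
  have hT0 : 0 < T := by linarith
  have hTτ : τ ≤ T := by
    calc τ ≤ 2 ^ p * τ := by nlinarith
      _ = (2 ^ p * τ) ^ (1 : ℝ) := (Real.rpow_one _).symm
      _ ≤ T := Real.rpow_le_rpow_of_exponent_le hτ1 hM1
  have hTτ' : τ ^ (1 / (p - 1)) ≤ T := by
    calc τ ^ (1 / (p - 1)) ≤ (2 ^ p * τ) ^ (1 / (p - 1)) :=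
          Real.rpow_le_rpow hτ0.le (by nlinarith) (by positivity)
      _ ≤ T := Real.rpow_le_rpow_of_exponent_le hτ1 (le_max_right _ _)
  have hTeq : T = (2 ^ p) ^ M * τ ^ M := Real.mul_rpow h2p.le hτ0.le
  have hsM : M * (|s| * B) ≤ c / T / 384 := by
    have h3 : 0 < τ ^ M := by positivity
    rw [hTeq]
    calc M * (|s| * B) = M * (|s| * B * τ ^ M) / τ ^ M := by field_simp
      _ ≤ M * (c / (384 * (2 ^ p) ^ M * M)) / τ ^ M := by gcongr
      _ = _ := by field_simp
  have hsB : 0 ≤ |s| * B := by positivity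
  let D : PerturbationData p W f s :=
    { τ := τ
      τ' := τ ^ (1 / (p - 1))
      η := c / T
      B := B
      hW := hW
      hτ := hofτ.ge
      hτ0 := hτ0.le
      hτ' := by rw [← hofτ, ENNReal.ofReal_rpow_of_nonneg hτ0.le (by positivity)]
      hη := by positivity
      hη1 := by rw [div_le_one hT0]; linarith
      hητ := by
        have : τ * (c / T) ≤ c := by
          rw [mul_div_assoc', div_le_iff₀ hT0]; nlinarith
        nlinarith
      hητ' := by
        have : τ ^ (1 / (p - 1)) * (c / T) ≤ c := by
          rw [mul_div_assoc', div_le_iff₀ hT0]; nlinarith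
        nlinarith
      hf := hf
      hB := hB
      hosc := hosc
      hs := by nlinarith
      hs' := by
        have h4 : 1 / (p - 1) ≤ M := le_max_right _ _
        rw [abs_div, abs_of_pos hp1]
        calc |s| / (p - 1) * B = 1 / (p - 1) * (|s| * B) := by ring
          _ ≤ M * (|s| * B) := by gcongr
          _ ≤ _ := hsM }
  refine ⟨D.memApPlus hp, (D.apPlusConst_le hp).trans (le_of_eq ?_)⟩
  rw [← hofτ, ENNReal.ofReal_mul (by positivity)]
  rfl

/-- The perturbed weight can be modified by a bounded factor so that its `A_p^+` constant is an
exact multiple of the original one. -/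
theorem exists_apPlusConst_mul_expWeight_mul_eq {p : ℝ} (hp : 1 < p) :
    ∃ ε : ℝ, 0 < ε ∧ ∃ κ R : ℝ≥0, 0 < κ ∧ ∀ (W : ℝ → ℝ≥0) (f : ℝ → ℝ) (B s : ℝ), MemApPlus p W →
      LocallyIntegrable f volume → 0 < B → HasMeanOscillationLE f B →
      |s| * B * (ApPlusConst p W).toReal ^ (max 1 (1 / (p - 1))) ≤ ε →
      MemApPlus p (fun x => W x * expWeight s f x) ∧
      ∃ u : ℝ → ℝ≥0, (∀ x, 1 ≤ u x) ∧ (∀ x, u x ≤ R) ∧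
        MemApPlus p (fun x => W x * expWeight s f x * u x) ∧
        ApPlusConst p (fun x => W x * expWeight s f x * u x) = κ * ApPlusConst p W := by
  have hp1 : 0 < p - 1 := by linarith
  obtain ⟨ε, hε, κ, hκ, h⟩ := exists_apPlusConst_mul_expWeight_le hp
  set M := max 1 (1 / (p - 1)) with hM
  have hM0 : 0 < M := lt_of_lt_of_le one_pos (le_max_left _ _)
  have hκ' : (1 : ℝ) ≤ κ := by exact_mod_cast hκ
  have hκM : (1 : ℝ) ≤ (κ : ℝ) ^ M := Real.one_le_rpow hκ' hM0.le
  refine ⟨ε / (κ : ℝ) ^ M, by positivity, κ, 2 * (κ * κ), by positivity, ?_⟩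
  intro W f B s hW hf hB hosc hs
  have hsB : 0 ≤ |s| * B := by positivity
  have hs1 : |s| * B * (ApPlusConst p W).toReal ^ M ≤ ε :=
    hs.trans (div_le_self hε.le hκM)
  obtain ⟨h1, h2⟩ := h W f B s hW hf hB hosc hs1
  have hfin : (κ : ℝ≥0∞) * ApPlusConst p W ≠ ∞ :=
    ENNReal.mul_ne_top ENNReal.coe_ne_top hW.const_lt_top.ne
  -- The perturbation is undone with `-s`, which yields the reverse comparison of constants. The
  -- weight perturbed first has a constant up to `κ` times larger, whence `ε / κ^M`.
  have hs2 : |-s| * B * (ApPlusConst p (fun x => W x * expWeight s f x)).toReal ^ M ≤ ε := by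
    rw [abs_neg]
    have h3 := ENNReal.toReal_mono hfin h2
    rw [ENNReal.toReal_mul, ENNReal.coe_toReal] at h3
    calc |s| * B * (ApPlusConst p (fun x => W x * expWeight s f x)).toReal ^ M
        ≤ |s| * B * (κ * (ApPlusConst p W).toReal) ^ M := by gcongr
      _ = (κ : ℝ) ^ M * (|s| * B * (ApPlusConst p W).toReal ^ M) := by
          rw [Real.mul_rpow (by positivity) ENNReal.toReal_nonneg]; ring
      _ ≤ (κ : ℝ) ^ M * (ε / (κ : ℝ) ^ M) := by gcongr
      _ = ε := by field_simp
  obtain ⟨-, h4⟩ := h _ f B (-s) h1 hf hB hosc hs2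
  have hback : (fun x => W x * expWeight s f x * expWeight (-s) f x) = W := by
    funext x
    have : expWeight s f x * expWeight (-s) f x = 1 := by
      rw [expWeight, expWeight, ← Real.toNNReal_mul (Real.exp_pos _).le, ← Real.exp_add]
      simp
    rw [mul_assoc, this, mul_one]
  rw [hback] at h4
  -- The target `κ [W]` lies between the perturbed constant and `κ²` times it.
  obtain ⟨u, hum, hu1, hu2, hueq⟩ := h1.exists_apPlusConst_mul_eq hp (R := κ * κ)
    (one_le_mul hκ hκ) h2 (by
      rw [ENNReal.coe_mul, mul_assoc]; exact mul_le_mul_right h4 _)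
  refine ⟨h1, u, hu1, hu2, ?_, hueq⟩
  refine memApPlus_of_const_lt_top hp ?_ ?_ (hueq ▸ hfin.lt_top)
  · simp only [ENNReal.coe_mul _ (u _)]
    exact h1.aemeasurable.mul hum.coe_nnreal_ennreal.aemeasurable
  · filter_upwards [h1.pos] with x hx
    exact mul_pos hx (lt_of_lt_of_le one_pos (hu1 x))

/-- The minimum of two `A_p^+` weights is an `A_p^+` weight. -/
theorem MemApPlus.min {p : ℝ} (hp : 1 < p) {W₁ W₂ : ℝ → ℝ≥0} (h₁ : MemApPlus p W₁)
    (h₂ : MemApPlus p W₂) : MemApPlus p (fun x => min (W₁ x) (W₂ x)) := by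
  have hp1 : 0 < p - 1 := by linarith
  have hle : ApPlusConst p (fun x => Min.min (W₁ x) (W₂ x)) ≤
      2 ^ (p - 1) * (ApPlusConst p W₁ + ApPlusConst p W₂) := by
    refine (apPlusConst_le_iff hp).2 fun a b c hab hbc => ?_
    have e₁ := (apPlusConst_le_iff hp).1 (le_refl (ApPlusConst p W₁)) a b c hab hbc
    have e₂ := (apPlusConst_le_iff hp).1 (le_refl (ApPlusConst p W₂)) a b c hab hbc
    set X := ∫⁻ x in Ioo a b, ((Min.min (W₁ x) (W₂ x) : ℝ≥0) : ℝ≥0∞)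
    set Y₁ := ∫⁻ x in Ioo b c, (W₁ x : ℝ≥0∞) ^ (-1 / (p - 1))
    set Y₂ := ∫⁻ x in Ioo b c, (W₂ x : ℝ≥0∞) ^ (-1 / (p - 1))
    have hX₁ : X ≤ ∫⁻ x in Ioo a b, (W₁ x : ℝ≥0∞) :=
      lintegral_mono fun x => ENNReal.coe_le_coe.2 (min_le_left _ _)
    have hX₂ : X ≤ ∫⁻ x in Ioo a b, (W₂ x : ℝ≥0∞) :=
      lintegral_mono fun x => ENNReal.coe_le_coe.2 (min_le_right _ _)
    have hY : ∫⁻ x in Ioo b c, ((Min.min (W₁ x) (W₂ x) : ℝ≥0) : ℝ≥0∞) ^ (-1 / (p - 1)) ≤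
        Y₁ + Y₂ := by
      rw [← lintegral_add_left' (h₁.aemeasurable.restrict.pow_const _)]
      refine lintegral_mono fun x => ?_
      rcases min_choice (W₁ x) (W₂ x) with h | h <;> simp only [h]
      · exact le_self_add
      · exact le_add_self
    have hpow : (Y₁ + Y₂) ^ (p - 1) ≤ 2 ^ (p - 1) * (Y₁ ^ (p - 1) + Y₂ ^ (p - 1)) := by
      calc (Y₁ + Y₂) ^ (p - 1) ≤ (2 * max Y₁ Y₂) ^ (p - 1) := by
            refine ENNReal.rpow_le_rpow ?_ hp1.le
            rw [two_mul]
            exact add_le_add (le_max_left _ _) (le_max_right _ _)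
        _ = 2 ^ (p - 1) * max Y₁ Y₂ ^ (p - 1) := ENNReal.mul_rpow_of_nonneg _ _ hp1.le
        _ ≤ _ := by
            refine mul_le_mul_right ?_ _
            rcases max_choice Y₁ Y₂ with h | h <;> rw [h]
            · exact le_self_add
            · exact le_add_self
    calc _ ≤ X * (2 ^ (p - 1) * (Y₁ ^ (p - 1) + Y₂ ^ (p - 1))) :=
          mul_le_mul_right ((ENNReal.rpow_le_rpow hY hp1.le).trans hpow) _
      _ = 2 ^ (p - 1) * (X * Y₁ ^ (p - 1) + X * Y₂ ^ (p - 1)) := by ring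
      _ ≤ 2 ^ (p - 1) * (ApPlusConst p W₁ * ENNReal.ofReal (c - a) ^ p +
          ApPlusConst p W₂ * ENNReal.ofReal (c - a) ^ p) := by
          refine mul_le_mul_right (add_le_add ?_ ?_) _
          · exact (mul_le_mul_left hX₁ _).trans e₁
          · exact (mul_le_mul_left hX₂ _).trans e₂
      _ = _ := by ring
  refine memApPlus_of_const_lt_top hp ?_ ?_ (hle.trans_lt ?_)
  · simp only [ENNReal.coe_min]
    exact h₁.aemeasurable.min h₂.aemeasurable
  · filter_upwards [h₁.pos, h₂.pos] with x hx hy using lt_min hx hy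
  · exact ENNReal.mul_lt_top (ENNReal.rpow_lt_top_of_nonneg hp1.le (by simp))
      (ENNReal.add_lt_top.2 ⟨h₁.const_lt_top, h₂.const_lt_top⟩)

/-! ### The discrete Cauchy formula -/

/-- Replacing `‖x‖` by `2‖x‖` multiplies the term of index `m ≥ n` by `2^m ≥ 2^n`. The doubled
exponent is what the damping `exp (-2r|b|)` later absorbs. -/
theorem norm_exp_sub_sum_le_two_inv_pow_mul (x : ℂ) (n : ℕ) :
    ‖Complex.exp x - ∑ m ∈ Finset.range n, x ^ m / m.factorial‖ ≤
      (1 / 2) ^ n * Real.exp (2 * ‖x‖) := by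
  refine (Complex.norm_exp_sub_sum_le_exp_norm_sub_sum x n).trans ?_
  set y := ‖x‖
  have hy : 0 ≤ y := norm_nonneg x
  have hA : ∀ y : ℝ, HasSum (fun m : ℕ => y ^ m / m.factorial) (Real.exp y) := fun y => by
    rw [Real.exp_eq_exp_ℝ]; exact NormedSpace.expSeries_div_hasSum_exp y
  have hB : HasSum (fun m : ℕ => if m ∈ Finset.range n then y ^ m / (m.factorial : ℝ) else 0)
      (∑ m ∈ Finset.range n, y ^ m / m.factorial) := by
    have h := hasSum_sum_of_ne_finset_zero (L := SummationFilter.unconditional ℕ)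
      (f := fun m : ℕ => if m ∈ Finset.range n then y ^ m / (m.factorial : ℝ) else 0)
      (s := Finset.range n) fun m hm => by simp only [hm, if_false]
    rwa [Finset.sum_congr rfl fun m hm => if_pos hm] at h
  refine hasSum_le (fun m => ?_) ((hA y).sub hB) ((hA (2 * y)).mul_left _)
  by_cases hm : m ∈ Finset.range n
  · simp only [hm, if_true, sub_self]; positivity
  · simp only [hm, if_false, sub_zero]
    rw [Finset.mem_range, not_lt] at hm
    have h1 : (1 : ℝ) ≤ (1 / 2) ^ n * 2 ^ m := by
      calc (1 : ℝ) = (1 / 2) ^ n * 2 ^ n := by rw [← mul_pow]; norm_num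
        _ ≤ (1 / 2) ^ n * 2 ^ m := by gcongr; norm_num
    calc y ^ m / m.factorial ≤ ((1 / 2) ^ n * 2 ^ m) * (y ^ m / m.factorial) :=
          le_mul_of_one_le_left (by positivity) h1
      _ = _ := by rw [mul_pow]; ring

/-- The standard primitive `n`-th root of unity. -/
noncomputable def unityRoot (n : ℕ) : ℂ := Complex.exp (2 * Real.pi * Complex.I / n)

theorem norm_unityRoot (n : ℕ) : ‖unityRoot n‖ = 1 := by
  rw [unityRoot, show (2 * Real.pi * Complex.I / n : ℂ) = ((2 * Real.pi / n : ℝ) : ℂ) * Complex.I by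
    push_cast; ring, Complex.norm_exp_ofReal_mul_I]

/-- Orthogonality of the powers of a primitive root, exact as soon as `N` exceeds both `m` and `k`;
smaller `N` may identify distinct exponents. -/
theorem tendsto_average_unityRoot (m k : ℕ) :
    Filter.Tendsto (fun N : ℕ => (N : ℂ)⁻¹ * ∑ l ∈ Finset.range N,
      ((unityRoot N ^ l) ^ k)⁻¹ * (unityRoot N ^ l) ^ m) Filter.atTop
      (nhds (if m = k then 1 else 0)) := by
  refine tendsto_const_nhds.congr' ?_
  filter_upwards [Filter.eventually_gt_atTop (max m k)] with N hN
  have hmN : m < N := (le_max_left _ _).trans_lt hN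
  have hkN : k < N := (le_max_right _ _).trans_lt hN
  have hN0 : N ≠ 0 := by omega
  have hprim : IsPrimitiveRoot (unityRoot N) N := Complex.isPrimitiveRoot_exp N hN0
  set ω := unityRoot N
  have hω0 : ω ≠ 0 := hprim.ne_zero hN0
  set ζ := (ω ^ k)⁻¹ * ω ^ m with hζ
  have hsum : ∑ l ∈ Finset.range N, ((ω ^ l) ^ k)⁻¹ * (ω ^ l) ^ m =
      ∑ l ∈ Finset.range N, ζ ^ l := by
    refine Finset.sum_congr rfl fun l _ => ?_
    rw [hζ, mul_pow, inv_pow, ← pow_mul, ← pow_mul, ← pow_mul, ← pow_mul, mul_comm l k,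
      mul_comm l m]
  rw [hsum]
  by_cases hmk : m = k
  · have : ζ = 1 := by rw [hζ, hmk, inv_mul_cancel₀ (pow_ne_zero _ hω0)]
    have hN' : (N : ℂ) ≠ 0 := by exact_mod_cast hN0
    simp [this, hmk, hN']
  · have hζ1 : ζ ≠ 1 := by
      intro h
      rw [hζ, inv_mul_eq_one₀ (pow_ne_zero _ hω0)] at h
      exact hmk (hprim.pow_inj hkN hmN h).symm
    have hζN : ζ ^ N = 1 := by
      rw [hζ, mul_pow, inv_pow, ← pow_mul, ← pow_mul, mul_comm k, mul_comm m, pow_mul, pow_mul,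
        hprim.pow_eq_one]
      simp
    rw [geom_sum_eq hζ1, hζN]
    simp [hmk]

/-- A discrete Cauchy formula: the coefficients of a power series are limits of averages of its
values over roots of unity. -/
theorem tendsto_average_tsum {c : ℕ → ℂ} {r : ℝ} (hr : 0 < r)
    (hc : Summable fun m => ‖c m‖ * r ^ m) (k : ℕ) :
    Filter.Tendsto (fun N : ℕ => (N : ℂ)⁻¹ * ∑ l ∈ Finset.range N,
      ((r * unityRoot N ^ l) ^ k)⁻¹ * ∑' m, c m * (r * unityRoot N ^ l) ^ m) Filter.atTop
      (nhds (c k)) := by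
  have hr' : (r : ℂ) ≠ 0 := by exact_mod_cast hr.ne'
  have hnorm : ∀ N l, ‖unityRoot N ^ l‖ = 1 := fun N l => by rw [norm_pow, norm_unityRoot, one_pow]
  have hsm : ∀ N l, Summable fun m => c m * (r * unityRoot N ^ l) ^ m := fun N l => by
    refine Summable.of_norm (hc.congr fun m => ?_)
    rw [norm_mul, norm_pow, norm_mul, hnorm, mul_one, Complex.norm_real, Real.norm_of_nonneg hr.le]
  set F : ℕ → ℕ → ℂ := fun N m => c m * (r : ℂ) ^ m * ((r : ℂ) ^ k)⁻¹ *
    ((N : ℂ)⁻¹ * ∑ l ∈ Finset.range N, ((unityRoot N ^ l) ^ k)⁻¹ * (unityRoot N ^ l) ^ m) with hF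
  have heq : ∀ N : ℕ, (N : ℂ)⁻¹ * ∑ l ∈ Finset.range N,
      ((r * unityRoot N ^ l) ^ k)⁻¹ * ∑' m, c m * (r * unityRoot N ^ l) ^ m = ∑' m, F N m := by
    intro N
    simp_rw [← tsum_mul_left]
    rw [← Summable.tsum_finsetSum fun l _ => (hsm N l).mul_left _, ← tsum_mul_left]
    refine tsum_congr fun m => ?_
    simp only [hF, Finset.mul_sum]
    refine Finset.sum_congr rfl fun l _ => ?_
    rw [mul_pow, mul_pow, mul_inv]
    ring
  simp_rw [heq]
  -- The averages of unimodular numbers have modulus at most one, so the series itself dominates.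
  have hlim := tendsto_tsum_of_dominated_convergence (𝓕 := Filter.atTop) (f := F)
    (g := fun m => c m * (r : ℂ) ^ m * ((r : ℂ) ^ k)⁻¹ * (if m = k then 1 else 0))
    (bound := fun m => ‖c m‖ * r ^ m * (r ^ k)⁻¹) (hc.mul_right _)
    (fun m => (tendsto_average_unityRoot m k).const_mul _) ?_
  · have hval : ∑' m, c m * (r : ℂ) ^ m * ((r : ℂ) ^ k)⁻¹ * (if m = k then 1 else 0) = c k := by
      rw [tsum_eq_single k fun m hm => by simp [hm]]
      simp [mul_assoc, mul_inv_cancel₀ (pow_ne_zero k hr')]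
    rwa [hval] at hlim
  · refine Filter.Eventually.of_forall fun N m => ?_
    have h1 : ‖(N : ℂ)⁻¹ * ∑ l ∈ Finset.range N,
        ((unityRoot N ^ l) ^ k)⁻¹ * (unityRoot N ^ l) ^ m‖ ≤ 1 := by
      rw [norm_mul, norm_inv, Complex.norm_natCast]
      have h2 : ‖∑ l ∈ Finset.range N, ((unityRoot N ^ l) ^ k)⁻¹ * (unityRoot N ^ l) ^ m‖ ≤ N := by
        refine (norm_sum_le _ _).trans ?_
        simp [norm_unityRoot]
      rcases N.eq_zero_or_pos with rfl | hN
      · simp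
      · rw [inv_mul_le_iff₀ (by exact_mod_cast hN), mul_one]; exact h2
    simp only [hF]
    rw [norm_mul, norm_mul, norm_mul, norm_inv, norm_pow, norm_pow, Complex.norm_real,
      Real.norm_of_nonneg hr.le]
    exact mul_le_of_le_one_right (by positivity) h1

/-- The Cauchy formula for the product of the series of `exp (z t)` with a second series; used with
`t = b x`, pointwise in `x`. -/
theorem tendsto_average_exp_mul_tsum {β : ℕ → ℂ} {r : ℝ} (hr : 0 < r)
    (hβ : Summable fun j => ‖β j‖ * r ^ j) (t : ℝ) (k : ℕ) :
    Filter.Tendsto (fun N : ℕ => (N : ℂ)⁻¹ * ∑ l ∈ Finset.range N,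
      ((r * unityRoot N ^ l) ^ k)⁻¹ * (Complex.exp (r * unityRoot N ^ l * t) *
        ∑' j, β j * (r * unityRoot N ^ l) ^ j)) Filter.atTop
      (nhds (∑ ij ∈ Finset.HasAntidiagonal.antidiagonal k, (t : ℂ) ^ ij.1 / ij.1.factorial * β ij.2)) := by
  set c : ℕ → ℂ := fun n => ∑ ij ∈ Finset.HasAntidiagonal.antidiagonal n,
    (t : ℂ) ^ ij.1 / ij.1.factorial * β ij.2 with hc
  have hterm : ∀ (z : ℂ) (n : ℕ), c n * z ^ n = ∑ ij ∈ Finset.HasAntidiagonal.antidiagonal n,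
      ((z * t) ^ ij.1 / ij.1.factorial) * (β ij.2 * z ^ ij.2) := fun z n => by
    rw [hc, Finset.sum_mul]
    refine Finset.sum_congr rfl fun ij hij => ?_
    rw [← Finset.HasAntidiagonal.mem_antidiagonal.1 hij, pow_add, mul_pow]; ring
  have hE : ∀ x : ℂ, Summable fun n : ℕ => ‖x ^ n / n.factorial‖ := fun x =>
    NormedSpace.norm_expSeries_div_summable x
  have hB : ∀ z : ℂ, ‖z‖ = r → Summable fun j => ‖β j * z ^ j‖ := fun z hz => by
    refine hβ.congr fun j => ?_
    rw [norm_mul, norm_pow, hz]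
  have hmul : ∀ z : ℂ, ‖z‖ = r →
      Complex.exp (z * t) * ∑' j, β j * z ^ j = ∑' n, c n * z ^ n := fun z hz => by
    rw [show Complex.exp (z * t) = ∑' n : ℕ, (z * t) ^ n / n.factorial by
      rw [Complex.exp_eq_exp_ℂ]; exact (NormedSpace.expSeries_div_hasSum_exp _).tsum_eq.symm,
      tsum_mul_tsum_eq_tsum_sum_antidiagonal_of_summable_norm (hE _) (hB z hz)]
    exact tsum_congr fun n => (hterm z n).symm
  have hcs : Summable fun m => ‖c m‖ * r ^ m := by
    have h1 := summable_norm_sum_mul_antidiagonal_of_summable_norm (hE ((r : ℂ) * t))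
      (hB r (by rw [Complex.norm_real, Real.norm_of_nonneg hr.le]))
    refine h1.congr fun m => ?_
    rw [← hterm, norm_mul, norm_pow, Complex.norm_real, Real.norm_of_nonneg hr.le]
  refine (tendsto_average_tsum hr hcs k).congr fun N => ?_
  congr 1
  refine Finset.sum_congr rfl fun l _ => ?_
  rw [hmul]
  rw [norm_mul, norm_pow, norm_unityRoot, Complex.norm_real, Real.norm_of_nonneg hr.le, one_pow,
    mul_one]

/-- The `q`-th powers have integrals of order `2^(-n)`, so they remain summable after multiplication
by `(3/2)^n`. Where that sum is finite, `‖u n x‖` is of order `(2/3)^(n/q)`. -/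
theorem ae_summable_norm_of_eLpNorm_le {u : ℕ → ℝ → ℂ} {q : ℝ} (hq : 1 ≤ q) {A : ℝ≥0∞}
    (hA : A ≠ ∞) (hu : ∀ n, AEStronglyMeasurable (u n) volume)
    (hle : ∀ n, eLpNorm (u n) (ENNReal.ofReal q) volume ≤ A * 2⁻¹ ^ n) :
    ∀ᵐ x, Summable fun n => ‖u n x‖ := by
  have hq0 : 0 < q := by linarith
  have hint : ∀ n, ∫⁻ x, ‖u n x‖ₑ ^ q ≤ A ^ q * 2⁻¹ ^ n := by
    intro n
    have h1 := ENNReal.rpow_le_rpow (hle n) hq0.le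
    rw [eLpNorm_eq_lintegral_rpow_enorm_toReal (by simpa using hq0) ENNReal.ofReal_ne_top,
      ENNReal.toReal_ofReal hq0.le, ← ENNReal.rpow_mul, one_div_mul_cancel hq0.ne',
      ENNReal.rpow_one, ENNReal.mul_rpow_of_nonneg _ _ hq0.le] at h1
    refine h1.trans (mul_le_mul_right ?_ _)
    calc ((2⁻¹ : ℝ≥0∞) ^ n) ^ q ≤ ((2⁻¹ : ℝ≥0∞) ^ n) ^ (1 : ℝ) :=
          ENNReal.rpow_le_rpow_of_exponent_ge (pow_le_one₀ zero_le (by simp)) hq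
      _ = _ := ENNReal.rpow_one _
  have hsum : ∫⁻ x, ∑' n : ℕ, (ENNReal.ofReal (3 / 2)) ^ n * ‖u n x‖ₑ ^ q ≠ ∞ := by
    rw [lintegral_tsum fun n => ((hu n).enorm.pow_const q).const_mul _]
    have h1 : ∀ n : ℕ, ∫⁻ x, (ENNReal.ofReal (3 / 2)) ^ n * ‖u n x‖ₑ ^ q ≤
        A ^ q * ENNReal.ofReal (3 / 4) ^ n := fun n => by
      rw [lintegral_const_mul' _ _ (by finiteness)]
      refine (mul_le_mul_right (hint n) _).trans (le_of_eq ?_)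
      have : ENNReal.ofReal (3 / 4) = ENNReal.ofReal (3 / 2) * 2⁻¹ := by
        rw [show (2⁻¹ : ℝ≥0∞) = ENNReal.ofReal 2⁻¹ by
          rw [ENNReal.ofReal_inv_of_pos two_pos]; simp, ← ENNReal.ofReal_mul (by norm_num)]
        norm_num
      rw [this, mul_pow]; ring
    refine ((ENNReal.tsum_le_tsum h1).trans_lt ?_).ne
    rw [ENNReal.tsum_mul_left, ENNReal.tsum_geometric]
    refine ENNReal.mul_lt_top (ENNReal.rpow_lt_top_of_nonneg hq0.le hA) ?_
    rw [ENNReal.inv_lt_top, tsub_pos_iff_lt, ENNReal.ofReal_lt_one]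
    norm_num
  have hae := ae_lt_top' (AEMeasurable.tsum fun n =>
    ((hu n).enorm.pow_const q).const_mul _) hsum
  filter_upwards [hae] with x hx
  set S := ∑' n : ℕ, (ENNReal.ofReal (3 / 2)) ^ n * ‖u n x‖ₑ ^ q with hS
  have hbd : ∀ n : ℕ, ‖u n x‖ ≤ (S.toReal ^ (1 / q)) * (((2 / 3 : ℝ) ^ (1 / q)) ^ n) := by
    intro n
    have h1 : (ENNReal.ofReal (3 / 2)) ^ n * ‖u n x‖ₑ ^ q ≤ S := ENNReal.le_tsum n
    have h2 := ENNReal.toReal_mono hx.ne h1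
    rw [ENNReal.toReal_mul, ENNReal.toReal_pow, ENNReal.toReal_ofReal (by norm_num),
      ← ENNReal.toReal_rpow, toReal_enorm] at h2
    have h3 : ‖u n x‖ ^ q ≤ S.toReal * (2 / 3) ^ n := by
      have : ((3 / 2 : ℝ) ^ n) * ((2 / 3) ^ n) = 1 := by rw [← mul_pow]; norm_num
      calc ‖u n x‖ ^ q = ((3 / 2 : ℝ) ^ n * ((2 / 3) ^ n)) * ‖u n x‖ ^ q := by rw [this, one_mul]
        _ = ((3 / 2 : ℝ) ^ n * ‖u n x‖ ^ q) * (2 / 3) ^ n := by ring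
        _ ≤ _ := by gcongr
    calc ‖u n x‖ = (‖u n x‖ ^ q) ^ (1 / q) := by
          rw [← Real.rpow_mul (norm_nonneg _), mul_one_div_cancel hq0.ne', Real.rpow_one]
      _ ≤ (S.toReal * (2 / 3) ^ n) ^ (1 / q) :=
          Real.rpow_le_rpow (by positivity) h3 (by positivity)
      _ = _ := by
          rw [Real.mul_rpow ENNReal.toReal_nonneg (by positivity), ← Real.rpow_natCast,
            ← Real.rpow_natCast, ← Real.rpow_mul (by norm_num), ← Real.rpow_mul (by norm_num),
            mul_comm (n : ℝ)]
  refine Summable.of_nonneg_of_le (fun n => norm_nonneg _) hbd (Summable.mul_left _ ?_)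
  exact summable_geometric_of_lt_one (by positivity)
    (Real.rpow_lt_one (by norm_num) (by norm_num) (by positivity))

/-! ### Algebraic expansion of iterated commutators -/

theorem coeFn_mulBy (b : ℝ →ₘ[volume] ℝ) (f : ℝ →ₘ[volume] ℂ) :
    mulBy b f =ᵐ[volume] fun x => (b x : ℂ) * f x := by
  have h1 := AEEqFun.coeFn_mul (AEEqFun.comp ((↑) : ℝ → ℂ) Complex.continuous_ofReal b) f
  have h2 := AEEqFun.coeFn_comp ((↑) : ℝ → ℂ) Complex.continuous_ofReal b
  filter_upwards [h1, h2] with x hx1 hx2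
  rw [show mulBy b f = AEEqFun.comp ((↑) : ℝ → ℂ) Complex.continuous_ofReal b * f from rfl, hx1,
    Pi.mul_apply, hx2, Function.comp_apply]

theorem coeFn_mulBy_pow (b : ℝ →ₘ[volume] ℝ) (f : ℝ →ₘ[volume] ℂ) (j : ℕ) :
    (mulBy b ^ j) f =ᵐ[volume] fun x => (b x : ℂ) ^ j * f x := by
  induction j with
  | zero => simp
  | succ j ih =>
    have h := coeFn_mulBy b ((mulBy b ^ j) f)
    filter_upwards [h, ih] with x hx1 hx2
    rw [pow_succ', Module.End.mul_apply, hx1, hx2]; ring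

open Classical in
/-- The extension of a partially defined operator by zero. -/
noncomputable def LinearPMap.extendByZero (T : LineOperator) (g : ℝ →ₘ[volume] ℂ) :
    ℝ →ₘ[volume] ℂ := if h : g ∈ T.domain then T ⟨g, h⟩ else 0

theorem LinearPMap.extendByZero_apply (T : LineOperator) {g : ℝ →ₘ[volume] ℂ} (h : g ∈ T.domain) :
    LinearPMap.extendByZero T g = T ⟨g, h⟩ := dif_pos h

theorem LinearPMap.extendByZero_sub_sum (T : LineOperator) {g : ℝ →ₘ[volume] ℂ}
    (hg : g ∈ T.domain) {F : ℕ → ℝ →ₘ[volume] ℂ} (hF : ∀ j, F j ∈ T.domain) (c : ℕ → ℂ) (n : ℕ) :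
    LinearPMap.extendByZero T (g - ∑ j ∈ Finset.range n, c j • F j) =
      LinearPMap.extendByZero T g -
        ∑ j ∈ Finset.range n, c j • LinearPMap.extendByZero T (F j) := by
  have hmem : g - ∑ j ∈ Finset.range n, c j • F j ∈ T.domain :=
    T.domain.sub_mem hg (T.domain.sum_mem fun j _ => T.domain.smul_mem _ (hF j))
  rw [LinearPMap.extendByZero_apply T hmem, LinearPMap.extendByZero_apply T hg]
  simp only [LinearPMap.extendByZero_apply T (hF _)]
  have h1 : (⟨_, hmem⟩ : T.domain) = ⟨g, hg⟩ - ∑ j ∈ Finset.range n, c j • ⟨F j, hF j⟩ := by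
    apply Subtype.ext
    simp
  have h2 : T (∑ j ∈ Finset.range n, c j • ⟨F j, hF j⟩) =
      ∑ j ∈ Finset.range n, c j • T ⟨F j, hF j⟩ :=
    (map_sum T.toFun _ _).trans (Finset.sum_congr rfl fun j _ => T.toFun.map_smul _ _)
  rw [h1, T.map_sub, h2]

/-- Expansion of iterated commutators. -/
theorem iterCommutator_eq_sum (b : ℝ →ₘ[volume] ℝ) (T : LineOperator) (n : ℕ) :
    ∀ g : ℝ →ₘ[volume] ℂ, (∀ j, (mulBy b ^ j) g ∈ T.domain) →
    ∃ h : g ∈ (iterCommutator b T n).domain, iterCommutator b T n ⟨g, h⟩ =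
      ∑ ij ∈ Finset.HasAntidiagonal.antidiagonal n, n.choose ij.1 •
        ((-1 : ℂ) ^ ij.2 • (mulBy b ^ ij.1) (LinearPMap.extendByZero T ((mulBy b ^ ij.2) g))) := by
  induction n with
  | zero =>
    intro g hg
    have h0 : g ∈ T.domain := hg 0
    refine ⟨h0, ?_⟩
    change T ⟨g, h0⟩ = _
    rw [← LinearPMap.extendByZero_apply T h0]
    simp
  | succ n ih =>
    intro g hg
    have hshift : ∀ j, (mulBy b ^ j) (mulBy b g) = (mulBy b ^ (j + 1)) g := fun j => by
      rw [pow_succ, Module.End.mul_apply]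
    obtain ⟨h1, e1⟩ := ih g hg
    obtain ⟨h2, e2⟩ := ih (mulBy b g) fun j => by rw [hshift]; exact hg (j + 1)
    refine ⟨⟨h1, h2⟩, ?_⟩
    change mulBy b (iterCommutator b T n ⟨g, h1⟩) - iterCommutator b T n ⟨mulBy b g, h2⟩ = _
    rw [e1, e2, Finset.sum_antidiagonal_choose_succ_nsmul (fun i j => (-1 : ℂ) ^ j •
      (mulBy b ^ i) (LinearPMap.extendByZero T ((mulBy b ^ j) g))) n, map_sum, add_comm,
      sub_eq_add_neg, ← Finset.sum_neg_distrib]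
    congr 1
    · refine Finset.sum_congr rfl fun ij hij => ?_
      rw [map_nsmul, map_smul, n.choose_symm_of_eq_add
        (Finset.HasAntidiagonal.mem_antidiagonal.1 hij).symm, pow_succ', Module.End.mul_apply]
    · refine Finset.sum_congr rfl fun ij _ => ?_
      rw [hshift, pow_succ (-1 : ℂ), mul_neg_one]
      module

theorem coeFn_finset_sum {ι : Type*} (s : Finset ι) (F : ι → ℝ →ₘ[volume] ℂ) :
    (∑ i ∈ s, F i : ℝ →ₘ[volume] ℂ) =ᵐ[volume] fun x => ∑ i ∈ s, F i x := by
  classical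
  induction s using Finset.induction_on with
  | empty =>
    simp only [Finset.sum_empty]
    exact AEEqFun.coeFn_zero
  | insert i s hi ih =>
    rw [Finset.sum_insert hi]
    filter_upwards [AEEqFun.coeFn_add (F i) (∑ i ∈ s, F i), ih] with x h1 h2
    rw [h1, Pi.add_apply, h2, Finset.sum_insert hi]

/-- With binomial coefficients written as factorials, the commutator is `n!` times the coefficient
of `z^n` in the product of `exp (z b)` and the series with coefficients `(-1)^j / j! T (b^j g)`: the
quantity that the discrete Cauchy formula recovers. -/
theorem ae_iterCommutator_eq (b : ℝ →ₘ[volume] ℝ) (T : LineOperator) (n : ℕ)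
    {g : ℝ →ₘ[volume] ℂ} (hg : ∀ j, (mulBy b ^ j) g ∈ T.domain) :
    ∃ h : g ∈ (iterCommutator b T n).domain, ∀ᵐ x, iterCommutator b T n ⟨g, h⟩ x =
      n.factorial * ∑ ij ∈ Finset.HasAntidiagonal.antidiagonal n,
        (b x : ℂ) ^ ij.1 / ij.1.factorial * ((-1) ^ ij.2 / ij.2.factorial *
          LinearPMap.extendByZero T ((mulBy b ^ ij.2) g) x) := by
  obtain ⟨h, e⟩ := iterCommutator_eq_sum b T n g hg
  refine ⟨h, ?_⟩
  rw [e]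
  have h1 := coeFn_finset_sum (Finset.HasAntidiagonal.antidiagonal n) fun ij => n.choose ij.1 •
        ((-1 : ℂ) ^ ij.2 • (mulBy b ^ ij.1) (LinearPMap.extendByZero T ((mulBy b ^ ij.2) g)))
  have h2 : ∀ᵐ x, ∀ ij : ℕ × ℕ, (n.choose ij.1 •
        ((-1 : ℂ) ^ ij.2 • (mulBy b ^ ij.1)
          (LinearPMap.extendByZero T ((mulBy b ^ ij.2) g))) : ℝ →ₘ[volume] ℂ) x =
      n.choose ij.1 * ((-1 : ℂ) ^ ij.2 * ((b x : ℂ) ^ ij.1 *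
        LinearPMap.extendByZero T ((mulBy b ^ ij.2) g) x)) := by
    rw [ae_all_iff]
    intro ij
    rw [← Nat.cast_smul_eq_nsmul ℂ]
    filter_upwards [coeFn_mulBy_pow b (LinearPMap.extendByZero T ((mulBy b ^ ij.2) g)) ij.1,
      AEEqFun.coeFn_smul (n.choose ij.1 : ℂ) ((-1 : ℂ) ^ ij.2 • (mulBy b ^ ij.1)
          (LinearPMap.extendByZero T ((mulBy b ^ ij.2) g))),
      AEEqFun.coeFn_smul ((-1 : ℂ) ^ ij.2) ((mulBy b ^ ij.1)
          (LinearPMap.extendByZero T ((mulBy b ^ ij.2) g)))] with x hx1 hx2 hx3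
    rw [hx2, Pi.smul_apply, hx3, Pi.smul_apply, hx1, smul_eq_mul, smul_eq_mul]
  filter_upwards [h1, h2] with x hx1 hx2
  rw [hx1, Finset.mul_sum]
  refine Finset.sum_congr rfl fun ij hij => ?_
  rw [hx2]
  have hn := Finset.HasAntidiagonal.mem_antidiagonal.1 hij
  have hfac : ((n.choose ij.1 : ℕ) : ℂ) * ij.1.factorial * ij.2.factorial = n.factorial := by
    have := Nat.choose_mul_factorial_mul_factorial (show ij.1 ≤ n by omega)
    rw [show n - ij.1 = ij.2 by omega] at this
    exact_mod_cast this
  have f1 : (ij.1.factorial : ℂ) ≠ 0 := by exact_mod_cast ij.1.factorial_ne_zero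
  have f2 : (ij.2.factorial : ℂ) ≠ 0 := by exact_mod_cast ij.2.factorial_ne_zero
  rw [← hfac]
  field_simp

/-! ### Weighted norms and power series in `z` -/

/-- With the weight moved into the function, all norms and limits refer to Lebesgue measure whatever
the weight. -/
theorem weightedNorm_eq {w : ℝ → ℝ≥0} (hw : AEMeasurable w volume) {r : ℝ} (hr : 0 < r)
    (f : ℝ →ₘ[volume] ℂ) :
    weightedNorm w r f = eLpNorm (fun x => ((w x : ℝ) : ℂ) * f x) (ENNReal.ofReal r) volume := by
  have h0 : ENNReal.ofReal r ≠ 0 := by simpa using hr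
  rw [weightedNorm, powMeasure, eLpNorm_eq_lintegral_rpow_enorm_toReal h0 ENNReal.ofReal_ne_top,
    eLpNorm_eq_lintegral_rpow_enorm_toReal h0 ENNReal.ofReal_ne_top, ENNReal.toReal_ofReal hr.le,
    lintegral_withDensity_eq_lintegral_mul₀ (hw.pow_const r).coe_nnreal_ennreal
      (f.aestronglyMeasurable.enorm.pow_const r)]
  congr 1
  refine lintegral_congr fun x => ?_
  rw [Pi.mul_apply, enorm_mul, ENNReal.mul_rpow_of_nonneg _ _ hr.le,
    ENNReal.coe_rpow_of_nonneg _ hr.le]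
  congr 2
  simp [enorm_eq_nnnorm]

theorem weightedNorm_le_mul {w₁ w₂ : ℝ → ℝ≥0} (h₁ : AEMeasurable w₁ volume)
    (h₂ : AEMeasurable w₂ volume) {e : ℝ} (he : 0 < e) {g₁ g₂ : ℝ →ₘ[volume] ℂ} {c : ℝ}
    (h : ∀ᵐ x, (w₁ x : ℝ) * ‖g₁ x‖ ≤ c * (w₂ x * ‖g₂ x‖)) :
    weightedNorm w₁ e g₁ ≤ ENNReal.ofReal c * weightedNorm w₂ e g₂ := by
  rw [weightedNorm_eq h₁ he, weightedNorm_eq h₂ he]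
  refine eLpNorm_le_mul_eLpNorm_of_ae_le_mul ?_ _
  filter_upwards [h] with x hx
  simpa [norm_mul] using hx

theorem aemeasurable_expWeight (s : ℝ) (b : ℝ →ₘ[volume] ℝ) :
    AEMeasurable (expWeight s b) volume :=
  (Real.measurable_exp.comp_aemeasurable
    (b.aestronglyMeasurable.aemeasurable.const_mul s)).real_toNNReal

/-- The function `exp (-z b) f`. -/
noncomputable def expMul (b : ℝ →ₘ[volume] ℝ) (f : ℝ →ₘ[volume] ℂ) (z : ℂ) : ℝ →ₘ[volume] ℂ :=
  AEEqFun.comp (fun t : ℝ => Complex.exp (-z * t)) (by fun_prop) b * f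

theorem coeFn_expMul (b : ℝ →ₘ[volume] ℝ) (f : ℝ →ₘ[volume] ℂ) (z : ℂ) :
    expMul b f z =ᵐ[volume] fun x => Complex.exp (-z * b x) * f x := by
  have hc : Continuous fun t : ℝ => Complex.exp (-z * t) := by fun_prop
  filter_upwards [AEEqFun.coeFn_mul (AEEqFun.comp _ hc b) f, AEEqFun.coeFn_comp _ hc b]
    with x h1 h2
  rw [expMul, h1, Pi.mul_apply, h2, Function.comp_apply]

/-- The weight `w exp (-|c| |b|)`, as a minimum. -/
noncomputable def dampedWeight (w : ℝ → ℝ≥0) (b : ℝ → ℝ) (c : ℝ) (x : ℝ) : ℝ≥0 :=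
  w x * min (expWeight c b x) (expWeight (-c) b x)

theorem coe_dampedWeight (w : ℝ → ℝ≥0) (b : ℝ → ℝ) {c : ℝ} (hc : 0 ≤ c) (x : ℝ) :
    (dampedWeight w b c x : ℝ) = w x * Real.exp (-(c * |b x|)) := by
  rw [dampedWeight, NNReal.coe_mul, NNReal.coe_min, coe_expWeight_real, coe_expWeight_real]
  congr 1
  rcases le_total 0 (b x) with h | h
  · rw [abs_of_nonneg h, min_eq_right (Real.exp_le_exp.2 (by nlinarith))]
    congr 1; ring
  · rw [abs_of_nonpos h, min_eq_left (Real.exp_le_exp.2 (by nlinarith))]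
    congr 1; ring

/-- `T` maps `L^p(w^p)` to `L^q(w^q)` with norm at most `D`. -/
def WeightedBound (T : LineOperator) (p q : ℝ) (w : ℝ → ℝ≥0) (D : ℝ≥0) : Prop :=
  ∀ g : ℝ →ₘ[volume] ℂ, weightedNorm w p g < ∞ →
    ∃ hg : g ∈ T.domain, weightedNorm w q (T ⟨g, hg⟩) ≤ D * weightedNorm w p g

theorem WeightedBound.extendByZero {T : LineOperator} {p q : ℝ} {w : ℝ → ℝ≥0} {D : ℝ≥0}
    (h : WeightedBound T p q w D) {g : ℝ →ₘ[volume] ℂ} (hg : weightedNorm w p g < ∞) :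
    g ∈ T.domain ∧ weightedNorm w q (LinearPMap.extendByZero T g) ≤ D * weightedNorm w p g := by
  obtain ⟨h1, h2⟩ := h g hg
  exact ⟨h1, by rwa [LinearPMap.extendByZero_apply T h1]⟩

section Series

variable {p q r : ℝ} {T : LineOperator} {b : ℝ →ₘ[volume] ℝ} {w : ℝ → ℝ≥0} {A : ℝ≥0}
  {f : ℝ →ₘ[volume] ℂ}

theorem aemeasurable_dampedWeight (hw : AEMeasurable w volume) (c : ℝ) :
    AEMeasurable (dampedWeight w b c) volume :=
  hw.mul ((aemeasurable_expWeight c b).min (aemeasurable_expWeight (-c) b))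

theorem ofReal_one_half_pow (n : ℕ) : ENNReal.ofReal ((1 / 2) ^ n) = 2⁻¹ ^ n := by
  rw [ENNReal.ofReal_pow (by norm_num), one_div, ENNReal.ofReal_inv_of_pos two_pos]
  simp

/-- `y^j / j! ≤ exp y` at `y = 2r|b|`. Damping with `2r` instead of `r` gains `(1/2)^j`, which makes
the series converge on the whole closed disc of radius `r`. -/
theorem weightedNorm_mulBy_pow_le (hp : 0 < p) (hr : 0 < r) (hw : AEMeasurable w volume) (j : ℕ) :
    weightedNorm (dampedWeight w b (2 * r)) p ((mulBy b ^ j) f) ≤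
      ENNReal.ofReal (j.factorial / r ^ j * (1 / 2) ^ j) * weightedNorm w p f := by
  refine weightedNorm_le_mul (aemeasurable_dampedWeight hw _) hw hp ?_
  filter_upwards [coeFn_mulBy_pow b f j] with x hx
  rw [hx, coe_dampedWeight w b (by positivity), norm_mul, norm_pow, Complex.norm_real,
    Real.norm_eq_abs]
  have h1 := Real.pow_div_factorial_le_exp (x := 2 * r * |b x|) (by positivity) j
  have hf0 : (0 : ℝ) < j.factorial := by exact_mod_cast j.factorial_pos
  rw [div_le_iff₀ hf0] at h1
  have h2 : Real.exp (-(2 * r * |b x|)) * |b x| ^ j ≤ j.factorial / r ^ j * (1 / 2) ^ j := by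
    rw [Real.exp_neg, inv_mul_le_iff₀ (Real.exp_pos _)]
    have h3 : |b x| ^ j = (2 * r * |b x|) ^ j * ((1 / 2) ^ j / r ^ j) := by
      rw [mul_pow, mul_pow, one_div, inv_pow]; field_simp
    rw [h3]
    calc _ ≤ Real.exp (2 * r * |b x|) * j.factorial * ((1 / 2) ^ j / r ^ j) := by gcongr
      _ = _ := by ring
  calc (w x : ℝ) * Real.exp (-(2 * r * |b x|)) * (|b x| ^ j * ‖f x‖)
      = (Real.exp (-(2 * r * |b x|)) * |b x| ^ j) * (w x * ‖f x‖) := by ring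
    _ ≤ _ := by gcongr

theorem mulBy_pow_mem_domain (hp : 0 < p) (hr : 0 < r) (hw : AEMeasurable w volume)
    (hA : WeightedBound T p q (dampedWeight w b (2 * r)) A) (hf : weightedNorm w p f < ∞) (j : ℕ) :
    (mulBy b ^ j) f ∈ T.domain :=
  (hA.extendByZero ((weightedNorm_mulBy_pow_le hp hr hw j).trans_lt
    (ENNReal.mul_lt_top ENNReal.ofReal_lt_top hf))).1

/-- In the damped norm the terms decay like `2^(-j)`, and the damped weight is positive almost
everywhere, so it can be divided out pointwise. -/
theorem ae_summable_extendByZero_mulBy_pow (hp : 0 < p) (hq : 1 < q) (hr : 0 < r)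
    (hw : AEMeasurable w volume) (hpos : ∀ᵐ x, 0 < w x)
    (hA : WeightedBound T p q (dampedWeight w b (2 * r)) A) (hf : weightedNorm w p f < ∞) :
    ∀ᵐ x, Summable fun j : ℕ =>
      ‖(-1) ^ j / j.factorial * LinearPMap.extendByZero T ((mulBy b ^ j) f) x‖ * r ^ j := by
  set v := dampedWeight w b (2 * r) with hv
  have hvm : AEMeasurable v volume := aemeasurable_dampedWeight hw _
  set a : ℕ → ℝ →ₘ[volume] ℂ := fun j => LinearPMap.extendByZero T ((mulBy b ^ j) f) with ha
  set u : ℕ → ℝ → ℂ := fun j x => ((r ^ j / j.factorial : ℝ) : ℂ) * (((v x : ℝ) : ℂ) * a j x)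
    with hu
  have hnorm : ∀ j, eLpNorm (u j) (ENNReal.ofReal q) volume ≤ (A * weightedNorm w p f) * 2⁻¹ ^ j := by
    intro j
    have h1 := weightedNorm_mulBy_pow_le (b := b) (f := f) hp hr hw j
    have h2 := (hA.extendByZero (h1.trans_lt (ENNReal.mul_lt_top ENNReal.ofReal_lt_top hf))).2
    rw [weightedNorm_eq hvm (by linarith)] at h2
    have hc : u j = ((r ^ j / j.factorial : ℝ) : ℂ) • fun x => ((v x : ℝ) : ℂ) * a j x := rfl
    rw [hc, eLpNorm_const_smul]
    have hf0 : (0 : ℝ) < j.factorial := by exact_mod_cast j.factorial_pos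
    have hc0 : (0 : ℝ) ≤ r ^ j / j.factorial := by positivity
    have hen : ‖((r ^ j / j.factorial : ℝ) : ℂ)‖ₑ = ENNReal.ofReal (r ^ j / j.factorial) := by
      rw [← ofReal_norm, Complex.norm_real, Real.norm_of_nonneg hc0]
    rw [hen]
    calc ENNReal.ofReal (r ^ j / j.factorial) *
          eLpNorm (fun x => ((v x : ℝ) : ℂ) * a j x) (ENNReal.ofReal q) volume
        ≤ ENNReal.ofReal (r ^ j / j.factorial) * (A * (ENNReal.ofReal
            (j.factorial / r ^ j * (1 / 2) ^ j) * weightedNorm w p f)) := by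
          gcongr
          exact h2.trans (mul_le_mul_right h1 _)
      _ = (A * weightedNorm w p f) * (ENNReal.ofReal (r ^ j / j.factorial) *
            ENNReal.ofReal (j.factorial / r ^ j * (1 / 2) ^ j)) := by ring
      _ = _ := by
          rw [← ENNReal.ofReal_mul hc0, ← ofReal_one_half_pow]
          congr 2; field_simp
  have hsum : ∀ᵐ x, Summable fun j => ‖u j x‖ := ae_summable_norm_of_eLpNorm_le hq.le
    (ENNReal.mul_ne_top ENNReal.coe_ne_top hf.ne) (fun j =>
      ((hvm.coe_nnreal_real.complex_ofReal.aestronglyMeasurable.mul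
        (a j).aestronglyMeasurable).const_mul _)) hnorm
  filter_upwards [hsum, hpos] with x hx hwx
  have hvx : 0 < (v x : ℝ) := by
    rw [hv, coe_dampedWeight w b (by positivity)]
    have : 0 < (w x : ℝ) := hwx
    positivity
  refine (hx.mul_left (v x : ℝ)⁻¹).congr fun j => ?_
  have hf0 : (0 : ℝ) < j.factorial := by exact_mod_cast j.factorial_pos
  simp only [hu, norm_mul, norm_div, norm_pow, norm_neg, norm_one, one_pow, Complex.norm_real,
    Complex.norm_natCast, Real.norm_of_nonneg hvx.le, Real.norm_of_nonneg hr.le,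
    Real.norm_of_nonneg hf0.le]
  field_simp
  rfl

/-- The remainder bound for the exponential contains `exp (2 ‖z b‖)`, which the damping cancels when
`‖z‖ ≤ r`. -/
theorem weightedNorm_expMul_sub_le (hp : 0 < p) (hr : 0 < r) (hw : AEMeasurable w volume) {z : ℂ}
    (hz : ‖z‖ ≤ r) (n : ℕ) :
    weightedNorm (dampedWeight w b (2 * r)) p (expMul b f z -
      ∑ j ∈ Finset.range n, ((-z) ^ j / j.factorial) • (mulBy b ^ j) f) ≤
      ENNReal.ofReal ((1 / 2) ^ n) * weightedNorm w p f := by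
  refine weightedNorm_le_mul (aemeasurable_dampedWeight hw _) hw hp ?_
  have h1 : ∀ᵐ x, ∀ j : ℕ, (((-z) ^ j / j.factorial) • (mulBy b ^ j) f : ℝ →ₘ[volume] ℂ) x =
      ((-z) ^ j / j.factorial) * ((b x : ℂ) ^ j * f x) := by
    rw [ae_all_iff]
    intro j
    filter_upwards [AEEqFun.coeFn_smul ((-z) ^ j / j.factorial : ℂ) ((mulBy b ^ j) f),
      coeFn_mulBy_pow b f j] with x hx1 hx2
    rw [hx1, Pi.smul_apply, hx2, smul_eq_mul]
  filter_upwards [h1, coeFn_expMul b f z, AEEqFun.coeFn_sub (expMul b f z)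
    (∑ j ∈ Finset.range n, ((-z) ^ j / j.factorial) • (mulBy b ^ j) f),
    coeFn_finset_sum (Finset.range n) fun j => ((-z) ^ j / j.factorial) • (mulBy b ^ j) f]
    with x hx1 hx2 hx3 hx4
  rw [hx3, Pi.sub_apply, hx2, hx4, coe_dampedWeight w b (by positivity)]
  simp only [hx1]
  have h2 : Complex.exp (-z * b x) * f x -
      ∑ j ∈ Finset.range n, (-z) ^ j / j.factorial * ((b x : ℂ) ^ j * f x) =
      (Complex.exp (-z * b x) - ∑ j ∈ Finset.range n, (-z * b x) ^ j / j.factorial) * f x := by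
    rw [sub_mul, Finset.sum_mul]
    congr 1
    refine Finset.sum_congr rfl fun j _ => ?_
    rw [mul_pow]; ring
  rw [h2, norm_mul]
  have h3 := norm_exp_sub_sum_le_two_inv_pow_mul (-z * b x) n
  have h4 : ‖-z * b x‖ ≤ r * |b x| := by
    rw [norm_mul, norm_neg, Complex.norm_real, Real.norm_eq_abs]
    gcongr
  have h5 : Real.exp (2 * ‖-z * b x‖) ≤ Real.exp (2 * r * |b x|) := Real.exp_le_exp.2 (by linarith)
  have h6 : Real.exp (-(2 * r * |b x|)) * Real.exp (2 * r * |b x|) = 1 := by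
    rw [← Real.exp_add]; simp
  calc _ ≤ (w x : ℝ) * Real.exp (-(2 * r * |b x|)) *
        ((1 / 2) ^ n * Real.exp (2 * r * |b x|) * ‖f x‖) := by
        gcongr
        exact h3.trans (by gcongr)
    _ = (Real.exp (-(2 * r * |b x|)) * Real.exp (2 * r * |b x|)) *
        ((1 / 2) ^ n * (w x * ‖f x‖)) := by ring
    _ ≤ _ := by rw [h6, one_mul]

/-- Expansion of `T (exp (-z b) f)` into a power series in `z`. -/
theorem ae_extendByZero_expMul_eq_tsum (hp : 0 < p) (hq : 1 < q) (hr : 0 < r)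
    (hw : AEMeasurable w volume) (hpos : ∀ᵐ x, 0 < w x)
    (hA : WeightedBound T p q (dampedWeight w b (2 * r)) A) (hf : weightedNorm w p f < ∞) {z : ℂ}
    (hz : ‖z‖ ≤ r) :
    ∀ᵐ x, LinearPMap.extendByZero T (expMul b f z) x = ∑' j : ℕ,
      (-1) ^ j / j.factorial * LinearPMap.extendByZero T ((mulBy b ^ j) f) x * z ^ j := by
  set v := dampedWeight w b (2 * r) with hv
  have hvm : AEMeasurable v volume := aemeasurable_dampedWeight hw _
  set a : ℕ → ℝ →ₘ[volume] ℂ := fun j => LinearPMap.extendByZero T ((mulBy b ^ j) f) with ha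
  have hdom := mulBy_pow_mem_domain hp hr hw hA hf
  have hfin : ∀ n, weightedNorm v p (expMul b f z -
      ∑ j ∈ Finset.range n, ((-z) ^ j / j.factorial) • (mulBy b ^ j) f) < ∞ := fun n =>
    (weightedNorm_expMul_sub_le hp hr hw hz n).trans_lt
      (ENNReal.mul_lt_top ENNReal.ofReal_lt_top hf)
  have hzdom : expMul b f z ∈ T.domain := by
    have := (hA.extendByZero (hfin 0)).1
    simpa using this
  -- By linearity the error of a partial sum is `T` of the remainder of the exponential. Its damped
  -- norm is of order `2^(-n)`, so it tends to zero almost everywhere along the full sequence.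
  set d : ℕ → ℝ →ₘ[volume] ℂ := fun n => LinearPMap.extendByZero T (expMul b f z) -
    ∑ j ∈ Finset.range n, ((-z) ^ j / j.factorial) • a j with hd
  have hdnorm : ∀ n, eLpNorm (fun x => ((v x : ℝ) : ℂ) * d n x) (ENNReal.ofReal q) volume ≤
      (A * weightedNorm w p f) * 2⁻¹ ^ n := by
    intro n
    have h2 := (hA.extendByZero (hfin n)).2
    rw [LinearPMap.extendByZero_sub_sum T hzdom hdom (fun j => (-z) ^ j / j.factorial),
      weightedNorm_eq hvm (by linarith)] at h2
    refine h2.trans ((mul_le_mul_right (weightedNorm_expMul_sub_le hp hr hw hz n) _).trans ?_)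
    rw [ofReal_one_half_pow]
    exact le_of_eq (by ring)
  have hsum : ∀ᵐ x, Summable fun n => ‖((v x : ℝ) : ℂ) * d n x‖ :=
    ae_summable_norm_of_eLpNorm_le hq.le (ENNReal.mul_ne_top ENNReal.coe_ne_top hf.ne) (fun n =>
      (hvm.coe_nnreal_real.complex_ofReal.aestronglyMeasurable.mul
        (d n).aestronglyMeasurable)) hdnorm
  have h1 : ∀ᵐ x, ∀ j : ℕ, (((-z) ^ j / j.factorial) • a j : ℝ →ₘ[volume] ℂ) x =
      ((-z) ^ j / j.factorial) * a j x := by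
    rw [ae_all_iff]
    intro j
    filter_upwards [AEEqFun.coeFn_smul ((-z) ^ j / j.factorial : ℂ) (a j)] with x hx1
    rw [hx1, Pi.smul_apply, smul_eq_mul]
  have h2 : ∀ᵐ x, ∀ n : ℕ, d n x = LinearPMap.extendByZero T (expMul b f z) x -
      ∑ j ∈ Finset.range n, (((-z) ^ j / j.factorial) • a j : ℝ →ₘ[volume] ℂ) x := by
    rw [ae_all_iff]
    intro n
    filter_upwards [AEEqFun.coeFn_sub (LinearPMap.extendByZero T (expMul b f z))
      (∑ j ∈ Finset.range n, ((-z) ^ j / j.factorial) • a j),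
      coeFn_finset_sum (Finset.range n) fun j => ((-z) ^ j / j.factorial) • a j] with x hx1 hx2
    rw [hd, hx1, Pi.sub_apply, hx2]
  filter_upwards [hsum, h1, h2, hpos,
    ae_summable_extendByZero_mulBy_pow hp hq hr hw hpos hA hf] with x hx hx1 hx2 hwx hxs
  have hvx : 0 < (v x : ℝ) := by
    rw [hv, coe_dampedWeight w b (by positivity)]
    have : 0 < (w x : ℝ) := hwx
    positivity
  have hlim : Filter.Tendsto (fun n => d n x) Filter.atTop (nhds 0) := by
    rw [tendsto_zero_iff_norm_tendsto_zero]
    have := (hx.tendsto_atTop_zero.const_mul (v x : ℝ)⁻¹)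
    rw [mul_zero] at this
    refine this.congr fun n => ?_
    rw [norm_mul, Complex.norm_real, Real.norm_of_nonneg hvx.le, inv_mul_cancel_left₀ hvx.ne']
  have hS : Summable fun j : ℕ => (-1) ^ j / j.factorial * a j x * z ^ j := by
    refine Summable.of_norm_bounded hxs fun j => ?_
    rw [norm_mul, norm_pow]
    gcongr
  have hlim2 : Filter.Tendsto (fun n => ∑ j ∈ Finset.range n, (-1) ^ j / j.factorial * a j x * z ^ j)
      Filter.atTop (nhds (LinearPMap.extendByZero T (expMul b f z) x)) := by
    have := hlim.const_sub (LinearPMap.extendByZero T (expMul b f z) x)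
    rw [sub_zero] at this
    refine this.congr fun n => ?_
    rw [hx2, sub_sub_cancel]
    refine Finset.sum_congr rfl fun j _ => ?_
    rw [hx1, neg_pow]; ring
  exact tendsto_nhds_unique hlim2 hS.hasSum.tendsto_sum_nat

end Series

/-! ### Cauchy estimate for the commutators and conclusion -/

/-- Bounds for an operator on the spaces with weights `w exp (s b)` yield bounds for its iterated
commutators with `b`. -/
theorem exists_weightedNorm_iterCommutator_le {p q r : ℝ} (hp : 1 < p) (hq : 1 < q) (hr : 0 < r)
    {T : LineOperator} {b : ℝ →ₘ[volume] ℝ} {w : ℝ → ℝ≥0} (hw : AEMeasurable w volume)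
    (hpos : ∀ᵐ x, 0 < w x) {D A : ℝ≥0}
    (hT : ∀ s, |s| ≤ r → WeightedBound T p q (fun x => w x * expWeight s b x) D)
    (hA : WeightedBound T p q (dampedWeight w b (2 * r)) A) {f : ℝ →ₘ[volume] ℂ}
    (hf : weightedNorm w p f < ∞) (k : ℕ) :
    ∃ h : f ∈ (iterCommutator b T k).domain, weightedNorm w q (iterCommutator b T k ⟨f, h⟩) ≤
      ENNReal.ofReal (k.factorial / r ^ k) * (D * weightedNorm w p f) := by
  have hp0 : 0 < p := by linarith
  have hq0 : 0 < q := by linarith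
  obtain ⟨hdom, hiter⟩ := ae_iterCommutator_eq b T k (mulBy_pow_mem_domain hp0 hr hw hA hf)
  refine ⟨hdom, ?_⟩
  set a : ℕ → ℝ →ₘ[volume] ℂ := fun j => LinearPMap.extendByZero T ((mulBy b ^ j) f) with ha
  set z : ℕ → ℕ → ℂ := fun N l => r * unityRoot N ^ l with hz
  have hzn : ∀ N l, ‖z N l‖ = r := fun N l => by
    rw [hz, norm_mul, norm_pow, norm_unityRoot, Complex.norm_real, Real.norm_of_nonneg hr.le,
      one_pow, mul_one]
  set Z : ℕ → ℕ → ℝ → ℂ := fun N l x => ((z N l) ^ k)⁻¹ * (((w x : ℝ) : ℂ) *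
    (Complex.exp (z N l * b x) * LinearPMap.extendByZero T (expMul b f (z N l)) x)) with hZ
  have hZm : ∀ N l, AEStronglyMeasurable (Z N l) volume := fun N l => by
    refine AEStronglyMeasurable.const_mul ?_ _
    refine (hw.coe_nnreal_real.complex_ofReal.aestronglyMeasurable.mul ?_)
    refine AEStronglyMeasurable.mul ?_ (AEEqFun.aestronglyMeasurable _)
    exact (by fun_prop : Continuous fun t : ℝ => Complex.exp (z N l * t)).comp_aestronglyMeasurable
      b.aestronglyMeasurable
  have hZnorm : ∀ N l, eLpNorm (Z N l) (ENNReal.ofReal q) volume ≤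
      ENNReal.ofReal ((r ^ k)⁻¹) * (D * weightedNorm w p f) := by
    intro N l
    -- Only the real part of `z` affects moduli: `exp (z b)` turns `w` into `w exp (s b)`, and for
    -- that weight `exp (-z b) f` has exactly the size that `f` has for `w`.
    set s := (z N l).re with hs
    have hsr : |s| ≤ r := (Complex.abs_re_le_norm _).trans (hzn N l).le
    have hwm : AEMeasurable (fun x => w x * expWeight s b x) volume :=
      hw.mul (aemeasurable_expWeight s b)
    have hexp : ∀ x (c : ℂ), ‖Complex.exp (c * b x)‖ = Real.exp (c.re * b x) := fun x c => by
      rw [Complex.norm_exp]; simp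
    have h1 : weightedNorm (fun x => w x * expWeight s b x) p (expMul b f (z N l)) ≤
        weightedNorm w p f := by
      have := weightedNorm_le_mul hwm hw hp0 (c := 1) (g₁ := expMul b f (z N l)) (g₂ := f) (by
        filter_upwards [coeFn_expMul b f (z N l)] with x hx
        rw [hx, norm_mul, hexp, NNReal.coe_mul, coe_expWeight_real, Complex.neg_re, ← hs, one_mul]
        have : Real.exp (s * b x) * Real.exp (-s * b x) = 1 := by rw [← Real.exp_add]; simp
        refine le_of_eq ?_
        linear_combination (w x * ‖f x‖ : ℝ) * this)
      simpa using this
    have h2 := ((hT s hsr).extendByZero (h1.trans_lt hf)).2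
    rw [weightedNorm_eq hwm hq0] at h2
    have h3 : eLpNorm (Z N l) (ENNReal.ofReal q) volume ≤ ENNReal.ofReal ((r ^ k)⁻¹) *
        eLpNorm (fun x => (((w x * expWeight s b x : ℝ≥0) : ℝ) : ℂ) *
          LinearPMap.extendByZero T (expMul b f (z N l)) x) (ENNReal.ofReal q) volume := by
      refine eLpNorm_le_mul_eLpNorm_of_ae_le_mul (ae_of_all _ fun x => ?_) _
      simp only [hZ, norm_mul, norm_inv, norm_pow, hzn, hexp, Complex.norm_real, ← hs,
        NNReal.coe_mul, coe_expWeight_real, Real.norm_eq_abs, NNReal.abs_eq, Real.abs_exp]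
      refine le_of_eq ?_
      ring
    exact h3.trans (mul_le_mul_right (h2.trans (mul_le_mul_right h1 _)) _)
  set G : ℕ → ℝ → ℂ := fun N x => (N : ℂ)⁻¹ * ∑ l ∈ Finset.range N, Z N l x with hG
  have hGm : ∀ N, AEStronglyMeasurable (G N) volume := fun N =>
    (Finset.aestronglyMeasurable_fun_sum _ fun l _ => hZm N l).const_mul _
  have hGnorm : ∀ N, eLpNorm (G N) (ENNReal.ofReal q) volume ≤
      ENNReal.ofReal ((r ^ k)⁻¹) * (D * weightedNorm w p f) := by
    intro N
    have hc : G N = (N : ℂ)⁻¹ • ∑ l ∈ Finset.range N, Z N l := by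
      funext x; simp [hG, Finset.sum_apply]
    rw [hc, eLpNorm_const_smul]
    have h1 := eLpNorm_sum_le (p := ENNReal.ofReal q) (μ := volume) (s := Finset.range N)
      (f := Z N) (fun l _ => hZm N l) (by simpa using hq.le)
    have h2 := h1.trans (Finset.sum_le_sum fun l _ => hZnorm N l)
    rw [Finset.sum_const, Finset.card_range, nsmul_eq_mul] at h2
    rcases N.eq_zero_or_pos with rfl | hN
    · simp
    · have hN0 : (N : ℂ) ≠ 0 := by exact_mod_cast hN.ne'
      have hen : ‖(N : ℂ)⁻¹‖ₑ = (N : ℝ≥0∞)⁻¹ := by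
        rw [enorm_inv hN0]
        congr 1
        rw [← ofReal_norm, Complex.norm_natCast, ENNReal.ofReal_natCast]
      rw [hen]
      refine (mul_le_mul_right h2 _).trans (le_of_eq ?_)
      rw [← mul_assoc, ENNReal.inv_mul_cancel (by exact_mod_cast hN.ne') (by simp), one_mul]
  set F : ℝ → ℂ := fun x => ((w x : ℝ) : ℂ) * ∑ ij ∈ Finset.HasAntidiagonal.antidiagonal k,
    (b x : ℂ) ^ ij.1 / ij.1.factorial * ((-1) ^ ij.2 / ij.2.factorial * a ij.2 x) with hF
  have hlim : ∀ᵐ x, Filter.Tendsto (fun N => G N x) Filter.atTop (nhds (F x)) := by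
    have hall : ∀ᵐ x, ∀ N l : ℕ, LinearPMap.extendByZero T (expMul b f (z N l)) x = ∑' j : ℕ,
        (-1) ^ j / j.factorial * a j x * z N l ^ j := by
      rw [ae_all_iff]
      intro N
      rw [ae_all_iff]
      exact fun l => ae_extendByZero_expMul_eq_tsum hp0 hq hr hw hpos hA hf (hzn N l).le
    filter_upwards [hall, ae_summable_extendByZero_mulBy_pow hp0 hq hr hw hpos hA hf]
      with x hx hxs
    refine ((tendsto_average_exp_mul_tsum hr hxs (b x) k).const_mul ((w x : ℝ) : ℂ)).congr
      fun N => ?_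
    simp only [hG, hZ, Finset.mul_sum, hx]
    refine Finset.sum_congr rfl fun l _ => ?_
    simp only [hz]
    ring
  -- An average of `N` samples obeys the bound of a single one, and Fatou's lemma carries it to the
  -- pointwise limit.
  have hfatou : eLpNorm F (ENNReal.ofReal q) volume ≤
      ENNReal.ofReal ((r ^ k)⁻¹) * (D * weightedNorm w p f) :=
    (Lp.eLpNorm_lim_le_liminf_eLpNorm hGm F hlim).trans
      (Filter.liminf_le_of_frequently_le' (Filter.Frequently.of_forall hGnorm))
  rw [weightedNorm_eq hw hq0]
  have hcongr : (fun x => ((w x : ℝ) : ℂ) * iterCommutator b T k ⟨f, hdom⟩ x) =ᵐ[volume]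
      (k.factorial : ℂ) • F := by
    filter_upwards [hiter] with x hx
    rw [hx, Pi.smul_apply, smul_eq_mul, hF]
    ring
  rw [eLpNorm_congr_ae hcongr, eLpNorm_const_smul, ← ofReal_norm, Complex.norm_natCast]
  refine (mul_le_mul_right hfatou _).trans (le_of_eq ?_)
  rw [← mul_assoc, ← ENNReal.ofReal_mul (by positivity), div_eq_mul_inv]

theorem MemBMO.hasMeanOscillationLE {b : ℝ →ₘ[volume] ℝ} (hb : MemBMO b) {B : ℝ} (hB : 0 ≤ B)
    (h : bmoNorm b ≤ ENNReal.ofReal B) : HasMeanOscillationLE b B := by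
  intro a c hac
  have hca : 0 < c - a := sub_pos.2 hac
  have hmean : ⨍ y in Ioo a c, b y = intervalMean b a c := by
    rw [setAverage_eq, intervalMean, intervalIntegral.integral_of_le hac.le,
      integral_Ioc_eq_integral_Ioo, Measure.real, Real.volume_Ioo, ENNReal.toReal_ofReal hca.le,
      smul_eq_mul, div_eq_inv_mul]
  have h1 : (∫⁻ x in Ioo a c, ‖b x - ⨍ y in Ioo a c, b y‖ₑ) / ENNReal.ofReal (c - a) ≤
      ENNReal.ofReal B := by
    rw [bmoNorm] at h
    simp only [iSup_le_iff] at h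
    exact h a c hac
  rw [ENNReal.div_le_iff (by simpa using hac) ENNReal.ofReal_ne_top, ← ENNReal.ofReal_mul hB,
    hmean] at h1
  have hint : IntegrableOn (fun x => b x - intervalMean b a c) (Ioo a c) volume :=
    (((hb.locallyIntegrable.sub (locallyIntegrable_const _)).integrableOn_isCompact
      isCompact_Icc).mono_set Ioo_subset_Icc_self)
  rw [intervalIntegral.integral_of_le hac.le, integral_Ioc_eq_integral_Ioo]
  rw [← ENNReal.ofReal_le_ofReal_iff (by positivity)]
  refine le_trans (le_of_eq ?_) h1
  rw [ofReal_integral_eq_lintegral_ofReal hint.abs (ae_of_all _ fun x => abs_nonneg _)]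
  simp only [Real.enorm_eq_ofReal_abs]

theorem expWeight_rpow (s q : ℝ) (b : ℝ → ℝ) (x : ℝ) :
    expWeight s b x ^ q = expWeight (q * s) b x := by
  rw [← NNReal.coe_inj, NNReal.coe_rpow, coe_expWeight_real, coe_expWeight_real, ← Real.exp_mul]
  congr 1; ring

/-- This exhibits the power of the damped weight as a minimum of two perturbations of `w^q`, as
`MemApPlus.min` requires. -/
theorem dampedWeight_rpow {q : ℝ} (hq : 0 ≤ q) (w : ℝ → ℝ≥0) (b : ℝ → ℝ) (c x : ℝ) :
    dampedWeight w b c x ^ q =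
      min (w x ^ q * expWeight (q * c) b x) (w x ^ q * expWeight (q * -c) b x) := by
  rw [dampedWeight, NNReal.mul_rpow, (NNReal.monotone_rpow_of_nonneg hq).map_min, expWeight_rpow,
    expWeight_rpow, mul_min]

theorem MemApPlus.aemeasurable_of_rpow {p q : ℝ} (hq : 0 < q) {w : ℝ → ℝ≥0}
    (hw : MemApPlus p fun x => w x ^ q) : AEMeasurable w volume := by
  have h1 : AEMeasurable (fun x => w x ^ q) volume := hw.aemeasurable.ennreal_toNNReal
  refine (h1.pow_const q⁻¹).congr (ae_of_all _ fun x => ?_)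
  exact NNReal.rpow_rpow_inv hq.ne' _

/-- An `A_p^+`-weighted bound depending on the weight only through its constant passes to
comparable weights. -/
theorem weightedBound_of_comparable {p₀ p q : ℝ} (hp : 0 < p) (hq : 0 < q) {T : LineOperator}
    {φ : ℝ≥0 → ℝ≥0} {C₀ : ℝ≥0}
    (hT : ∀ w : ℝ → ℝ≥0, MemApPlus p₀ (fun x => w x ^ q) →
      WeightedBound T p q w (C₀ * φ (ApPlusConst p₀ (fun x => w x ^ q)).toNNReal))
    {w u : ℝ → ℝ≥0} (hw : AEMeasurable w volume) {R : ℝ≥0} (hu1 : ∀ x, 1 ≤ u x)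
    (huR : ∀ x, u x ≤ R) (hmem : MemApPlus p₀ fun x => w x ^ q * u x) :
    WeightedBound T p q w
      (R ^ q⁻¹ * (C₀ * φ (ApPlusConst p₀ (fun x => w x ^ q * u x)).toNNReal)) := by
  set v : ℝ → ℝ≥0 := fun x => w x * u x ^ q⁻¹ with hv
  have hvq : (fun x => v x ^ q) = fun x => w x ^ q * u x := by
    funext x
    rw [hv, NNReal.mul_rpow, NNReal.rpow_inv_rpow hq.ne']
  rw [← hvq] at hmem ⊢
  have hvm : AEMeasurable v volume := hmem.aemeasurable_of_rpow hq
  have hqi : 0 ≤ q⁻¹ := inv_nonneg.2 hq.le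
  intro g hg
  have h1 : weightedNorm v p g ≤ R ^ q⁻¹ * weightedNorm w p g := by
    have := weightedNorm_le_mul hvm hw hp (g₁ := g) (g₂ := g) (c := (R ^ q⁻¹ : ℝ≥0))
      (ae_of_all _ fun x => by
        have h : (v x : ℝ) ≤ ((R ^ q⁻¹ : ℝ≥0) : ℝ) * w x := by
          rw [← NNReal.coe_mul, NNReal.coe_le_coe, mul_comm]
          exact mul_le_mul_right (NNReal.rpow_le_rpow (huR x) hqi) _
        rw [← mul_assoc]
        gcongr)
    rwa [ENNReal.ofReal_coe_nnreal, ENNReal.coe_rpow_of_nonneg _ hqi] at this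
  obtain ⟨hdom, hle⟩ := hT v hmem g (h1.trans_lt (ENNReal.mul_lt_top
    (ENNReal.rpow_lt_top_of_nonneg hqi ENNReal.coe_ne_top) hg))
  refine ⟨hdom, ?_⟩
  have h2 : weightedNorm w q (T ⟨g, hdom⟩) ≤ weightedNorm v q (T ⟨g, hdom⟩) := by
    have := weightedNorm_le_mul hw hvm hq (g₁ := T ⟨g, hdom⟩) (g₂ := T ⟨g, hdom⟩) (c := 1)
      (ae_of_all _ fun x => by
        have h : (w x : ℝ) ≤ v x := by
          rw [NNReal.coe_le_coe]
          exact le_mul_of_one_le_right' (NNReal.one_le_rpow (hu1 x) hqi)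
        rw [one_mul]
        gcongr)
    simpa using this
  refine (h2.trans hle).trans ((mul_le_mul_right h1 _).trans (le_of_eq ?_))
  push_cast
  rw [ENNReal.coe_rpow_of_nonneg _ hqi]
  ring

/-- If `x ≤ c b ^ k` for all `b > β`, then `x ≤ c β ^ k`. -/
theorem ENNReal.le_mul_pow_of_forall_gt {x c β : ℝ≥0∞} (hc : c ≠ ∞) (hβ : β ≠ ∞) {k : ℕ}
    (h : ∀ B : ℝ, 0 < B → β < ENNReal.ofReal B → x ≤ c * ENNReal.ofReal B ^ k) :
    x ≤ c * β ^ k := by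
  have hlim : Filter.Tendsto (fun n : ℕ => c * ENNReal.ofReal (β.toReal + 1 / ((n : ℝ) + 1)) ^ k)
      Filter.atTop (nhds (c * ENNReal.ofReal (β.toReal + 0) ^ k)) :=
    ENNReal.Tendsto.const_mul (ENNReal.Tendsto.pow (ENNReal.tendsto_ofReal
      (tendsto_one_div_add_atTop_nhds_zero_nat.const_add _))) (Or.inr hc)
  rw [add_zero, ENNReal.ofReal_toReal hβ] at hlim
  refine ge_of_tendsto' hlim fun n => ?_
  have hn : (0 : ℝ) < 1 / ((n : ℝ) + 1) := by positivity
  have hβ0 : 0 ≤ β.toReal := ENNReal.toReal_nonneg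
  refine h _ (by positivity) ?_
  rw [ENNReal.lt_ofReal_iff_toReal_lt hβ]
  linarith

theorem theorem1p2 (p₀ p q : ℝ) (hp₀ : 1 < p₀) (hp : 1 < p) (hq : 1 < q) :
    ∃ κ : ℝ≥0, 0 < κ ∧ ∀ k : ℕ, 1 ≤ k → ∃ C : ℝ≥0,
      ∀ (T : LineOperator) (φ : ℝ≥0 → ℝ≥0) (C₀ : ℝ≥0),
        (∀ w : ℝ → ℝ≥0, MemApPlus p₀ (fun x => w x ^ q) →
          ∀ f : ℝ →ₘ[volume] ℂ, weightedNorm w p f < ∞ →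
            ∃ hf : f ∈ T.domain,
              weightedNorm w q (T ⟨f, hf⟩) ≤
                C₀ * φ (ApPlusConst p₀ (fun x => w x ^ q)).toNNReal * weightedNorm w p f) →
        ∀ b : ℝ →ₘ[volume] ℝ, MemBMO b →
          ∀ w : ℝ → ℝ≥0, MemApPlus p₀ (fun x => w x ^ q) →
            ∀ f : ℝ →ₘ[volume] ℂ, weightedNorm w p f < ∞ →
              ∃ hf : f ∈ (iterCommutator b T k).domain,
                weightedNorm w q (iterCommutator b T k ⟨f, hf⟩) ≤
                  C * C₀ * φ (κ * (ApPlusConst p₀ (fun x => w x ^ q)).toNNReal) *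
                    ApPlusConst p₀ (fun x => w x ^ q) ^ ((k : ℝ) * max 1 (1 / (p₀ - 1))) *
                    bmoNorm b ^ k * weightedNorm w p f := by
  have hp0 : 0 < p := by linarith
  have hq0 : 0 < q := by linarith
  obtain ⟨ε, hε, κ, R, hκ, hmain⟩ := exists_apPlusConst_mul_expWeight_mul_eq hp₀
  -- `k! (2q / ε)^k` is `k! / r^k` without the oscillation and `A^+` factors; `R^(1/q)` is the price
  -- of the bounded factor `u`.
  refine ⟨κ, hκ, fun k _ => ⟨(k.factorial * (2 * q / ε) ^ k).toNNReal * R ^ q⁻¹, ?_⟩⟩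
  intro T φ C₀ hT b hb w hw f hf
  replace hT : ∀ w : ℝ → ℝ≥0, MemApPlus p₀ (fun x => w x ^ q) →
      WeightedBound T p q w (C₀ * φ (ApPlusConst p₀ (fun x => w x ^ q)).toNNReal) := by
    intro w hw g hg
    simpa using hT w hw g hg
  set M := max 1 (1 / (p₀ - 1)) with hM
  set t := ApPlusConst p₀ (fun x => w x ^ q) with ht
  have httop : t ≠ ∞ := hw.const_lt_top.ne
  have ht0 : 0 < t.toReal := by
    have h1 := MemApPlus.one_le_two_rpow_mul hp₀ hw
    by_contra h
    rw [← ht, le_antisymm (not_lt.1 h) ENNReal.toReal_nonneg] at h1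
    norm_num at h1
  have hwm : AEMeasurable w volume := hw.aemeasurable_of_rpow hq0
  have hpos : ∀ᵐ x, 0 < w x := by
    filter_upwards [hw.pos] with x hx
    refine pos_iff_ne_zero.2 fun h => ?_
    rw [h, NNReal.zero_rpow hq0.ne'] at hx
    exact hx.false
  set D : ℝ≥0 := R ^ q⁻¹ * (C₀ * φ (κ * t.toNNReal)) with hD
  -- The seminorm of `b` may vanish, so the radius is built from a strictly larger `B`, which
  -- decreases to the seminorm at the end.
  have key : ∀ B : ℝ, 0 < B → bmoNorm b < ENNReal.ofReal B →
      ∃ h : f ∈ (iterCommutator b T k).domain, weightedNorm w q (iterCommutator b T k ⟨f, h⟩) ≤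
        ENNReal.ofReal (k.factorial / (ε / (2 * q * (B * t.toReal ^ M))) ^ k) *
          (D * weightedNorm w p f) := by
    intro B hB hbB
    have hosc := hb.hasMeanOscillationLE hB.le hbB.le
    have htM : 0 < t.toReal ^ M := Real.rpow_pos_of_pos ht0 _
    set r := ε / (2 * q * (B * t.toReal ^ M)) with hr
    have hr0 : 0 < r := by positivity
    have hreq : 2 * r * q * (B * t.toReal ^ M) = ε := by rw [hr]; field_simp
    -- The Cauchy circle needs `|s| ≤ r` only; the range `2r` is for the damped weight.
    have hsmall : ∀ s, |s| ≤ 2 * r → |q * s| * B * t.toReal ^ M ≤ ε := by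
      intro s hs
      rw [abs_mul, abs_of_pos hq0, ← hreq]
      calc q * |s| * B * t.toReal ^ M = |s| * (q * (B * t.toReal ^ M)) := by ring
        _ ≤ 2 * r * (q * (B * t.toReal ^ M)) := by gcongr
        _ = _ := by ring
    have hpert := fun s hs => hmain (fun x => w x ^ q) b B (q * s) hw hb.locallyIntegrable hB hosc
      (hsmall s hs)
    have hbound : ∀ s, |s| ≤ r → WeightedBound T p q (fun x => w x * expWeight s b x) D := by
      intro s hs
      obtain ⟨-, u, hu1, huR, hmem, heq⟩ := hpert s (by linarith)
      have hpow : (fun x => w x ^ q * expWeight (q * s) b x * u x) =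
          fun x => (w x * expWeight s b x) ^ q * u x := by
        funext x
        rw [NNReal.mul_rpow, expWeight_rpow]
      rw [hpow] at hmem heq
      have := weightedBound_of_comparable hp0 hq0 hT (hwm.mul (aemeasurable_expWeight s b))
        hu1 huR hmem
      -- The constant is exactly `κ t` for every `s`, so `φ` is evaluated at one and the same point.
      have hval : (ApPlusConst p₀ fun x => (w x * expWeight s b x) ^ q * u x).toNNReal =
          κ * t.toNNReal := by
        rw [heq, ENNReal.toNNReal_mul, ENNReal.toNNReal_coe]
      simp only [Pi.mul_apply] at this
      rw [hval] at this
      exact this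
    have h2r : |2 * r| ≤ 2 * r := (abs_of_pos (by positivity)).le
    -- Only membership matters here: the resulting operator bound justifies the series and is absent
    -- from the estimate.
    have hdamp : MemApPlus p₀ fun x => dampedWeight w b (2 * r) x ^ q := by
      simp only [dampedWeight_rpow hq0.le]
      exact MemApPlus.min hp₀ (hpert _ h2r).1 (hpert _ (by rwa [abs_neg])).1
    exact exists_weightedNorm_iterCommutator_le hp hq hr0 hwm hpos hbound (hT _ hdamp) hf k
  have hbtop : bmoNorm b ≠ ∞ := hb.norm_lt_top.ne
  obtain ⟨hdom, -⟩ := key ((bmoNorm b).toReal + 1) (by positivity) (by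
    rw [ENNReal.lt_ofReal_iff_toReal_lt hbtop]; linarith)
  refine ⟨hdom, ?_⟩
  set c : ℝ≥0∞ := ENNReal.ofReal (k.factorial * (2 * q / ε) ^ k) * t ^ ((k : ℝ) * M) *
    (D * weightedNorm w p f) with hc
  have hM0 : 0 ≤ M := zero_le_one.trans (le_max_left _ _)
  have hctop : c ≠ ∞ := by
    refine ENNReal.mul_ne_top (ENNReal.mul_ne_top ENNReal.ofReal_ne_top ?_)
      (ENNReal.mul_ne_top ENNReal.coe_ne_top hf.ne)
    exact ENNReal.rpow_ne_top_of_nonneg (by positivity) httop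
  have hfinal : weightedNorm w q (iterCommutator b T k ⟨f, hdom⟩) ≤ c * bmoNorm b ^ k := by
    refine ENNReal.le_mul_pow_of_forall_gt hctop hbtop fun B hB hbB => ?_
    obtain ⟨_, h⟩ := key B hB hbB
    refine h.trans (le_of_eq ?_)
    have e1 : k.factorial / (ε / (2 * q * (B * t.toReal ^ M))) ^ k =
        k.factorial * (2 * q / ε) ^ k * (t.toReal ^ ((k : ℝ) * M)) * B ^ k := by
      have htk : t.toReal ^ ((k : ℝ) * M) = (t.toReal ^ M) ^ k := by
        rw [mul_comm, Real.rpow_mul ht0.le, Real.rpow_natCast]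
      have htM : 0 < t.toReal ^ M := Real.rpow_pos_of_pos ht0 _
      rw [htk]
      simp only [div_pow, mul_pow]
      field_simp
    have e2 : ENNReal.ofReal (t.toReal ^ ((k : ℝ) * M)) = t ^ ((k : ℝ) * M) := by
      rw [← ENNReal.ofReal_rpow_of_pos ht0, ENNReal.ofReal_toReal httop]
    rw [e1, ENNReal.ofReal_mul (by positivity), ENNReal.ofReal_mul (by positivity), e2,
      ENNReal.ofReal_pow hB.le, hc]
    ring
  refine hfinal.trans (le_of_eq ?_)
  rw [hc, hD]
  push_cast
  rw [ENNReal.ofReal]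
  ring
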